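/- Let $\Bbbk$ be a commutative ring and $G$ a finite group. **Spans and Mackey functors.** Let $\mathbb G$ be a $(2,1)$-category with pseudo-pullback squares (Mackey squares) and with finite coproducts stable under them. The category of spans $\mathrm{Span}(\mathbb G)$ has the objects of $\mathbb G$; a morphism $X\to Y$ is a class of spans $X\leftarrow S\to Y$, two spans being identified if there is an equivalence of their middle objects compatible with the legs up to invertible 2-cells. Spans are composed by Mackey squares and added by coproducts of the middle objects. Its $\Bbbk$-linearization $\mathrm{Span}_\Bbbk(\mathbb G)$ is obtained by group completing the Hom monoids and extending scalars to $\Bbbk$. The category $\mathrm{Mack}_\Bbbk(\mathbb G)$ of Mackey functors on $\mathbb G$ consists of the $\Bbbk$-linear functors $\mathrm{Span}_\Bbbk(\mathbb G)\to \Bbbk\text{-Mod}$ and all natural transformations. Consider the following four 2-categories. * $G\text{-set}$: finite $G$-sets, $G$-maps, and only identity 2-cells. Put $\mathrm{Mack}_\Bbbk(G)=\mathrm{Mack}_\Bbbk(G\text{-set})$. * $G\text{-set}^{\mathrm{fus}}$ (fused $G$-sets): finite $G$-sets and $G$-maps; a 2-cell $f\Rightarrow f'$ between $f,f'\colon X\to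 Y$ is a twisting map, i.e. a map $\tau\colon X\to G$ with $\tau(gx)=g\tau(x)g^{-1}$ and $\tau(x)f(x)=f'(x)$ for all $g \in G$, $x\in X$. * $\mathrm{gpd}^f_{/G}$: finite groupoids $H$ with a faithful functor $i_H\colon H\to G$; 1-cells $H\to K$ are pairs of a functor $u\colon H\to K$ and a natural isomorphism $\theta\colon i_Ku\cong i_H$; 2-cells are the natural transformations of functors $H \to K$ compatible with the isomorphisms $\theta$. * $\mathrm{gpd}^{f,\mathrm{fus}}_{/G}$: the same objects and 1-cells, but all natural transformations $u\Rightarrow u'$ as 2-cells. The transport groupoid $G\ltimes X$ (objects the points of $X$, morphisms $x\to y$ the $g\in G$ with $gx=y$), with its projection to $G$, defines 2-functors $G\text{-set}\to \mathrm{gpd}^f_{/G}$ and $G\text{-set}^{\mathrm{fus}}\to \mathrm{gpd}^{f,\mathrm{fus}}_{/G}$. Precomposition with these and with the inclusions gives a commutative square of $\Bbbk$-linear functors $$\begin{array}{ccc}\mathrm{Mack}_\Bbbk(G)&\xleftarrow{\ \simeq\ }&\mathrm{Mack}_\Bbbk(\mathrm{gpd}^f_{/G})\\ \uparrow&&\uparrow\\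 \mathrm{Mack}_\Bbbk(G\text{-set}^{\mathrm{fus}})&\xleftarrow{\ \simeq\ }&\mathrm{Mack}_\Bbbk(\mathrm{gpd}^{f,\mathrm{fus}}_{/G})\end{array}$$ Let $\Phi\colon \mathrm{Mack}_\Bbbk(\mathrm{gpd}^{f,\mathrm{fus}}_{/G})\to\mathrm{Mack}_\Bbbk(G)$ be restriction along $G\ltimes-\colon G\text{-set}\to\mathrm{gpd}^{f,\mathrm{fus}}_{/G}$. **Corollary.** 1. The square commutes, its diagonal is $\Phi$, and its horizontal functors are equivalences. In particular, Mackey functors on fused $G$-sets are equivalent to Mackey functors on $\mathrm{gpd}^{f,\mathrm{fus}}_{/G}$. 2. $\Phi$ is fully faithful, and its essential image is the full subcategory $\mathrm{Mack}^f_\Bbbk(G)\subseteq\mathrm{Mack}_\Bbbk(G)$ of fused Mackey functors of Bouc: those $M$ that are isomorphic to the composite of a $\Bbbk$-linear functor with the canonical functor from $\mathrm{Span}_\Bbbk(G\text{-set})$ to the $\Bbbk$-linearized category of spans of fused $G$-sets. In the latter the morphisms are isomorphism classes of spans in the quotient of the category of finite $G$-sets that identifies two parallel maps $f,f'$ whenever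 there is a twisting map from $f$ to $f'$, and composition is induced by the pullback of finite $G$-sets. 3. $\mathrm{Mack}^f_\Bbbk(G)$ is an abelian subcategory of the abelian category $\mathrm{Mack}_\Bbbk(G)$: it is abelian and its inclusion functor is exact. 4. $\mathrm{Mack}^f_\Bbbk(G)$ consists precisely of the conjugation-invariant Mackey functors: those $M$ such that for every subgroup $H\le G$ and every $a$ in the centralizer $C_G(H)$, the conjugation map of $M(G/H)$ induced by the $G$-map $G/H\to G/H$, $gH\mapsto gaH$, is the identity. -/

import Mathlib

open CategoryTheory Bicategory

universe m w v u w'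

namespace FusedMackey

section

section PseudoPullbackCat

variable {P X Y Z : Type*} [Category* P] [Category* X] [Category* Y] [Category* Z]

/-- A square of functors commuting up to the isomorphisms `γ` is a pseudo-pullback of categories. -/
structure IsPseudoPullback (p : P ⥤ X) (q : P ⥤ Y) (u : X ⥤ Z) (v : Y ⥤ Z)
    (γ : p ⋙ u ≅ q ⋙ v) : Prop where
  lift : ∀ (x : X) (y : Y) (σ : u.obj x ≅ v.obj y), ∃ (t : P) (φ : x ≅ p.obj t) (ψ : q.obj t ≅ y),
    σ.hom = u.map φ.hom ≫ γ.hom.app t ≫ v.map ψ.hom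
  ext : ∀ (t t' : P) (β : p.obj t ⟶ p.obj t') (β' : q.obj t ⟶ q.obj t'),
    u.map β ≫ γ.hom.app t' = γ.hom.app t ≫ v.map β' → ∃! a : t ⟶ t', p.map a = β ∧ q.map a = β'

namespace IsPseudoPullback

variable {p : P ⥤ X} {q : P ⥤ Y} {u : X ⥤ Z} {v : Y ⥤ Z} {γ : p ⋙ u ≅ q ⋙ v}

lemma map_hi (F : X ⥤ Z) {a b : P ⥤ X} (κ : a ≅ b) (t : P) :
    F.map (κ.hom.app t) ≫ F.map (κ.inv.app t) = 𝟙 _ := by simp [← Functor.map_comp]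

lemma map_ih (F : X ⥤ Z) {a b : P ⥤ X} (κ : a ≅ b) (t : P) :
    F.map (κ.inv.app t) ≫ F.map (κ.hom.app t) = 𝟙 _ := by simp [← Functor.map_comp]

lemma map_hi' (F : X ⥤ Z) {a b : P ⥤ X} (κ : a ≅ b) (t : P) {z : Z} (f : F.obj (a.obj t) ⟶ z) :
    F.map (κ.hom.app t) ≫ F.map (κ.inv.app t) ≫ f = f := by simp [← Functor.map_comp_assoc]

lemma map_ih' (F : X ⥤ Z) {a b : P ⥤ X} (κ : a ≅ b) (t : P) {z : Z} (f : F.obj (b.obj t) ⟶ z) :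
    F.map (κ.inv.app t) ≫ F.map (κ.hom.app t) ≫ f = f := by simp [← Functor.map_comp_assoc]

lemma symm (h : IsPseudoPullback p q u v γ) : IsPseudoPullback q p v u γ.symm where
  lift y x σ := by
    obtain ⟨t, φ, ψ, e⟩ := h.lift x y σ.symm
    refine ⟨t, ψ.symm, φ.symm, ?_⟩
    have := congrArg (fun f => σ.hom ≫ f ≫ v.map ψ.inv ≫ γ.inv.app t ≫ u.map φ.inv) e
    simp [← Functor.map_comp_assoc, ← Functor.map_comp] at this
    simpa using this.symm
  ext t t' β β' e := by
    obtain ⟨a, ⟨h1, h2⟩, h3⟩ := h.ext t t' β' β (by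
      have := congrArg (fun f => γ.hom.app t ≫ f ≫ γ.hom.app t') e
      simpa using this.symm)
    exact ⟨a, ⟨h2, h1⟩, fun b hb => h3 b ⟨hb.2, hb.1⟩⟩

lemma paste (h : IsPseudoPullback p q u v γ) {R W : Type*} [Category* R] [Category* W]
    {a : R ⥤ P} {b : R ⥤ W} {w : W ⥤ Y} {δ : a ⋙ q ≅ b ⋙ w} (h' : IsPseudoPullback a b q w δ)
    {a' : R ⥤ X} {w' : W ⥤ Z} (κ : a' ≅ a ⋙ p) (l : w' ≅ w ⋙ v) (ω : a' ⋙ u ≅ b ⋙ w')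
    (hω : ∀ r, ω.hom.app r = u.map (κ.hom.app r) ≫ γ.hom.app (a.obj r) ≫ v.map (δ.hom.app r) ≫
      l.inv.app (b.obj r)) :
    IsPseudoPullback a' b u w' ω where
  lift x y σ := by
    obtain ⟨t, φ, ψ, e⟩ := h.lift x (w.obj y) (σ ≪≫ l.app y)
    obtain ⟨r, φ', ψ', e'⟩ := h'.lift t y ψ
    refine ⟨r, φ ≪≫ p.mapIso φ' ≪≫ (κ.app r).symm, ψ', ?_⟩
    have hn := γ.hom.naturality φ'.hom
    have hl := l.inv.naturality ψ'.hom
    have e2 : σ.hom = u.map φ.hom ≫ γ.hom.app t ≫ v.map ψ.hom ≫ l.inv.app y := by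
      have := congrArg (fun f => f ≫ l.inv.app y) e
      simpa using this
    rw [e2, e', hω]
    simp only [Functor.comp_map] at hn hl
    simp only [Functor.map_comp, Category.assoc, Iso.trans_hom, Functor.mapIso_hom, Iso.symm_hom,
      Iso.app_inv]
    rw [hl, ← reassoc_of% hn]
    simp [map_ih']
  ext r r' β β' e := by
    rw [hω, hω] at e
    obtain ⟨a0, ⟨h1, h2⟩, h3⟩ := h.ext (a.obj r) (a.obj r') (κ.inv.app r ≫ β ≫ κ.hom.app r')
      (δ.hom.app r ≫ w.map β' ≫ δ.inv.app r') (by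
        have hl := l.hom.naturality β'
        have := congrArg (fun f => u.map (κ.inv.app r) ≫ f ≫ l.hom.app _ ≫ v.map (δ.inv.app r')) e
        simp only [Functor.comp_map] at hl
        simp only [Category.assoc, map_ih', reassoc_of% hl] at this
        simpa [map_hi] using this)
    obtain ⟨a1, ⟨k1, k2⟩, k3⟩ := h'.ext r r' a0 β' (by simp [h2])
    have hk : ∀ c : r ⟶ r', a'.map c = κ.hom.app r ≫ p.map (a.map c) ≫ κ.inv.app r' := fun c => by
      have := κ.hom.naturality c
      simp only [Functor.comp_map] at this
      rw [← reassoc_of% this]; simp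
    refine ⟨a1, ⟨by rw [hk, k1, h1]; simp, k2⟩, fun c hc => k3 c ⟨h3 _ ⟨?_, ?_⟩, hc.2⟩⟩
    · rw [← hc.1, hk]; simp
    · have := δ.hom.naturality c
      simp only [Functor.comp_map, hc.2] at this
      rw [← reassoc_of% this]; simp

lemma transport (h : IsPseudoPullback p q u v γ) {X' Y' : Type*} [Category* X'] [Category* Y']
    (E : X ⥤ X') [E.IsEquivalence] (F : Y ⥤ Y') [F.IsEquivalence] {p' : P ⥤ X'} {q' : P ⥤ Y'}
    {u' : X' ⥤ Z} {v' : Y' ⥤ Z} (κ : p' ≅ p ⋙ E) (l : q' ≅ q ⋙ F) (m : u ≅ E ⋙ u')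
    (n : v ≅ F ⋙ v') (γ' : p' ⋙ u' ≅ q' ⋙ v')
    (hγ : ∀ t, γ'.hom.app t = u'.map (κ.hom.app t) ≫ m.inv.app (p.obj t) ≫ γ.hom.app t ≫
      n.hom.app (q.obj t) ≫ v'.map (l.inv.app t)) :
    IsPseudoPullback p' q' u' v' γ' where
  lift x y σ := by
    let ex := E.objObjPreimageIso x
    let ey := F.objObjPreimageIso y
    obtain ⟨t, φ, ψ, e⟩ := h.lift (E.objPreimage x) (F.objPreimage y)
      (m.app _ ≪≫ u'.mapIso ex ≪≫ σ ≪≫ (v'.mapIso ey).symm ≪≫ (n.app _).symm)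
    refine ⟨t, ex.symm ≪≫ E.mapIso φ ≪≫ (κ.app t).symm, l.app t ≪≫ F.mapIso ψ ≪≫ ey, ?_⟩
    have e2 : σ.hom = u'.map ex.inv ≫ m.inv.app _ ≫ (u.map φ.hom ≫ γ.hom.app t ≫ v.map ψ.hom) ≫
        n.hom.app _ ≫ v'.map ey.hom := by
      rw [← e]; simp
    have hm := m.inv.naturality φ.hom
    have hn := n.hom.naturality ψ.hom
    simp only [Functor.comp_map] at hm hn
    rw [e2, hγ]
    simp only [Category.assoc]
    rw [reassoc_of% hn, ← reassoc_of% hm]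
    simp [map_ih']
  ext t t' β β' e := by
    rw [hγ, hγ] at e
    let b := E.preimage (κ.inv.app t ≫ β ≫ κ.hom.app t')
    let b' := F.preimage (l.inv.app t ≫ β' ≫ l.hom.app t')
    have hb : β = κ.hom.app t ≫ E.map b ≫ κ.inv.app t' := by simp [b]
    have hb' : β' = l.hom.app t ≫ F.map b' ≫ l.inv.app t' := by simp [b']
    have hm := m.inv.naturality b
    have hn := n.hom.naturality b'
    simp only [Functor.comp_map] at hm hn
    obtain ⟨a, ⟨h1, h2⟩, h3⟩ := h.ext t t' b b' (by
      rw [hb, hb'] at e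
      have := congrArg (fun f => m.hom.app _ ≫ u'.map (κ.inv.app t) ≫ f ≫ v'.map (l.hom.app t') ≫
        n.inv.app _) e
      simp only [Functor.map_comp, Category.assoc, map_ih'] at this
      rw [← reassoc_of% hn, reassoc_of% hm] at this
      simpa using this)
    have kp : p'.map a = κ.hom.app t ≫ E.map (p.map a) ≫ κ.inv.app t' := by
      have := κ.hom.naturality a
      simp only [Functor.comp_map] at this
      rw [← reassoc_of% this]; simp
    have kq : q'.map a = l.hom.app t ≫ F.map (q.map a) ≫ l.inv.app t' := by
      have := l.hom.naturality a
      simp only [Functor.comp_map] at this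
      rw [← reassoc_of% this]; simp
    refine ⟨a, ⟨by rw [kp, h1, hb], by rw [kq, h2, hb']⟩, fun c hc => h3 c ⟨?_, ?_⟩⟩
    · apply E.map_injective
      have := κ.inv.naturality c
      simp only [Functor.comp_map] at this
      simp [b, ← hc.1]
    · apply F.map_injective
      simp [b', ← hc.2]

end IsPseudoPullback
end PseudoPullbackCat

end

section

section MackeySquares

variable {B : Type u} [Bicategory.{w, v} B]

/-- The invertible 2-cell `γ : p ≫ u ≅ q ≫ v` is a Mackey square (a pseudo-pullback): every other
square over `u, v` factors through it up to isomorphism, and 2-cells into `P` are the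
compatible pairs of 2-cells between components. -/
structure IsMackeySquare {P X Y Z : B} {p : P ⟶ X} {q : P ⟶ Y} {u : X ⟶ Z} {v : Y ⟶ Z}
    (γ : p ≫ u ≅ q ≫ v) : Prop where
  lift : ∀ {T : B} (r : T ⟶ X) (s : T ⟶ Y) (σ : r ≫ u ≅ s ≫ v),
    ∃ (t : T ⟶ P) (φ : r ≅ t ≫ p) (ψ : t ≫ q ≅ s),
      σ.hom = φ.hom ▷ u ≫ ((α_ t p u).hom ≫ t ◁ γ.hom ≫ (α_ t q v).inv) ≫ ψ.hom ▷ v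
  ext : ∀ {T : B} (t t' : T ⟶ P) (β : t ≫ p ⟶ t' ≫ p) (β' : t ≫ q ⟶ t' ≫ q),
    β ▷ u ≫ ((α_ t' p u).hom ≫ t' ◁ γ.hom ≫ (α_ t' q v).inv) =
      ((α_ t p u).hom ≫ t ◁ γ.hom ≫ (α_ t q v).inv) ≫ β' ▷ v →
    ∃! a : t ⟶ t', a ▷ p = β ∧ a ▷ q = β'

/-- `P`, with its legs `p` and `q`, underlies some Mackey square over `u, v`. -/
def IsMackey {P X Y Z : B} (p : P ⟶ X) (q : P ⟶ Y) (u : X ⟶ Z) (v : Y ⟶ Z) : Prop :=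
  ∃ γ : p ≫ u ≅ q ≫ v, IsMackeySquare γ

/-- The effect of a square on the categories of 1-cells out of `T`. -/
def homSquare {P X Y Z : B} {p : P ⟶ X} {q : P ⟶ Y} {u : X ⟶ Z} {v : Y ⟶ Z}
    (γ : p ≫ u ≅ q ≫ v) (T : B) :
    postcomp T p ⋙ postcomp T u ≅ postcomp T q ⋙ postcomp T v :=
  NatIso.ofComponents (fun t => α_ t p u ≪≫ whiskerLeftIso t γ ≪≫ (α_ t q v).symm) (by
    intro t t' a
    dsimp [postcomp]
    simp only [Category.assoc, whiskerLeftIso_hom]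
    rw [associator_naturality_left_assoc, ← whisker_exchange_assoc, associator_inv_naturality_left])

lemma isMackeySquare_iff {P X Y Z : B} {p : P ⟶ X} {q : P ⟶ Y} {u : X ⟶ Z} {v : Y ⟶ Z}
    (γ : p ≫ u ≅ q ≫ v) : IsMackeySquare γ ↔ ∀ T, IsPseudoPullback (postcomp T p) (postcomp T q)
      (postcomp T u) (postcomp T v) (homSquare γ T) :=
  ⟨fun h _ => ⟨h.lift, h.ext⟩, fun h => ⟨fun {T} => (h T).lift, fun {T} => (h T).ext⟩⟩

/-- Postcomposition is pseudofunctorial. -/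
def postcompIso {X Y Z : B} (T : B) {p : X ⟶ Y} {e : Y ⟶ Z} {p' : X ⟶ Z} (κ : p' ≅ p ≫ e) :
    postcomp T p' ≅ postcomp T p ⋙ postcomp T e :=
  NatIso.ofComponents (fun t => whiskerLeftIso t κ ≪≫ (α_ t p e).symm) (by
    intro t t' a
    dsimp [postcomp]
    simp only [Category.assoc, whiskerLeftIso_hom]
    rw [← whisker_exchange_assoc, associator_inv_naturality_left])

lemma postcomp_isEquivalence {X Y : B} (e : X ≌ Y) (T : B) : (postcomp T e.hom).IsEquivalence :=
  (CategoryTheory.Equivalence.mk (postcomp T e.hom) (postcomp T e.inv)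
    (NatIso.ofComponents (fun t => (ρ_ t).symm ≪≫ whiskerLeftIso t e.unit ≪≫ (α_ t _ _).symm) (by
      intro t t' a
      dsimp [postcomp]
      simp only [Category.assoc, whiskerLeftIso_hom]
      rw [rightUnitor_inv_naturality_assoc, ← whisker_exchange_assoc, associator_inv_naturality_left]))
    (NatIso.ofComponents (fun t => α_ t _ _ ≪≫ whiskerLeftIso t e.counit ≪≫ ρ_ t) (by
      intro t t' a
      dsimp [postcomp]
      simp only [Category.assoc, whiskerLeftIso_hom]
      rw [associator_naturality_left_assoc, ← whisker_exchange_assoc, rightUnitor_naturality]))).isEquivalence_functor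

/-- An isomorphism between the components of 1-cells into a Mackey square. -/
lemma IsMackeySquare.isIsomorphic {P X Y Z : B} {p : P ⟶ X} {q : P ⟶ Y} {u : X ⟶ Z} {v : Y ⟶ Z}
    {γ : p ≫ u ≅ q ≫ v} (h : IsMackeySquare γ) {T : B} (t t' : T ⟶ P) (β : t ≫ p ≅ t' ≫ p)
    (β' : t ≫ q ≅ t' ≫ q) (e : β.hom ▷ u ≫ ((α_ t' p u).hom ≫ t' ◁ γ.hom ≫ (α_ t' q v).inv) =
      ((α_ t p u).hom ≫ t ◁ γ.hom ≫ (α_ t q v).inv) ≫ β'.hom ▷ v) : IsIsomorphic t t' := by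
  obtain ⟨a, ha, -⟩ := h.ext t t' β.hom β'.hom e
  obtain ⟨b, hb, -⟩ := h.ext t' t β.inv β'.inv (by
    have := congrArg (fun f => β.inv ▷ u ≫ f ≫ β'.inv ▷ v) e
    simpa using this.symm)
  refine ⟨⟨a, b, ?_, ?_⟩⟩
  · exact (h.ext t t (𝟙 _) (𝟙 _) (by simp)).unique (by simp [ha, hb]) (by simp)
  · exact (h.ext t' t' (𝟙 _) (𝟙 _) (by simp)).unique (by simp [ha, hb]) (by simp)

namespace IsMackey

variable {P X Y Z : B} {p : P ⟶ X} {q : P ⟶ Y} {u : X ⟶ Z} {v : Y ⟶ Z}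

lemma symm (h : IsMackey p q u v) : IsMackey q p v u := by
  obtain ⟨γ, h⟩ := h
  refine ⟨γ.symm, (isMackeySquare_iff _).2 fun T => ?_⟩
  have := ((isMackeySquare_iff _).1 h T).symm
  convert this using 1
  ext t
  change (α_ t q v).hom ≫ t ◁ γ.inv ≫ (α_ t p u).inv =
    ((α_ t q v).hom ≫ t ◁ γ.inv) ≫ (α_ t p u).inv
  simp

lemma transport (h : IsMackey p q u v) {X' Y' : B} (e : X ≌ X') (f : Y ≌ Y') {p' : P ⟶ X'}
    {q' : P ⟶ Y'} {u' : X' ⟶ Z} {v' : Y' ⟶ Z} (hp : IsIsomorphic p' (p ≫ e.hom))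
    (hq : IsIsomorphic q' (q ≫ f.hom)) (hu : IsIsomorphic u (e.hom ≫ u'))
    (hv : IsIsomorphic v (f.hom ≫ v')) : IsMackey p' q' u' v' := by
  obtain ⟨γ, h⟩ := h
  obtain ⟨κ⟩ := hp
  obtain ⟨l⟩ := hq
  obtain ⟨m⟩ := hu
  obtain ⟨n⟩ := hv
  refine ⟨whiskerRightIso κ u' ≪≫ α_ _ _ _ ≪≫ whiskerLeftIso p m.symm ≪≫ γ ≪≫
    whiskerLeftIso q n ≪≫ (α_ _ _ _).symm ≪≫ whiskerRightIso l.symm v',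
    (isMackeySquare_iff _).2 fun T => ?_⟩
  have := postcomp_isEquivalence e T
  have := postcomp_isEquivalence f T
  refine ((isMackeySquare_iff _).1 h T).transport (postcomp T e.hom) (postcomp T f.hom)
    (postcompIso T κ) (postcompIso T l) (postcompIso T m) (postcompIso T n) _ fun t => ?_
  change (α_ t p' u').hom ≫ t ◁ (κ.hom ▷ u' ≫ (α_ _ _ _).hom ≫ p ◁ m.inv ≫ γ.hom ≫ q ◁ n.hom ≫
      (α_ _ _ _).inv ≫ l.inv ▷ v') ≫ (α_ t q' v').inv =
    (t ◁ κ.hom ≫ (α_ t p e.hom).inv) ▷ u' ≫ ((α_ (t ≫ p) e.hom u').hom ≫ (t ≫ p) ◁ m.inv) ≫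
      ((α_ t p u).hom ≫ t ◁ γ.hom ≫ (α_ t q v).inv) ≫ ((t ≫ q) ◁ n.hom ≫ (α_ (t ≫ q) _ _).inv) ≫
      ((α_ t q f.hom).hom ≫ t ◁ l.inv) ▷ v'
  simp

lemma congr (h : IsMackey p q u v) {p' : P ⟶ X} {q' : P ⟶ Y} {u' : X ⟶ Z} {v' : Y ⟶ Z}
    (hp : IsIsomorphic p' p) (hq : IsIsomorphic q' q) (hu : IsIsomorphic u' u)
    (hv : IsIsomorphic v' v) : IsMackey p' q' u' v' :=
  h.transport (Equivalence.id X) (Equivalence.id Y) ⟨hp.some ≪≫ (ρ_ p).symm⟩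
    ⟨hq.some ≪≫ (ρ_ q).symm⟩ ⟨hu.some.symm ≪≫ (λ_ u').symm⟩ ⟨hv.some.symm ≪≫ (λ_ v').symm⟩

lemma paste (h : IsMackey p q u v) {R W : B} {a : R ⟶ P} {b : R ⟶ W} {w : W ⟶ Y}
    (h' : IsMackey a b q w) : IsMackey (a ≫ p) b u (w ≫ v) := by
  obtain ⟨γ, h⟩ := h
  obtain ⟨δ, h'⟩ := h'
  refine ⟨α_ _ _ _ ≪≫ whiskerLeftIso a γ ≪≫ (α_ _ _ _).symm ≪≫ whiskerRightIso δ v ≪≫ α_ _ _ _,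
    (isMackeySquare_iff _).2 fun T => ?_⟩
  refine ((isMackeySquare_iff _).1 h T).paste ((isMackeySquare_iff _).1 h' T)
    (postcompIso T (Iso.refl _)) (postcompIso T (Iso.refl _)) _ fun r => ?_
  change (α_ r (a ≫ p) u).hom ≫ r ◁ ((α_ a p u).hom ≫ a ◁ γ.hom ≫ (α_ a q v).inv ≫ δ.hom ▷ v ≫
      (α_ b w v).hom) ≫ (α_ r b (w ≫ v)).inv =
    (r ◁ 𝟙 _ ≫ (α_ r a p).inv) ▷ u ≫ ((α_ (r ≫ a) p u).hom ≫ (r ≫ a) ◁ γ.hom ≫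
      (α_ (r ≫ a) q v).inv) ≫ ((α_ r a q).hom ≫ r ◁ δ.hom ≫ (α_ r b w).inv) ▷ v ≫
      ((α_ (r ≫ b) w v).hom ≫ (r ≫ b) ◁ 𝟙 _)
  simp

/-- Identities give Mackey squares. -/
lemma id_left (u : X ⟶ Z) : IsMackey u (𝟙 X) (𝟙 Z) u := by
  refine ⟨ρ_ u ≪≫ (λ_ u).symm, ⟨fun {T} r s σ => ?_, fun {T} t t' β β' e => ?_⟩⟩
  · refine ⟨s, (ρ_ r).symm ≪≫ σ, ρ_ s, ?_⟩
    simp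
  · refine ⟨(ρ_ t).inv ≫ β' ≫ (ρ_ t').hom, ⟨?_, by simp⟩, fun a ha => ?_⟩
    · have e2 := congrArg (fun f => (ρ_ _).inv ≫ f ≫ (α_ t' (𝟙 X) u).hom ≫ t' ◁ (λ_ u).hom) e
      simp at e2
      simp [e2]
    · rw [← ha.2]; simp

/-- Two Mackey squares over the same cospan are equivalent. -/
lemma unique (h : IsMackey p q u v) {P' : B} {p' : P' ⟶ X} {q' : P' ⟶ Y}
    (h' : IsMackey p' q' u v) : ∃ e : P ≌ P', IsIsomorphic p (e.hom ≫ p') ∧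
      IsIsomorphic q (e.hom ≫ q') := by
  obtain ⟨γ, h⟩ := h
  obtain ⟨γ', h'⟩ := h'
  have key : ∀ {P P' : B} {p : P ⟶ X} {q : P ⟶ Y} {p' : P' ⟶ X} {q' : P' ⟶ Y}
      {γ : p ≫ u ≅ q ≫ v} {γ' : p' ≫ u ≅ q' ≫ v} (h : IsMackeySquare γ)
      (t : P ⟶ P') (φ : p ≅ t ≫ p') (ψ : t ≫ q' ≅ q) (hg : γ.hom = φ.hom ▷ u ≫
        ((α_ t p' u).hom ≫ t ◁ γ'.hom ≫ (α_ t q' v).inv) ≫ ψ.hom ▷ v)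
      (s : P' ⟶ P) (φ' : p' ≅ s ≫ p) (ψ' : s ≫ q ≅ q') (hg' : γ'.hom = φ'.hom ▷ u ≫
        ((α_ s p u).hom ≫ s ◁ γ.hom ≫ (α_ s q v).inv) ≫ ψ'.hom ▷ v), IsIsomorphic (𝟙 P) (t ≫ s) := by
    intro P P' p q p' q' γ γ' h t φ ψ hg s φ' ψ' hg'
    refine h.isIsomorphic _ _ (λ_ p ≪≫ φ ≪≫ whiskerLeftIso t φ' ≪≫ (α_ _ _ _).symm)
      (λ_ q ≪≫ ψ.symm ≪≫ whiskerLeftIso t ψ'.symm ≪≫ (α_ _ _ _).symm) ?_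
    have e : γ'.hom ≫ ψ'.inv ▷ v = φ'.hom ▷ u ≫
        ((α_ s p u).hom ≫ s ◁ γ.hom ≫ (α_ s q v).inv) := by
      rw [hg']; simp
    have e2 : γ.hom ≫ ψ.inv ▷ v = φ.hom ▷ u ≫
        ((α_ t p' u).hom ≫ t ◁ γ'.hom ≫ (α_ t q' v).inv) := by
      rw [hg]; simp
    have e3 := congrArg (fun f => (α_ t p' u).hom ≫ t ◁ f ≫ (α_ _ _ _).inv) e
    have e4 := congrArg (fun f => (λ_ p).hom ▷ u ≫ f ≫ (t ◁ ψ'.inv) ▷ v ≫ (α_ _ _ _).inv ▷ v) e2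
    simp at e3 e4 ⊢
    rw [e4, reassoc_of% e3]
    simp
  obtain ⟨t, φ, ψ, hg⟩ := h'.lift p q γ
  obtain ⟨s, φ', ψ', hg'⟩ := h.lift p' q' γ'
  obtain ⟨η⟩ := key h t φ ψ hg s φ' ψ' hg'
  obtain ⟨θ⟩ := key h' s φ' ψ' hg' t φ ψ hg
  exact ⟨Equivalence.mkOfAdjointifyCounit η θ.symm, ⟨φ⟩, ⟨ψ.symm⟩⟩

end IsMackey
end MackeySquares

end

section

section Spans

variable {B : Type u} [Bicategory.{w, v} B]

lemma isIsomorphic_comp {X Y Z : B} {f f' : X ⟶ Y} {g g' : Y ⟶ Z} (hf : IsIsomorphic f f')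
    (hg : IsIsomorphic g g') : IsIsomorphic (f ≫ g) (f' ≫ g') :=
  ⟨whiskerRightIso hf.some g ≪≫ whiskerLeftIso f' hg.some⟩

lemma isIsomorphic_refl {X Y : B} (f : X ⟶ Y) : IsIsomorphic f f := ⟨Iso.refl f⟩

lemma isIsomorphic_symm {X Y : B} {f g : X ⟶ Y} (h : IsIsomorphic f g) : IsIsomorphic g f :=
  ⟨h.some.symm⟩

lemma isIsomorphic_trans {X Y : B} {f g h : X ⟶ Y} (h₁ : IsIsomorphic f g)
    (h₂ : IsIsomorphic g h) : IsIsomorphic f h := ⟨h₁.some ≪≫ h₂.some⟩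

variable (B) in
/-- The 1-truncation of a bicategory: the same objects, and isomorphism classes of 1-cells. -/
structure Trunc where
  /-- The underlying object. -/
  as : B

instance : Category (Trunc B) where
  Hom X Y := Quotient (isIsomorphicSetoid (X.as ⟶ Y.as))
  id X := Quotient.mk _ (𝟙 X.as)
  comp f g := Quotient.map₂ (fun f g => f ≫ g) (fun _ _ hf _ _ hg => isIsomorphic_comp hf hg) f g
  id_comp f := by
    induction f using Quotient.inductionOn
    exact Quotient.sound ⟨λ_ _⟩
  comp_id f := by
    induction f using Quotient.inductionOn
    exact Quotient.sound ⟨ρ_ _⟩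
  assoc f g h := by
    induction f using Quotient.inductionOn
    induction g using Quotient.inductionOn
    induction h using Quotient.inductionOn
    exact Quotient.sound ⟨α_ _ _ _⟩

/-- The class of a 1-cell. -/
def cl {X Y : B} (f : X ⟶ Y) : Trunc.mk X ⟶ Trunc.mk Y := Quotient.mk _ f

lemma cl_eq_iff {X Y : B} {f g : X ⟶ Y} : cl f = cl g ↔ IsIsomorphic f g :=
  ⟨fun h => Quotient.exact h, fun h => Quotient.sound h⟩

lemma cl_comp {X Y Z : B} (f : X ⟶ Y) (g : Y ⟶ Z) : cl (f ≫ g) = cl f ≫ cl g := rfl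

lemma cl_id (X : B) : cl (𝟙 X) = 𝟙 _ := rfl

lemma cl_surj {X Y : B} (f : Trunc.mk X ⟶ Trunc.mk Y) : ∃ g : X ⟶ Y, cl g = f :=
  Quotient.exists_rep f

/-- A 1-cell is an equivalence if it is invertible up to invertible 2-cells. -/
def IsEquivalenceCell {X Y : B} (f : X ⟶ Y) : Prop :=
  ∃ g : Y ⟶ X, IsIsomorphic (f ≫ g) (𝟙 X) ∧ IsIsomorphic (g ≫ f) (𝟙 Y)

lemma isEquivalenceCell_iff {X Y : B} {f : X ⟶ Y} : IsEquivalenceCell f ↔ IsIso (cl f) := by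
  constructor
  · rintro ⟨g, h₁, h₂⟩
    exact ⟨cl g, cl_eq_iff.2 h₁, cl_eq_iff.2 h₂⟩
  · rintro ⟨g, h₁, h₂⟩
    obtain ⟨g, rfl⟩ := cl_surj g
    exact ⟨g, cl_eq_iff.1 h₁, cl_eq_iff.1 h₂⟩

lemma IsEquivalenceCell.exists_equivalence {X Y : B} {f : X ⟶ Y} (h : IsEquivalenceCell f) :
    ∃ e : X ≌ Y, e.hom = f := by
  obtain ⟨g, ⟨a⟩, ⟨b⟩⟩ := h
  exact ⟨Equivalence.mkOfAdjointifyCounit a.symm b, rfl⟩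

lemma isEquivalenceCell_hom {X Y : B} (e : X ≌ Y) : IsEquivalenceCell e.hom :=
  ⟨e.inv, ⟨e.unit.symm⟩, ⟨e.counit⟩⟩

/-- The 1-cells `i, j` exhibit `W` as a coproduct of `X` and `Y`: for every `T`, the functor
`Hom(W, T) ⥤ Hom(X, T) × Hom(Y, T)` is an equivalence. -/
structure IsCoproduct {X Y W : B} (i : X ⟶ W) (j : Y ⟶ W) : Prop where
  desc : ∀ {T : B} (f : X ⟶ T) (g : Y ⟶ T), ∃ t : W ⟶ T,
    IsIsomorphic (i ≫ t) f ∧ IsIsomorphic (j ≫ t) g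
  ext : ∀ {T : B} (t t' : W ⟶ T) (a : i ≫ t ⟶ i ≫ t') (b : j ≫ t ⟶ j ≫ t'),
    ∃! c : t ⟶ t', i ◁ c = a ∧ j ◁ c = b

/-- `E` is initial: every category `Hom(E, T)` is equivalent to the final category. -/
structure IsInitialObject (E : B) : Prop where
  desc : ∀ T : B, Nonempty (E ⟶ T)
  ext : ∀ {T : B} (t t' : E ⟶ T), ∃! _c : t ⟶ t', True

namespace IsCoproduct
variable {X Y W : B} {i : X ⟶ W} {j : Y ⟶ W}

lemma isIsomorphic (h : IsCoproduct i j) {T : B} {t t' : W ⟶ T}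
    (a : IsIsomorphic (i ≫ t) (i ≫ t')) (b : IsIsomorphic (j ≫ t) (j ≫ t')) :
    IsIsomorphic t t' := by
  obtain ⟨a⟩ := a
  obtain ⟨b⟩ := b
  obtain ⟨c, hc, -⟩ := h.ext t t' a.hom b.hom
  obtain ⟨d, hd, -⟩ := h.ext t' t a.inv b.inv
  exact ⟨⟨c, d, (h.ext t t (𝟙 _) (𝟙 _)).unique (by simp [hc, hd]) (by simp),
    (h.ext t' t' (𝟙 _) (𝟙 _)).unique (by simp [hc, hd]) (by simp)⟩⟩

lemma symm (h : IsCoproduct i j) : IsCoproduct j i where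
  desc f g := by
    obtain ⟨t, h₁, h₂⟩ := h.desc g f
    exact ⟨t, h₂, h₁⟩
  ext t t' a b := by
    obtain ⟨c, ⟨h₁, h₂⟩, h₃⟩ := h.ext t t' b a
    exact ⟨c, ⟨h₂, h₁⟩, fun d hd => h₃ d ⟨hd.2, hd.1⟩⟩

/-- The coproduct in the 1-truncation. -/
lemma hom_ext (h : IsCoproduct i j) {T : B} {t t' : Trunc.mk W ⟶ Trunc.mk T}
    (a : cl i ≫ t = cl i ≫ t') (b : cl j ≫ t = cl j ≫ t') : t = t' := by
  obtain ⟨t, rfl⟩ := cl_surj t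
  obtain ⟨t', rfl⟩ := cl_surj t'
  exact cl_eq_iff.2 (h.isIsomorphic (cl_eq_iff.1 a) (cl_eq_iff.1 b))

lemma exists_desc (h : IsCoproduct i j) {T : B} (f : Trunc.mk X ⟶ Trunc.mk T)
    (g : Trunc.mk Y ⟶ Trunc.mk T) :
    ∃ t : Trunc.mk W ⟶ Trunc.mk T, cl i ≫ t = f ∧ cl j ≫ t = g := by
  obtain ⟨f, rfl⟩ := cl_surj f
  obtain ⟨g, rfl⟩ := cl_surj g
  obtain ⟨t, h₁, h₂⟩ := h.desc f g
  exact ⟨cl t, cl_eq_iff.2 h₁, cl_eq_iff.2 h₂⟩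

end IsCoproduct

lemma IsInitialObject.hom_ext {E : B} (h : IsInitialObject E) {T : B}
    (t t' : Trunc.mk E ⟶ Trunc.mk T) : t = t' := by
  obtain ⟨t, rfl⟩ := cl_surj t
  obtain ⟨t', rfl⟩ := cl_surj t'
  obtain ⟨c, -, -⟩ := h.ext t t'
  obtain ⟨d, -, -⟩ := h.ext t' t
  exact cl_eq_iff.2 ⟨⟨c, d, (h.ext t t).unique trivial trivial,
    (h.ext t' t').unique trivial trivial⟩⟩

variable (B) in
/-- A (2,1)-category with Mackey squares, and with finite coproducts which are stable under
Mackey squares, as in every extensive 2-category. -/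
class Spannable : Prop where
  isIso_cell : ∀ {X Y : B} {f g : X ⟶ Y} (a : f ⟶ g), IsIso a
  mackey : ∀ {X Y Z : B} (u : X ⟶ Z) (v : Y ⟶ Z), ∃ (P : B) (p : P ⟶ X) (q : P ⟶ Y),
    IsMackey p q u v
  coproduct : ∀ X Y : B, ∃ (W : B) (i : X ⟶ W) (j : Y ⟶ W), IsCoproduct i j ∧
    ∀ {T : B} (c : T ⟶ W), ∃ (T₁ T₂ : B) (t₁ : T₁ ⟶ T) (a : T₁ ⟶ X) (t₂ : T₂ ⟶ T) (b : T₂ ⟶ Y),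
      IsMackey a t₁ i c ∧ IsMackey b t₂ j c ∧ IsCoproduct t₁ t₂
  initial : ∃ E : B, IsInitialObject E
  strict_initial : ∀ {E T : B} (_ : T ⟶ E), IsInitialObject E → IsInitialObject T

/-- A span `X ← S → Y` of 1-cells. -/
structure Span (X Y : B) where
  /-- The middle object. -/
  apex : B
  /-- The backward leg. -/
  left : apex ⟶ X
  /-- The forward leg. -/
  right : apex ⟶ Y

namespace Span

variable {X Y Z W : B}

/-- Equivalence of spans: an equivalence of the middle objects, compatible with the legs up to
invertible 2-cells. -/
def Equiv (S S' : Span X Y) : Prop :=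
  ∃ s : S.apex ⟶ S'.apex, IsEquivalenceCell s ∧ IsIsomorphic S.left (s ≫ S'.left) ∧
    IsIsomorphic S.right (s ≫ S'.right)

lemma equiv_iff {S S' : Span X Y} : S.Equiv S' ↔ ∃ s : Trunc.mk S.apex ≅ Trunc.mk S'.apex,
    cl S.left = s.hom ≫ cl S'.left ∧ cl S.right = s.hom ≫ cl S'.right := by
  constructor
  · rintro ⟨s, h, h₁, h₂⟩
    have := isEquivalenceCell_iff.1 h
    exact ⟨asIso (cl s), cl_eq_iff.2 h₁, cl_eq_iff.2 h₂⟩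
  · rintro ⟨s, h₁, h₂⟩
    obtain ⟨f, hf⟩ := cl_surj s.hom
    rw [← hf] at h₁ h₂
    exact ⟨f, isEquivalenceCell_iff.2 (hf ▸ inferInstance), cl_eq_iff.1 h₁, cl_eq_iff.1 h₂⟩

lemma Equiv.refl (S : Span X Y) : S.Equiv S := equiv_iff.2 ⟨Iso.refl _, by simp, by simp⟩

lemma Equiv.symm {S S' : Span X Y} (h : S.Equiv S') : S'.Equiv S := by
  obtain ⟨s, h₁, h₂⟩ := equiv_iff.1 h
  exact equiv_iff.2 ⟨s.symm, by simp [h₁], by simp [h₂]⟩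

lemma Equiv.trans {S S' S'' : Span X Y} (h : S.Equiv S') (h' : S'.Equiv S'') : S.Equiv S'' := by
  obtain ⟨s, h₁, h₂⟩ := equiv_iff.1 h
  obtain ⟨s', h₁', h₂'⟩ := equiv_iff.1 h'
  exact equiv_iff.2 ⟨s ≪≫ s', by simp [h₁, h₁'], by simp [h₂, h₂']⟩

lemma Equiv.of_flip {S S' : Span X Y} (h : Equiv (Span.mk S.apex S.right S.left)
    (Span.mk S'.apex S'.right S'.left)) : S.Equiv S' := by
  obtain ⟨s, h, h₁, h₂⟩ := h
  exact ⟨s, h, h₂, h₁⟩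

instance setoid (X Y : B) : Setoid (Span X Y) := ⟨Equiv, Equiv.refl, Equiv.symm, Equiv.trans⟩

/-- `R` is a composite of `S` and `T`, formed along a Mackey square. -/
def IsComp (S : Span X Y) (T : Span Y Z) (R : Span X Z) : Prop :=
  ∃ (p : R.apex ⟶ S.apex) (q : R.apex ⟶ T.apex), IsMackey p q S.right T.left ∧
    IsIsomorphic R.left (p ≫ S.left) ∧ IsIsomorphic R.right (q ≫ T.right)

/-- `R` is a sum of `S` and `T`, formed by a coproduct of the middle objects. -/
def IsSum (S T R : Span X Y) : Prop :=
  ∃ (i : S.apex ⟶ R.apex) (j : T.apex ⟶ R.apex), IsCoproduct i j ∧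
    IsIsomorphic (i ≫ R.left) S.left ∧ IsIsomorphic (j ≫ R.left) T.left ∧
    IsIsomorphic (i ≫ R.right) S.right ∧ IsIsomorphic (j ≫ R.right) T.right

/-- The reversed span. -/
def flip (S : Span X Y) : Span Y X := ⟨S.apex, S.right, S.left⟩

lemma IsComp.flip {S : Span X Y} {T : Span Y Z} {R : Span X Z} (h : IsComp S T R) :
    IsComp T.flip S.flip R.flip := by
  obtain ⟨p, q, h, h₁, h₂⟩ := h
  exact ⟨q, p, h.symm, h₂, h₁⟩

lemma IsSum.flip {S T R : Span X Y} (h : IsSum S T R) : IsSum S.flip T.flip R.flip := by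
  obtain ⟨i, j, h, h₁, h₂, h₃, h₄⟩ := h
  exact ⟨i, j, h, h₃, h₄, h₁, h₂⟩

lemma IsComp.equiv {S S' : Span X Y} {T T' : Span Y Z} {R R' : Span X Z} (h : IsComp S T R)
    (h' : IsComp S' T' R') (hS : S.Equiv S') (hT : T.Equiv T') : R.Equiv R' := by
  obtain ⟨p, q, h, h₁, h₂⟩ := h
  obtain ⟨p', q', h', h₁', h₂'⟩ := h'
  obtain ⟨s, es, hs₁, hs₂⟩ := hS
  obtain ⟨t, et, ht₁, ht₂⟩ := hT
  obtain ⟨f, rfl⟩ := es.exists_equivalence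
  obtain ⟨g, rfl⟩ := et.exists_equivalence
  obtain ⟨e, he₁, he₂⟩ := (h.transport f g (isIsomorphic_refl _) (isIsomorphic_refl _)
    hs₂ ht₁).unique h'
  refine ⟨e.hom, isEquivalenceCell_hom e, ?_, ?_⟩
  · rw [← cl_eq_iff] at *
    simp only [cl_comp] at *
    rw [h₁, h₁', hs₁, ← reassoc_of% he₁]
  · rw [← cl_eq_iff] at *
    simp only [cl_comp] at *
    rw [h₂, h₂', ht₂, ← reassoc_of% he₂]

lemma IsSum.equiv {S S' T T' R R' : Span X Y} (h : IsSum S T R)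
    (h' : IsSum S' T' R') (hS : S.Equiv S') (hT : T.Equiv T') : R.Equiv R' := by
  obtain ⟨i, j, h, h₁, h₂, h₃, h₄⟩ := h
  obtain ⟨i', j', h', h₁', h₂', h₃', h₄'⟩ := h'
  obtain ⟨s, hs₁, hs₂⟩ := equiv_iff.1 hS
  obtain ⟨t, ht₁, ht₂⟩ := equiv_iff.1 hT
  rw [← cl_eq_iff, cl_comp] at *
  obtain ⟨f, hf₁, hf₂⟩ := h.exists_desc (s.hom ≫ cl i') (t.hom ≫ cl j')
  obtain ⟨g, hg₁, hg₂⟩ := h'.exists_desc (s.inv ≫ cl i) (t.inv ≫ cl j)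
  refine equiv_iff.2 ⟨⟨f, g, h.hom_ext ?_ ?_, h'.hom_ext ?_ ?_⟩, h.hom_ext ?_ ?_, h.hom_ext ?_ ?_⟩
  · rw [reassoc_of% hf₁, hg₁]; simp
  · rw [reassoc_of% hf₂, hg₂]; simp
  · rw [reassoc_of% hg₁, hf₁]; simp
  · rw [reassoc_of% hg₂, hf₂]; simp
  · rw [h₁, reassoc_of% hf₁, h₁', hs₁]
  · rw [h₂, reassoc_of% hf₂, h₂', ht₁]
  · rw [h₃, reassoc_of% hf₁, h₃', hs₂]
  · rw [h₄, reassoc_of% hf₂, h₄', ht₂]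

lemma IsSum.symm {S T R : Span X Y} (h : IsSum S T R) : IsSum T S R := by
  obtain ⟨i, j, h, h₁, h₂, h₃, h₄⟩ := h
  exact ⟨j, i, h.symm, h₂, h₁, h₄, h₃⟩

lemma IsSum.assoc {S₁ S₂ S₃ A D R R' : Span X Y} (h : IsSum S₁ S₂ A) (k : IsSum A S₃ R)
    (h' : IsSum S₂ S₃ D) (k' : IsSum S₁ D R') : R.Equiv R' := by
  obtain ⟨i, j, h, h₁, h₂, h₃, h₄⟩ := h
  obtain ⟨a, b, k, k₁, k₂, k₃, k₄⟩ := k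
  obtain ⟨i', j', h', h₁', h₂', h₃', h₄'⟩ := h'
  obtain ⟨a', b', k', k₁', k₂', k₃', k₄'⟩ := k'
  rw [← cl_eq_iff, cl_comp] at *
  obtain ⟨f₀, hf₀, hf₁⟩ := h.exists_desc (cl a') (cl i' ≫ cl b')
  obtain ⟨f, hf₂, hf₃⟩ := k.exists_desc f₀ (cl j' ≫ cl b')
  obtain ⟨g₀, hg₀, hg₁⟩ := h'.exists_desc (cl j ≫ cl a) (cl b)
  obtain ⟨g, hg₂, hg₃⟩ := k'.exists_desc (cl i ≫ cl a) g₀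
  refine equiv_iff.2 ⟨⟨f, g, k.hom_ext (h.hom_ext ?_ ?_) ?_, k'.hom_ext ?_ (h'.hom_ext ?_ ?_)⟩,
    k.hom_ext (h.hom_ext ?_ ?_) ?_, k.hom_ext (h.hom_ext ?_ ?_) ?_⟩
  · rw [reassoc_of% hf₂, reassoc_of% hf₀, hg₂]; simp
  · rw [reassoc_of% hf₂, reassoc_of% hf₁, hg₃, hg₀]; simp
  · rw [reassoc_of% hf₃, hg₃, hg₁]; simp
  · rw [reassoc_of% hg₂, hf₂, hf₀]; simp
  · rw [reassoc_of% hg₃, reassoc_of% hg₀, hf₂, hf₁]; simp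
  · rw [reassoc_of% hg₃, reassoc_of% hg₁, hf₃]; simp
  · rw [k₁, h₁, reassoc_of% hf₂, reassoc_of% hf₀, k₁']
  · rw [k₁, h₂, reassoc_of% hf₂, reassoc_of% hf₁, k₂', h₁']
  · rw [k₂, reassoc_of% hf₃, k₂', h₂']
  · rw [k₃, h₃, reassoc_of% hf₂, reassoc_of% hf₀, k₃']
  · rw [k₃, h₄, reassoc_of% hf₂, reassoc_of% hf₁, k₄', h₃']
  · rw [k₄, reassoc_of% hf₃, k₄', h₄']

lemma isSum_initial (S Z : Span X Y) (h : IsInitialObject Z.apex) {R : Span X Y}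
    (hR : IsSum Z S R) : R.Equiv S := by
  obtain ⟨i, j, k, k₁, k₂, k₃, k₄⟩ := hR
  rw [← cl_eq_iff, cl_comp] at *
  obtain ⟨z⟩ := h.desc S.apex
  obtain ⟨f, hf₁, hf₂⟩ := k.exists_desc (cl z) (𝟙 _)
  refine equiv_iff.2 ⟨⟨f, cl j, k.hom_ext (h.hom_ext _ _) ?_, hf₂⟩, k.hom_ext (h.hom_ext _ _) ?_,
    k.hom_ext (h.hom_ext _ _) ?_⟩
  · rw [reassoc_of% hf₂]; simp
  · rw [k₂, reassoc_of% hf₂]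
  · rw [k₄, reassoc_of% hf₂]

lemma equiv_of_initial {S S' : Span X Y} (h : IsInitialObject S.apex)
    (h' : IsInitialObject S'.apex) : S.Equiv S' := by
  obtain ⟨z⟩ := h.desc S'.apex
  obtain ⟨z'⟩ := h'.desc S.apex
  exact equiv_iff.2 ⟨⟨cl z, cl z', h.hom_ext _ _, h'.hom_ext _ _⟩, h.hom_ext _ _, h.hom_ext _ _⟩

lemma isComp_id_left (S : Span X Y) : IsComp ⟨X, 𝟙 X, 𝟙 X⟩ S S :=
  ⟨S.left, 𝟙 _, IsMackey.id_left S.left, ⟨(ρ_ _).symm⟩, ⟨(λ_ _).symm⟩⟩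

section
variable [Spannable B]

lemma exists_isComp (S : Span X Y) (T : Span Y Z) : ∃ R, IsComp S T R := by
  obtain ⟨P, p, q, h⟩ := Spannable.mackey S.right T.left
  exact ⟨⟨P, p ≫ S.left, q ≫ T.right⟩, p, q, h, isIsomorphic_refl _, isIsomorphic_refl _⟩

lemma exists_isSum (S T : Span X Y) : ∃ R, IsSum S T R := by
  obtain ⟨W, i, j, h, -⟩ := Spannable.coproduct S.apex T.apex
  obtain ⟨l, h₁, h₂⟩ := h.desc S.left T.left
  obtain ⟨r, h₃, h₄⟩ := h.desc S.right T.right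
  exact ⟨⟨W, l, r⟩, i, j, h, h₁, h₂, h₃, h₄⟩

lemma exists_initial (X Y : B) : ∃ S : Span X Y, IsInitialObject S.apex := by
  obtain ⟨E, h⟩ := Spannable.initial (B := B)
  exact ⟨⟨E, (h.desc X).some, (h.desc Y).some⟩, h⟩

lemma IsComp.assoc {S : Span X Y} {T : Span Y Z} {U : Span Z W} {A : Span X Z} {D : Span Y W}
    {R R' : Span X W} (h : IsComp S T A) (k : IsComp A U R) (h' : IsComp T U D)
    (k' : IsComp S D R') : R.Equiv R' := by
  obtain ⟨p, q, h, h₁, h₂⟩ := h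
  obtain ⟨p', q', h', h₁', h₂'⟩ := h'
  obtain ⟨Q, a, b, m⟩ := Spannable.mackey q p'
  have e₁ : IsComp A U ⟨Q, a ≫ A.left, b ≫ D.right⟩ :=
    ⟨a, b ≫ q', (h'.symm.paste m.symm).symm.congr (isIsomorphic_refl _) (isIsomorphic_refl _) h₂
      (isIsomorphic_refl _), isIsomorphic_refl _,
      isIsomorphic_trans (isIsomorphic_comp (isIsomorphic_refl b) h₂') ⟨(α_ _ _ _).symm⟩⟩
  have e₂ : IsComp S D ⟨Q, a ≫ A.left, b ≫ D.right⟩ :=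
    ⟨a ≫ p, b, (h.paste m).congr (isIsomorphic_refl _) (isIsomorphic_refl _) (isIsomorphic_refl _)
      h₁', isIsomorphic_trans (isIsomorphic_comp (isIsomorphic_refl a) h₁) ⟨(α_ _ _ _).symm⟩,
      isIsomorphic_refl _⟩
  exact (k.equiv e₁ (Equiv.refl _) (Equiv.refl _)).trans
    (e₂.equiv k' (Equiv.refl _) (Equiv.refl _))

lemma IsSum.comp {S₁ S₂ S : Span X Y} {T : Span Y Z} {R₁ R₂ R D : Span X Z} (hS : IsSum S₁ S₂ S)
    (h : IsComp S T R) (h₁ : IsComp S₁ T R₁) (h₂ : IsComp S₂ T R₂) (hD : IsSum R₁ R₂ D) :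
    R.Equiv D := by
  obtain ⟨W, i, j, c, hc⟩ := Spannable.coproduct S₁.apex S₂.apex
  obtain ⟨l, hl₁, hl₂⟩ := c.desc S₁.left S₂.left
  obtain ⟨r, hr₁, hr₂⟩ := c.desc S₁.right S₂.right
  have hS' : IsSum S₁ S₂ ⟨W, l, r⟩ := ⟨i, j, c, hl₁, hl₂, hr₁, hr₂⟩
  obtain ⟨P, p, q, m⟩ := Spannable.mackey r T.left
  have e : IsComp ⟨W, l, r⟩ T ⟨P, p ≫ l, q ≫ T.right⟩ :=
    ⟨p, q, m, isIsomorphic_refl _, isIsomorphic_refl _⟩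
  obtain ⟨P₁, P₂, t₁, a, t₂, b, m₁, m₂, c'⟩ := hc p
  have e₁ : IsComp S₁ T ⟨P₁, t₁ ≫ p ≫ l, t₁ ≫ q ≫ T.right⟩ := by
    refine ⟨a, t₁ ≫ q, (m.symm.paste m₁.symm).symm.congr (isIsomorphic_refl _)
      (isIsomorphic_refl _) (isIsomorphic_symm hr₁) (isIsomorphic_refl _), ?_,
      ⟨(α_ _ _ _).symm⟩⟩
    obtain ⟨γ, -⟩ := m₁
    have hγ := cl_eq_iff.2 ⟨γ⟩
    rw [← cl_eq_iff] at *
    simp only [cl_comp] at *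
    rw [← hl₁, ← reassoc_of% hγ]
  have e₂ : IsComp S₂ T ⟨P₂, t₂ ≫ p ≫ l, t₂ ≫ q ≫ T.right⟩ := by
    refine ⟨b, t₂ ≫ q, (m.symm.paste m₂.symm).symm.congr (isIsomorphic_refl _)
      (isIsomorphic_refl _) (isIsomorphic_symm hr₂) (isIsomorphic_refl _), ?_,
      ⟨(α_ _ _ _).symm⟩⟩
    obtain ⟨γ, -⟩ := m₂
    have hγ := cl_eq_iff.2 ⟨γ⟩
    rw [← cl_eq_iff] at *
    simp only [cl_comp] at *
    rw [← hl₂, ← reassoc_of% hγ]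
  have e₃ : IsSum ⟨P₁, t₁ ≫ p ≫ l, t₁ ≫ q ≫ T.right⟩ ⟨P₂, t₂ ≫ p ≫ l, t₂ ≫ q ≫ T.right⟩
      ⟨P, p ≫ l, q ≫ T.right⟩ := ⟨t₁, t₂, c', isIsomorphic_refl _, isIsomorphic_refl _,
        isIsomorphic_refl _, isIsomorphic_refl _⟩
  have r₁ := Equiv.refl S₁
  have r₂ := Equiv.refl S₂
  have rT := Equiv.refl T
  exact (h.equiv e (hS.equiv hS' r₁ r₂) rT).trans
    (e₃.equiv hD (e₁.equiv h₁ r₁ rT) (e₂.equiv h₂ r₂ rT))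

lemma IsComp.initial {S : Span X Y} {T : Span Y Z} {R : Span X Z} (h : IsComp S T R)
    (hS : IsInitialObject S.apex) : IsInitialObject R.apex := by
  obtain ⟨p, -⟩ := h
  exact Spannable.strict_initial p hS

lemma IsComp.initial' {S : Span X Y} {T : Span Y Z} {R : Span X Z} (h : IsComp S T R)
    (hT : IsInitialObject T.apex) : IsInitialObject R.apex := by
  obtain ⟨-, q, -⟩ := h
  exact Spannable.strict_initial q hT

end
end Span

variable (B) in
/-- The category of spans of a spannable (2,1)-category. -/
structure SpanCat where
  /-- The underlying object. -/
  as : B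

/-- A category enriched in commutative monoids. -/
class MonoidEnriched (C : Type*) [Category* C] where
  addCommMonoid : ∀ X Y : C, AddCommMonoid (X ⟶ Y)
  add_comp : ∀ {X Y Z : C} (f g : X ⟶ Y) (h : Y ⟶ Z), (f + g) ≫ h = f ≫ h + g ≫ h
  comp_add : ∀ {X Y Z : C} (f : X ⟶ Y) (g h : Y ⟶ Z), f ≫ (g + h) = f ≫ g + f ≫ h
  zero_comp : ∀ {X Y Z : C} (h : Y ⟶ Z), (0 : X ⟶ Y) ≫ h = 0
  comp_zero : ∀ {X Y Z : C} (f : X ⟶ Y), f ≫ (0 : Y ⟶ Z) = 0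

attribute [reducible, instance] MonoidEnriched.addCommMonoid

section
variable [Spannable B]

/-- The composite of two spans, along a chosen Mackey square. -/
noncomputable def Span.comp {X Y Z : B} (S : Span X Y) (T : Span Y Z) : Span X Z :=
  (Span.exists_isComp S T).choose

lemma Span.isComp {X Y Z : B} (S : Span X Y) (T : Span Y Z) : Span.IsComp S T (S.comp T) :=
  (Span.exists_isComp S T).choose_spec

/-- The sum of two spans, along a chosen coproduct. -/
noncomputable def Span.add {X Y : B} (S T : Span X Y) : Span X Y :=
  (Span.exists_isSum S T).choose

lemma Span.isSum {X Y : B} (S T : Span X Y) : Span.IsSum S T (S.add T) :=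
  (Span.exists_isSum S T).choose_spec

/-- The zero span, with a chosen initial object in the middle. -/
noncomputable def Span.zero (X Y : B) : Span X Y := (Span.exists_initial X Y).choose

lemma Span.isInitial_zero (X Y : B) : IsInitialObject (Span.zero X Y).apex :=
  (Span.exists_initial X Y).choose_spec

/-- Morphisms are equivalence classes of spans; composition is along Mackey squares. -/
noncomputable instance : Category (SpanCat B) where
  Hom X Y := Quotient (Span.setoid X.as Y.as)
  id X := Quotient.mk _ ⟨X.as, 𝟙 X.as, 𝟙 X.as⟩
  comp f g := Quotient.map₂ Span.comp
    (fun _ _ hS _ _ hT => (Span.isComp _ _).equiv (Span.isComp _ _) hS hT) f g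
  id_comp f := by
    induction f using Quotient.inductionOn
    exact Quotient.sound ((Span.isComp _ _).equiv (Span.isComp_id_left _) (.refl _) (.refl _))
  comp_id f := by
    induction f using Quotient.inductionOn with
    | h S => exact Quotient.sound ((Span.isComp _ _).equiv (Span.isComp_id_left S.flip).flip
        (.refl _) (.refl _))
  assoc f g h := by
    induction f using Quotient.inductionOn
    induction g using Quotient.inductionOn
    induction h using Quotient.inductionOn
    exact Quotient.sound ((Span.isComp _ _).assoc (Span.isComp _ _) (Span.isComp _ _)
      (Span.isComp _ _))

/-- The class of a span, as a morphism of the category of spans. -/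
def Span.toHom {X Y : B} (S : Span X Y) : SpanCat.mk X ⟶ SpanCat.mk Y := Quotient.mk _ S

lemma Span.IsComp.toHom {X Y Z : B} {S : Span X Y} {T : Span Y Z} {R : Span X Z}
    (h : IsComp S T R) : S.toHom ≫ T.toHom = R.toHom :=
  Quotient.sound ((isComp S T).equiv h (.refl _) (.refl _))

noncomputable instance (X Y : SpanCat B) : Zero (X ⟶ Y) :=
  ⟨Quotient.mk _ (Span.zero X.as Y.as)⟩

noncomputable instance (X Y : SpanCat B) : Add (X ⟶ Y) :=
  ⟨fun f g => Quotient.map₂ Span.add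
    (fun _ _ hS _ _ hT => (Span.isSum _ _).equiv (Span.isSum _ _) hS hT) f g⟩

/-- The sum of spans is given by coproducts, and the zero span by the initial object. -/
noncomputable instance : MonoidEnriched (SpanCat B) where
  addCommMonoid X Y :=
    { nsmul := nsmulRec
      add_assoc := fun f g h => by
        induction f using Quotient.inductionOn
        induction g using Quotient.inductionOn
        induction h using Quotient.inductionOn
        exact Quotient.sound ((Span.isSum _ _).assoc (Span.isSum _ _) (Span.isSum _ _)
          (Span.isSum _ _))
      add_comm := fun f g => by
        induction f using Quotient.inductionOn
        induction g using Quotient.inductionOn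
        exact Quotient.sound ((Span.isSum _ _).equiv (Span.isSum _ _).symm (.refl _) (.refl _))
      zero_add := fun f => by
        induction f using Quotient.inductionOn
        exact Quotient.sound (Span.isSum_initial _ _ (Span.isInitial_zero _ _) (Span.isSum _ _))
      add_zero := fun f => by
        induction f using Quotient.inductionOn
        exact Quotient.sound (Span.isSum_initial _ _ (Span.isInitial_zero _ _)
          (Span.isSum _ _).symm) }
  add_comp f g h := by
    induction f using Quotient.inductionOn
    induction g using Quotient.inductionOn
    induction h using Quotient.inductionOn
    exact Quotient.sound ((Span.isSum _ _).comp (Span.isComp _ _) (Span.isComp _ _)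
      (Span.isComp _ _) (Span.isSum _ _))
  comp_add f g h := by
    induction f using Quotient.inductionOn
    induction g using Quotient.inductionOn
    induction h using Quotient.inductionOn
    exact Quotient.sound (Span.Equiv.of_flip ((Span.isSum _ _).flip.comp (Span.isComp _ _).flip (Span.isComp _ _).flip
      (Span.isComp _ _).flip (Span.isSum _ _).flip))
  zero_comp h := by
    induction h using Quotient.inductionOn
    exact Quotient.sound (Span.equiv_of_initial
      ((Span.isComp _ _).initial (Span.isInitial_zero _ _)) (Span.isInitial_zero _ _))
  comp_zero h := by
    induction h using Quotient.inductionOn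
    exact Quotient.sound (Span.equiv_of_initial
      ((Span.isComp _ _).initial' (Span.isInitial_zero _ _)) (Span.isInitial_zero _ _))

end

end Spans

end

section

section Linearization

open scoped TensorProduct
open Algebra

/-- The objects of the `k`-linearization of `C`. -/
structure Linearization (k : Type*) (C : Type*) where
  /-- The underlying object. -/
  as : C

variable {k : Type*} [CommRing k] {C : Type*} [Category* C] [MonoidEnriched C]

lemma lift_of {M A : Type*} [AddCommMonoid M] [AddCommGroup A] (φ : M →+ A) (m : M) :
    GrothendieckAddGroup.lift φ (.of m) = φ m :=
  DFunLike.congr_fun (GrothendieckAddGroup.lift.symm_apply_apply φ) m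

lemma gr_ext {M A : Type*} [AddCommMonoid M] [AddCommGroup A]
    {φ ψ : GrothendieckAddGroup M →+ A} (h : ∀ m, φ (.of m) = ψ (.of m)) : φ = ψ :=
  GrothendieckAddGroup.lift.symm.injective (AddMonoidHom.ext h)

/-- Composition, extended to the group completions of the Hom monoids. -/
noncomputable def grComp (X Y Z : C) : GrothendieckAddGroup (X ⟶ Y) →+
    GrothendieckAddGroup (Y ⟶ Z) →+ GrothendieckAddGroup (X ⟶ Z) :=
  GrothendieckAddGroup.lift
    { toFun := fun f => GrothendieckAddGroup.lift
        { toFun := fun g => GrothendieckAddGroup.of (f ≫ g)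
          map_zero' := by rw [MonoidEnriched.comp_zero, map_zero]
          map_add' := fun g h => by rw [MonoidEnriched.comp_add, map_add] }
      map_zero' := by
        refine gr_ext fun g => ?_
        rw [lift_of]
        simp [MonoidEnriched.zero_comp]
      map_add' := fun f f' => by
        refine gr_ext fun g => ?_
        rw [AddMonoidHom.add_apply, lift_of, lift_of, lift_of]
        simp [MonoidEnriched.add_comp] }

lemma grComp_of {X Y Z : C} (f : X ⟶ Y) (g : Y ⟶ Z) :
    grComp X Y Z (.of f) (.of g) = .of (f ≫ g) := by
  rw [grComp, lift_of]
  exact lift_of _ _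

variable (k) in
/-- Composition in the `k`-linearization: the `k`-bilinear extension of composition in `C`. -/
noncomputable def linComp (X Y Z : C) : k ⊗[ℤ] GrothendieckAddGroup (X ⟶ Y) →ₗ[k]
    k ⊗[ℤ] GrothendieckAddGroup (Y ⟶ Z) →ₗ[k] k ⊗[ℤ] GrothendieckAddGroup (X ⟶ Z) :=
  LinearMap.liftBaseChange k ((LinearMap.baseChangeHom ℤ k _ _).comp
    ((AddMonoidHom.toIntLinearMap
      { toFun := fun f => (grComp X Y Z f).toIntLinearMap
        map_zero' := by ext; simp
        map_add' := fun f g => by ext; simp }) :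
      GrothendieckAddGroup (X ⟶ Y) →ₗ[ℤ]
        (GrothendieckAddGroup (Y ⟶ Z) →ₗ[ℤ] GrothendieckAddGroup (X ⟶ Z))))

lemma linComp_tmul {X Y Z : C} (a b : k) (f : GrothendieckAddGroup (X ⟶ Y))
    (g : GrothendieckAddGroup (Y ⟶ Z)) :
    linComp k X Y Z (a ⊗ₜ f) (b ⊗ₜ g) = (a * b) ⊗ₜ grComp X Y Z f g := by
  simp [linComp, TensorProduct.smul_tmul']

variable (k) in
/-- The class `1 ⊗ f`. -/
noncomputable def linOf {X Y : C} (f : X ⟶ Y) : k ⊗[ℤ] GrothendieckAddGroup (X ⟶ Y) :=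
  1 ⊗ₜ GrothendieckAddGroup.of f

lemma linComp_of {X Y Z : C} (f : X ⟶ Y) (g : Y ⟶ Z) :
    linComp k X Y Z (linOf k f) (linOf k g) = linOf k (f ≫ g) := by
  rw [linOf, linOf, linComp_tmul, grComp_of, mul_one, linOf]

/-- Linear maps out of a Hom module of the linearization agree if they agree on morphisms. -/
lemma lin_ext {X Y : C} {N : Type*} [AddCommGroup N] [Module k N]
    {φ ψ : k ⊗[ℤ] GrothendieckAddGroup (X ⟶ Y) →ₗ[k] N}
    (h : ∀ f : X ⟶ Y, φ (linOf k f) = ψ (linOf k f)) : φ = ψ := by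
  apply (LinearMap.liftBaseChangeEquiv (R := ℤ) k).symm.injective
  ext x
  have : ((LinearMap.liftBaseChangeEquiv (R := ℤ) k).symm φ).toAddMonoidHom =
      ((LinearMap.liftBaseChangeEquiv (R := ℤ) k).symm ψ).toAddMonoidHom := by
    exact gr_ext h
  exact DFunLike.congr_fun this x

lemma linComp_assoc {W X Y Z : C} (f : k ⊗[ℤ] GrothendieckAddGroup (W ⟶ X))
    (g : k ⊗[ℤ] GrothendieckAddGroup (X ⟶ Y)) (h : k ⊗[ℤ] GrothendieckAddGroup (Y ⟶ Z)) :
    linComp k W Y Z (linComp k W X Y f g) h = linComp k W X Z f (linComp k X Y Z g h) := by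
  refine LinearMap.congr_fun (f := ((linComp k W Y Z).flip h).comp ((linComp k W X Y).flip g))
    (g := (linComp k W X Z).flip (linComp k X Y Z g h)) (lin_ext fun f => ?_) f
  refine LinearMap.congr_fun (f := ((linComp k W Y Z).flip h).comp (linComp k W X Y (linOf k f)))
    (g := (linComp k W X Z (linOf k f)).comp ((linComp k X Y Z).flip h)) (lin_ext fun g => ?_) g
  refine LinearMap.congr_fun (f := linComp k W Y Z (linComp k W X Y (linOf k f) (linOf k g)))
    (g := (linComp k W X Z (linOf k f)).comp (linComp k X Y Z (linOf k g)))
    (lin_ext fun h => ?_) h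
  simp [linComp_of]

/-- The `k`-linearization of a category enriched in commutative monoids: the Hom modules are
`k ⊗ M^±`, where `M^±` is the group completion of the Hom monoid `M`. -/
noncomputable instance : Category (Linearization k C) where
  Hom X Y := k ⊗[ℤ] GrothendieckAddGroup (X.as ⟶ Y.as)
  id X := linOf k (𝟙 X.as)
  comp {X Y Z} f g := linComp k X.as Y.as Z.as f g
  id_comp {X Y} f := by
    refine LinearMap.congr_fun (f := linComp k X.as X.as Y.as (linOf k (𝟙 X.as)))
      (g := LinearMap.id) (lin_ext fun f => ?_) f
    simp [linComp_of]
  comp_id {X Y} f := by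
    refine LinearMap.congr_fun (f := (linComp k X.as Y.as Y.as).flip (linOf k (𝟙 Y.as)))
      (g := LinearMap.id) (lin_ext fun f => ?_) f
    simp [linComp_of]
  assoc {W X Y Z} f g h := by
    exact linComp_assoc f g h

noncomputable instance : Preadditive (Linearization k C) where
  homGroup X Y := inferInstanceAs (AddCommGroup (k ⊗[ℤ] GrothendieckAddGroup (X.as ⟶ Y.as)))
  add_comp X Y Z f g h := LinearMap.map_add₂ (linComp k X.as Y.as Z.as) f g h
  comp_add X Y Z f g h := (linComp k X.as Y.as Z.as f).map_add g h

noncomputable instance : Linear k (Linearization k C) where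
  homModule X Y := inferInstanceAs (Module k (k ⊗[ℤ] GrothendieckAddGroup (X.as ⟶ Y.as)))
  smul_comp X Y Z r f g := LinearMap.map_smul₂ (linComp k X.as Y.as Z.as) r f g
  comp_smul X Y Z f r g := (linComp k X.as Y.as Z.as f).map_smul r g

variable {D : Type*} [Category* D] [MonoidEnriched D]

/-- A functor between categories enriched in commutative monoids is additive if it preserves
sums and zero morphisms. -/
class MonoidEnriched.IsAdditive (F : C ⥤ D) : Prop where
  map_add : ∀ {X Y : C} (f g : X ⟶ Y), F.map (f + g) = F.map f + F.map g
  map_zero : ∀ X Y : C, F.map (0 : X ⟶ Y) = 0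

variable (k) in
/-- The effect of an additive functor on the Hom modules of the linearizations. -/
noncomputable def linMap (F : C ⥤ D) [MonoidEnriched.IsAdditive F] (X Y : C) :
    k ⊗[ℤ] GrothendieckAddGroup (X ⟶ Y) →ₗ[k]
      k ⊗[ℤ] GrothendieckAddGroup (F.obj X ⟶ F.obj Y) :=
  LinearMap.baseChange k (GrothendieckAddGroup.lift
    { toFun := fun f => GrothendieckAddGroup.of (F.map f)
      map_zero' := by rw [MonoidEnriched.IsAdditive.map_zero, map_zero]
      map_add' := fun f g => by
        rw [MonoidEnriched.IsAdditive.map_add, map_add] }).toIntLinearMap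

lemma linMap_of (F : C ⥤ D) [MonoidEnriched.IsAdditive F] {X Y : C} (f : X ⟶ Y) :
    linMap k F X Y (linOf k f) = linOf k (F.map f) := by
  rw [linOf, linMap, LinearMap.baseChange_tmul, linOf, AddMonoidHom.coe_toIntLinearMap, lift_of]
  rfl

variable (k) in
/-- The `k`-linear extension of an additive functor. -/
noncomputable def Linearization.map (F : C ⥤ D) [MonoidEnriched.IsAdditive F] :
    Linearization k C ⥤ Linearization k D where
  obj X := ⟨F.obj X.as⟩
  map {X Y} f := linMap k F X.as Y.as f
  map_id X := (linMap_of F (𝟙 X.as)).trans (by rw [F.map_id]; rfl)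
  map_comp {X Y Z} f g := by
    refine LinearMap.congr_fun (f := (linMap k F X.as Z.as).comp ((linComp k X.as Y.as Z.as).flip g))
      (g := ((linComp k _ _ _).flip (linMap k F Y.as Z.as g)).comp (linMap k F X.as Y.as))
      (lin_ext fun f => ?_) f
    refine LinearMap.congr_fun (f := (linMap k F X.as Z.as).comp (linComp k X.as Y.as Z.as (linOf k f)))
      (g := (linComp k _ _ _ (linMap k F X.as Y.as (linOf k f))).comp (linMap k F Y.as Z.as))
      (lin_ext fun g => ?_) g
    simp [linComp_of, linMap_of]

instance (F : C ⥤ D) [MonoidEnriched.IsAdditive F] : (Linearization.map k F).Additive where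
  map_add {X Y} {f g} := map_add (linMap k F X.as Y.as) f g

instance (F : C ⥤ D) [MonoidEnriched.IsAdditive F] : (Linearization.map k F).Linear k where
  map_smul {X Y} f r := map_smul (linMap k F X.as Y.as) r f

end Linearization

section SpanFunctors

variable {B : Type*} [Bicategory B] {C : Type*} [Bicategory C]

/-- A pseudofunctor which preserves Mackey squares and finite coproducts. -/
class PreservesSpans (F : B ⥤ᵖ C) : Prop where
  mackey : ∀ {X Y Z : B} (u : X ⟶ Z) (v : Y ⟶ Z), ∃ (P : B) (p : P ⟶ X) (q : P ⟶ Y),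
    IsMackey p q u v ∧ IsMackey (F.map p) (F.map q) (F.map u) (F.map v)
  coproduct : ∀ X Y : B, ∃ (W : B) (i : X ⟶ W) (j : Y ⟶ W),
    IsCoproduct i j ∧ IsCoproduct (F.map i) (F.map j)
  initial : ∃ E : B, IsInitialObject E ∧ IsInitialObject (F.obj E)

namespace Span
variable (F : B ⥤ᵖ C)

lemma map_isIsomorphic {X Y : B} {f g : X ⟶ Y} (h : IsIsomorphic f g) :
    IsIsomorphic (F.map f) (F.map g) := ⟨F.map₂Iso h.some⟩

lemma map_isIsomorphic_comp {X Y Z : B} {f : X ⟶ Z} {g : X ⟶ Y} {h : Y ⟶ Z}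
    (e : IsIsomorphic f (g ≫ h)) : IsIsomorphic (F.map f) (F.map g ≫ F.map h) :=
  ⟨F.map₂Iso e.some ≪≫ F.mapComp g h⟩

/-- The image of a span under a pseudofunctor. -/
def map {X Y : B} (S : Span X Y) : Span (F.obj X) (F.obj Y) :=
  ⟨F.obj S.apex, F.map S.left, F.map S.right⟩

lemma Equiv.map {X Y : B} {S S' : Span X Y} (h : S.Equiv S') : (S.map F).Equiv (S'.map F) := by
  obtain ⟨s, ⟨r, h₁, h₂⟩, hl, hr⟩ := h
  refine ⟨F.map s, ⟨F.map r, ?_, ?_⟩, map_isIsomorphic_comp F hl, map_isIsomorphic_comp F hr⟩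
  · exact ⟨(F.mapComp _ _).symm ≪≫ F.map₂Iso h₁.some ≪≫ F.mapId _⟩
  · exact ⟨(F.mapComp _ _).symm ≪≫ F.map₂Iso h₂.some ≪≫ F.mapId _⟩

variable [PreservesSpans F]

lemma IsComp.map {X Y Z : B} {S : Span X Y} {T : Span Y Z} {R : Span X Z} (h : IsComp S T R)
    {D : Span (F.obj X) (F.obj Z)} (hD : IsComp (S.map F) (T.map F) D) : (R.map F).Equiv D := by
  obtain ⟨P, p, q, m, m'⟩ := PreservesSpans.mackey (F := F) S.right T.left
  have e : IsComp S T ⟨P, p ≫ S.left, q ≫ T.right⟩ :=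
    ⟨p, q, m, isIsomorphic_refl _, isIsomorphic_refl _⟩
  have e' : IsComp (S.map F) (T.map F) (Span.map F ⟨P, p ≫ S.left, q ≫ T.right⟩) :=
    ⟨F.map p, F.map q, m', ⟨F.mapComp _ _⟩, ⟨F.mapComp _ _⟩⟩
  exact ((h.equiv e (.refl _) (.refl _)).map F).trans (e'.equiv hD (.refl _) (.refl _))

lemma IsSum.map {X Y : B} {S T R : Span X Y} (h : IsSum S T R)
    {D : Span (F.obj X) (F.obj Y)} (hD : IsSum (S.map F) (T.map F) D) : (R.map F).Equiv D := by
  obtain ⟨W, i, j, c, c'⟩ := PreservesSpans.coproduct (F := F) S.apex T.apex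
  obtain ⟨l, h₁, h₂⟩ := c.desc S.left T.left
  obtain ⟨r, h₃, h₄⟩ := c.desc S.right T.right
  have e : IsSum S T ⟨W, l, r⟩ := ⟨i, j, c, h₁, h₂, h₃, h₄⟩
  have e' : IsSum (S.map F) (T.map F) (Span.map F ⟨W, l, r⟩) :=
    ⟨F.map i, F.map j, c', isIsomorphic_symm (map_isIsomorphic_comp F (isIsomorphic_symm h₁)),
      isIsomorphic_symm (map_isIsomorphic_comp F (isIsomorphic_symm h₂)),
      isIsomorphic_symm (map_isIsomorphic_comp F (isIsomorphic_symm h₃)),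
      isIsomorphic_symm (map_isIsomorphic_comp F (isIsomorphic_symm h₄))⟩
  exact ((h.equiv e (.refl _) (.refl _)).map F).trans (e'.equiv hD (.refl _) (.refl _))

end Span

variable [Spannable B] [Spannable C] (F : B ⥤ᵖ C) [PreservesSpans F]

/-- The functor between categories of spans induced by a pseudofunctor, sending the class of
`X ← S → Y` to the class of `F X ← F S → F Y`. -/
noncomputable def SpanCat.map : SpanCat B ⥤ SpanCat C where
  obj X := ⟨F.obj X.as⟩
  map f := Quotient.map (Span.map F) (fun _ _ h => Span.Equiv.map F h) f
  map_id X := Quotient.sound ⟨𝟙 _, ⟨𝟙 _, ⟨λ_ _⟩, ⟨λ_ _⟩⟩, ⟨F.mapId _ ≪≫ (λ_ _).symm⟩,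
    ⟨F.mapId _ ≪≫ (λ_ _).symm⟩⟩
  map_comp f g := by
    induction f using Quotient.inductionOn
    induction g using Quotient.inductionOn
    exact Quotient.sound ((Span.isComp _ _).map F (Span.isComp _ _))

instance : MonoidEnriched.IsAdditive (SpanCat.map F) where
  map_add f g := by
    induction f using Quotient.inductionOn
    induction g using Quotient.inductionOn
    exact Quotient.sound ((Span.isSum _ _).map F (Span.isSum _ _))
  map_zero X Y := by
    obtain ⟨E, h, h'⟩ := PreservesSpans.initial (F := F)
    obtain ⟨l⟩ := h.desc X.as
    obtain ⟨r⟩ := h.desc Y.as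
    exact Quotient.sound (((Span.equiv_of_initial (S' := ⟨E, l, r⟩) (Span.isInitial_zero _ _)
      h).map F).trans (Span.equiv_of_initial h' (Span.isInitial_zero _ _)))

end SpanFunctors

section MackeyFunctors


variable (k : Type w') [CommRing k] (B : Type u) [Bicategory.{w, v} B] [Spannable B]

/-- The `k`-linear category of spans in `B`. -/
abbrev SpanLin := Linearization k (SpanCat B)

/-- A functor from the `k`-linear category of spans in `B` to `k`-modules is a Mackey functor
if it is `k`-linear. -/
def isMackeyFunctor : ObjectProperty (SpanLin k B ⥤ ModuleCat.{m} k) :=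
  fun M => M.Additive ∧ M.Linear k

/-- The category of `k`-linear Mackey functors for `B`, and natural transformations. -/
abbrev Mackey := (isMackeyFunctor k B).FullSubcategory

variable {B} {C : Type*} [Bicategory C] [Spannable C]

/-- Precomposition with the `k`-linear functor on span categories induced by `F`. -/
noncomputable def Mackey.restrict (F : B ⥤ᵖ C) [PreservesSpans F] : Mackey.{_, _, _, _, m} k C ⥤ Mackey.{_, _, _, _, m} k B :=
  ObjectProperty.lift _ ((isMackeyFunctor k C).ι ⋙
    (Functor.whiskeringLeft _ _ _).obj (Linearization.map k (SpanCat.map F)))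
    fun M => by
      have := M.property.1
      have := M.property.2
      exact ⟨inferInstanceAs (Linearization.map k (SpanCat.map F) ⋙ M.obj).Additive,
        inferInstanceAs ((Linearization.map k (SpanCat.map F) ⋙ M.obj).Linear k)⟩

end MackeyFunctors

end

section

/-- The two kinds of 2-cells considered below. -/
inductive Kind
  | plain
  | fused

section GSets

/-- A finite left `G`-set. The parameter `κ` selects the 2-cells. -/
structure FinGSet (κ : Kind) (G : Type u) [Group G] where
  /-- The underlying set. -/
  carrier : Type u
  [mulAction : MulAction G carrier]
  [finite : Finite carrier]

attribute [instance] FinGSet.mulAction FinGSet.finite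

variable {κ : Kind} {G : Type u} [Group G]

namespace FinGSet

/-- 1-cells are the `G`-equivariant maps. -/
instance categoryStruct : CategoryStruct (FinGSet κ G) where
  Hom X Y := X.carrier →[G] Y.carrier
  id _ := MulActionHom.id G
  comp f g := g.comp f

/-- The value of a 1-cell at a point. -/
def app {X Y : FinGSet κ G} (f : X ⟶ Y) (x : X.carrier) : Y.carrier :=
  MulActionHom.toFun f x

lemma app_smul {X Y : FinGSet κ G} (f : X ⟶ Y) (a : G) (x : X.carrier) :
    app f (a • x) = a • app f x := MulActionHom.map_smul' f a x

@[simp] lemma app_id (X : FinGSet κ G) (x : X.carrier) : app (𝟙 X) x = x := rfl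

@[simp] lemma app_comp {X Y Z : FinGSet κ G} (f : X ⟶ Y) (g : Y ⟶ Z) (x : X.carrier) :
    app (f ≫ g) x = app g (app f x) := rfl

lemma hom_ext {X Y : FinGSet κ G} {f g : X ⟶ Y} (h : ∀ x, app f x = app g x) : f = g :=
  MulActionHom.ext h

/-- A `G`-equivariant map, as a 1-cell. -/
def ofMap {X Y : FinGSet κ G} (f : X.carrier → Y.carrier) (h : ∀ (a : G) x, f (a • x) = a • f x) :
    X ⟶ Y := MulActionHom.mk f h

@[simp] lemma app_ofMap {X Y : FinGSet κ G} (f : X.carrier → Y.carrier)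
    (h : ∀ (a : G) x, f (a • x) = a • f x) (x : X.carrier) : app (ofMap f h : X ⟶ Y) x = f x := rfl

/-- A twisting map `τ` with `τ * f = g`, that is, a `G`-map `τ` from `X` to `G` with the conjugation
action such that `τ(x) • f(x) = g(x)`. Only the constant twisting map `1` is allowed if `κ` is
`plain`. -/
@[ext] structure Twist {X Y : FinGSet κ G} (f g : X ⟶ Y) where
  /-- The underlying map. -/
  twist : X.carrier → G
  twist_smul : ∀ (a : G) x, twist (a • x) = a * twist x * a⁻¹
  twist_app : ∀ x, twist x • app f x = app g x
  plain : κ = .plain → ∀ x, twist x = 1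

/-- Vertical composition of twisting maps is pointwise multiplication. -/
instance homCategory (X Y : FinGSet κ G) : Category (X ⟶ Y) where
  Hom f g := Twist f g
  id f := ⟨fun _ => 1, by simp, by simp, by simp⟩
  comp {f g h} s t := ⟨fun x => t.twist x * s.twist x,
    fun a x => by simp [s.twist_smul, t.twist_smul],
    fun x => by simp [mul_smul, s.twist_app, t.twist_app],
    fun hk x => by simp [s.plain hk, t.plain hk]⟩
  id_comp s := Twist.ext (by funext; simp)
  comp_id s := Twist.ext (by funext; simp)
  assoc s t r := Twist.ext (by funext; simp [mul_assoc])

/-- The twisting map underlying a 2-cell. -/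
def tw {X Y : FinGSet κ G} {f g : X ⟶ Y} (s : f ⟶ g) (x : X.carrier) : G := Twist.twist s x

lemma tw_smul {X Y : FinGSet κ G} {f g : X ⟶ Y} (s : f ⟶ g) (a : G) (x : X.carrier) :
    tw s (a • x) = a * tw s x * a⁻¹ := Twist.twist_smul s a x

lemma tw_app {X Y : FinGSet κ G} {f g : X ⟶ Y} (s : f ⟶ g) (x : X.carrier) :
    tw s x • app f x = app g x := Twist.twist_app s x

lemma tw_plain {X Y : FinGSet κ G} {f g : X ⟶ Y} (s : f ⟶ g) (h : κ = .plain) (x : X.carrier) :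
    tw s x = 1 := Twist.plain s h x

lemma cell_ext {X Y : FinGSet κ G} {f g : X ⟶ Y} {s t : f ⟶ g} (h : ∀ x, tw s x = tw t x) :
    s = t := Twist.ext (funext h)

@[simp] lemma tw_id {X Y : FinGSet κ G} (f : X ⟶ Y) (x : X.carrier) : tw (𝟙 f) x = 1 := rfl

@[simp] lemma tw_comp {X Y : FinGSet κ G} {f g h : X ⟶ Y} (s : f ⟶ g) (t : g ⟶ h)
    (x : X.carrier) : tw (s ≫ t) x = tw t x * tw s x := rfl

/-- A twisting map, as a 2-cell. -/
def cell {X Y : FinGSet κ G} {f g : X ⟶ Y} (τ : X.carrier → G)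
    (h₁ : ∀ (a : G) x, τ (a • x) = a * τ x * a⁻¹) (h₂ : ∀ x, τ x • app f x = app g x)
    (h₃ : κ = .plain → ∀ x, τ x = 1) : f ⟶ g := (⟨τ, h₁, h₂, h₃⟩ : Twist f g)

@[simp] lemma tw_cell {X Y : FinGSet κ G} {f g : X ⟶ Y} (τ : X.carrier → G)
    (h₁ : ∀ (a : G) x, τ (a • x) = a * τ x * a⁻¹) (h₂ : ∀ x, τ x • app f x = app g x)
    (h₃ : κ = .plain → ∀ x, τ x = 1) (x : X.carrier) : tw (cell τ h₁ h₂ h₃) x = τ x := rfl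

/-- 2-cells are invertible. -/
def inv {X Y : FinGSet κ G} {f g : X ⟶ Y} (s : f ⟶ g) : g ⟶ f :=
  cell (fun x => (tw s x)⁻¹) (fun a x => by simp [tw_smul, mul_assoc])
    (fun x => by rw [inv_smul_eq_iff, tw_app]) (fun h x => by simp [tw_plain s h])

/-- The invertible 2-cell given by a 2-cell. -/
def iso {X Y : FinGSet κ G} {f g : X ⟶ Y} (s : f ⟶ g) : f ≅ g where
  hom := s
  inv := inv s
  hom_inv_id := cell_ext fun x => by simp [inv]
  inv_hom_id := cell_ext fun x => by simp [inv]

/-- The identity 2-cell between two equal 1-cells. -/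
def ofEq {X Y : FinGSet κ G} {f g : X ⟶ Y} (h : ∀ x, app f x = app g x) : f ⟶ g :=
  cell (fun _ => 1) (by simp) (by simp [h]) (by simp)

@[simp] lemma tw_ofEq {X Y : FinGSet κ G} {f g : X ⟶ Y} (h : ∀ x, app f x = app g x)
    (x : X.carrier) : tw (ofEq h) x = 1 := rfl

/-- The horizontal composite of a 1-cell and a 2-cell. -/
def preWhisker {X Y Z : FinGSet κ G} (f : X ⟶ Y) {g h : Y ⟶ Z} (s : g ⟶ h) : f ≫ g ⟶ f ≫ h :=
  cell (fun x => tw s (app f x)) (fun a x => by rw [app_smul, tw_smul]) (fun x => tw_app s _)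
    (fun h x => tw_plain s h _)

/-- The horizontal composite of a 2-cell and a 1-cell. -/
def postWhisker {X Y Z : FinGSet κ G} {f g : X ⟶ Y} (s : f ⟶ g) (h : Y ⟶ Z) : f ≫ h ⟶ g ≫ h :=
  cell (fun x => tw s x) (tw_smul s)
    (fun x => (app_smul h _ _).symm.trans (congrArg (app h) (tw_app s x))) (tw_plain s)

@[simp] lemma tw_preWhisker {X Y Z : FinGSet κ G} (f : X ⟶ Y) {g h : Y ⟶ Z} (s : g ⟶ h)
    (x : X.carrier) : tw (preWhisker f s) x = tw s (app f x) := rfl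

@[simp] lemma tw_postWhisker {X Y Z : FinGSet κ G} {f g : X ⟶ Y} (s : f ⟶ g) (h : Y ⟶ Z)
    (x : X.carrier) : tw (postWhisker s h) x = tw s x := rfl

@[simp] lemma tw_iso_hom {X Y : FinGSet κ G} {f g : X ⟶ Y} (s : f ⟶ g) (x : X.carrier) :
    tw (iso s).hom x = tw s x := rfl

@[simp] lemma tw_iso_inv {X Y : FinGSet κ G} {f g : X ⟶ Y} (s : f ⟶ g) (x : X.carrier) :
    tw (iso s).inv x = (tw s x)⁻¹ := rfl

/-- For `κ = plain`, the category of finite `G`-sets as a discrete 2-category. For `κ = fused`, the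
2-category of finite `G`-sets, `G`-maps and twisting maps. -/
instance : Bicategory (FinGSet κ G) where
  toCategoryStruct := categoryStruct
  homCategory := homCategory
  whiskerLeft f _ _ s := preWhisker f s
  whiskerRight s h := postWhisker s h
  associator f g h := iso (ofEq fun _ => rfl)
  leftUnitor f := iso (ofEq fun _ => rfl)
  rightUnitor f := iso (ofEq fun _ => rfl)
  whiskerLeft_id f g := cell_ext fun x => by simp
  whiskerLeft_comp f _ _ _ s t := cell_ext fun x => by simp
  id_whiskerLeft s := cell_ext fun x => by simp
  comp_whiskerLeft f g _ _ s := cell_ext fun x => by simp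
  id_whiskerRight f g := cell_ext fun x => by simp
  comp_whiskerRight s t h := cell_ext fun x => by simp
  whiskerRight_id s := cell_ext fun x => by simp
  whiskerRight_comp s g h := cell_ext fun x => by simp
  whisker_assoc f _ _ s h := cell_ext fun x => by simp
  whisker_exchange s t := cell_ext fun x => by
    simp only [tw_comp, tw_preWhisker, tw_postWhisker]
    rw [← tw_app s x, tw_smul]
    simp
  pentagon f g h i := cell_ext fun x => by simp
  triangle f g := cell_ext fun x => by simp

@[simp] lemma tw_whiskerLeft {X Y Z : FinGSet κ G} (f : X ⟶ Y) {g h : Y ⟶ Z} (s : g ⟶ h)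
    (x : X.carrier) : tw (f ◁ s) x = tw s (app f x) := rfl

@[simp] lemma tw_whiskerRight {X Y Z : FinGSet κ G} {f g : X ⟶ Y} (s : f ⟶ g) (h : Y ⟶ Z)
    (x : X.carrier) : tw (s ▷ h) x = tw s x := rfl

@[simp] lemma tw_associator_hom {W X Y Z : FinGSet κ G} (f : W ⟶ X) (g : X ⟶ Y) (h : Y ⟶ Z)
    (x : W.carrier) : tw (α_ f g h).hom x = 1 := rfl

@[simp] lemma tw_associator_inv {W X Y Z : FinGSet κ G} (f : W ⟶ X) (g : X ⟶ Y) (h : Y ⟶ Z)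
    (x : W.carrier) : tw (α_ f g h).inv x = 1 := inv_one

@[simp] lemma tw_leftUnitor_hom {X Y : FinGSet κ G} (f : X ⟶ Y) (x : X.carrier) :
    tw (λ_ f).hom x = 1 := rfl

@[simp] lemma tw_rightUnitor_hom {X Y : FinGSet κ G} (f : X ⟶ Y) (x : X.carrier) :
    tw (ρ_ f).hom x = 1 := rfl

/-- Two 1-cells are isomorphic as soon as there is a 2-cell between them. -/
lemma isIsomorphic {X Y : FinGSet κ G} {f g : X ⟶ Y} (s : f ⟶ g) : IsIsomorphic f g := ⟨iso s⟩

/-- The pullback of `G`-sets. -/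
def pullback {X Y Z : FinGSet κ G} (f : X ⟶ Z) (g : Y ⟶ Z) : FinGSet κ G where
  carrier := {t : X.carrier × Y.carrier // app f t.1 = app g t.2}
  mulAction :=
    { smul := fun a t => ⟨a • t.1, by
        rw [Prod.smul_fst, Prod.smul_snd, app_smul, app_smul, t.2]⟩
      one_smul := fun t => Subtype.ext (one_smul G t.1)
      mul_smul := fun a b t => Subtype.ext (mul_smul a b t.1) }

/-- The first projection of the pullback. -/
def fst {X Y Z : FinGSet κ G} (f : X ⟶ Z) (g : Y ⟶ Z) : pullback f g ⟶ X :=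
  ofMap (fun t => t.1.1) fun _ _ => rfl

/-- The second projection of the pullback. -/
def snd {X Y Z : FinGSet κ G} (f : X ⟶ Z) (g : Y ⟶ Z) : pullback f g ⟶ Y :=
  ofMap (fun t => t.1.2) fun _ _ => rfl

/-- A commutative square of `G`-sets which is a pullback of sets is a Mackey square. -/
lemma isMackey {P X Y Z : FinGSet κ G} {p : P ⟶ X} {q : P ⟶ Y} {f : X ⟶ Z} {g : Y ⟶ Z}
    (comm : ∀ t, app f (app p t) = app g (app q t))
    (exists_pt : ∀ x y, app f x = app g y → ∃ t, app p t = x ∧ app q t = y)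
    (inj : ∀ t t', app p t = app p t' → app q t = app q t' → t = t') : IsMackey p q f g := by
  have comm' : ∀ t, app (p ≫ f) t = app (q ≫ g) t := comm
  refine ⟨iso (ofEq comm'), ⟨fun {T} r s σ => ?_, fun {T} t t' β β' e => ?_⟩⟩
  · have key : ∀ x, app f (tw σ.hom x • app r x) = app g (app s x) := fun x => by
      rw [app_smul]; exact tw_app σ.hom x
    choose t ht₁ ht₂ using fun x => exists_pt _ _ (key x)
    have ht : ∀ (a : G) x, t (a • x) = a • t x := fun a x => by
      apply inj
      · rw [ht₁, app_smul r, app_smul p, ht₁, tw_smul, smul_smul, smul_smul, inv_mul_cancel_right]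
      · rw [ht₂, app_smul s, app_smul q, ht₂]
    have h₁ : ∀ x, tw σ.hom x • app r x = app ((ofMap t ht : T ⟶ P) ≫ p) x :=
      fun x => (ht₁ x).symm
    have h₂ : ∀ x, app ((ofMap t ht : T ⟶ P) ≫ q) x = app s x := ht₂
    exact ⟨ofMap t ht, iso (cell (tw σ.hom) (tw_smul _) h₁ (tw_plain _)),
      iso (ofEq h₂), cell_ext fun x => by simp⟩
  · have h : ∀ x, tw β x = tw β' x := fun x => by
      simpa using congrArg (fun s => tw s x) e
    refine ⟨cell (tw β) (tw_smul _) (fun x => inj _ _ ?_ ?_) (tw_plain _), ⟨?_, ?_⟩, ?_⟩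
    · rw [app_smul]; exact tw_app β x
    · rw [app_smul, h]; exact tw_app β' x
    · exact cell_ext fun x => rfl
    · exact cell_ext h
    · rintro c ⟨hc, -⟩
      exact cell_ext fun x => congrArg (fun s : t ≫ p ⟶ t' ≫ p => tw s x) hc

lemma isMackey_pullback {X Y Z : FinGSet κ G} (f : X ⟶ Z) (g : Y ⟶ Z) :
    IsMackey (fst f g) (snd f g) f g :=
  isMackey (fun t => t.2) (fun x y h => ⟨⟨(x, y), h⟩, rfl, rfl⟩)
    (fun _ _ h₁ h₂ => Subtype.ext (Prod.ext h₁ h₂))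

/-- The disjoint union of `G`-sets. -/
def sum (X Y : FinGSet κ G) : FinGSet κ G where
  carrier := X.carrier ⊕ Y.carrier
  mulAction :=
    { smul := fun a => Sum.map (a • ·) (a • ·)
      one_smul := fun t => by
        rcases t with t | t
        · exact congrArg Sum.inl (one_smul G t)
        · exact congrArg Sum.inr (one_smul G t)
      mul_smul := fun a b t => by
        rcases t with t | t
        · exact congrArg Sum.inl (mul_smul a b t)
        · exact congrArg Sum.inr (mul_smul a b t) }

/-- The first inclusion. -/
def inl (X Y : FinGSet κ G) : X ⟶ sum X Y := ofMap Sum.inl fun _ _ => rfl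

/-- The second inclusion. -/
def inr (X Y : FinGSet κ G) : Y ⟶ sum X Y := ofMap Sum.inr fun _ _ => rfl

/-- The map out of a disjoint union. -/
def desc {X Y T : FinGSet κ G} (f : X ⟶ T) (g : Y ⟶ T) : sum X Y ⟶ T :=
  ofMap (Sum.elim (app f) (app g)) fun a t => by
    rcases t with t | t
    · exact app_smul f a t
    · exact app_smul g a t

/-- A disjoint union decomposition is a coproduct. -/
lemma isCoproduct {X Y W : FinGSet κ G} {i : X ⟶ W} {j : Y ⟶ W}
    (bij : Function.Bijective (Sum.elim (app i) (app j))) : IsCoproduct i j where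
  desc {T} f g := by
    let e := Equiv.ofBijective _ bij
    have hi : ∀ x, e.symm (app i x) = .inl x := fun x => e.symm_apply_eq.2 rfl
    have hj : ∀ x, e.symm (app j x) = .inr x := fun x => e.symm_apply_eq.2 rfl
    refine ⟨ofMap (fun w => Sum.elim (app f) (app g) (e.symm w)) fun a w => ?_,
      ⟨iso (ofEq fun x => ?_)⟩, ⟨iso (ofEq fun x => ?_)⟩⟩
    · obtain ⟨x | x, rfl⟩ := e.surjective w
      · change Sum.elim _ _ (e.symm (a • app i x)) = a • Sum.elim _ _ (e.symm (app i x))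
        rw [← app_smul, hi, hi]; exact app_smul f a x
      · change Sum.elim _ _ (e.symm (a • app j x)) = a • Sum.elim _ _ (e.symm (app j x))
        rw [← app_smul, hj, hj]; exact app_smul g a x
    · simp [hi]
    · simp [hj]
  ext {T} t t' a b := by
    let e := Equiv.ofBijective _ bij
    have hi : ∀ x, e.symm (app i x) = .inl x := fun x => e.symm_apply_eq.2 rfl
    have hj : ∀ x, e.symm (app j x) = .inr x := fun x => e.symm_apply_eq.2 rfl
    have surj : ∀ {p : W.carrier → Prop}, (∀ x, p (app i x)) → (∀ x, p (app j x)) → ∀ w, p w := by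
      intro p h₁ h₂ w
      obtain ⟨x | x, rfl⟩ := e.surjective w
      · exact h₁ x
      · exact h₂ x
    refine ⟨cell (fun w => Sum.elim (tw a) (tw b) (e.symm w)) (fun c => surj ?_ ?_) (surj ?_ ?_)
      (fun h => surj ?_ ?_), ⟨?_, ?_⟩, fun c hc => ?_⟩
    · intro x; rw [← app_smul, hi, hi]; exact tw_smul a c x
    · intro x; rw [← app_smul, hj, hj]; exact tw_smul b c x
    · intro x; rw [hi]; exact tw_app a x
    · intro x; rw [hj]; exact tw_app b x
    · intro x; rw [hi]; exact tw_plain a h x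
    · intro x; rw [hj]; exact tw_plain b h x
    · exact cell_ext fun x => by simp [hi]
    · exact cell_ext fun x => by simp [hj]
    · refine cell_ext (surj (fun x => ?_) fun x => ?_)
      · rw [tw_cell, hi]; exact congrArg (fun s => tw s x) hc.1
      · rw [tw_cell, hj]; exact congrArg (fun s => tw s x) hc.2

lemma isCoproduct_sum (X Y : FinGSet κ G) : IsCoproduct (inl X Y) (inr X Y) :=
  isCoproduct (by
    have : Sum.elim (app (inl X Y)) (app (inr X Y)) = id := by
      funext t; rcases t with t | t <;> rfl
    rw [this]; exact Function.bijective_id)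

/-- The empty `G`-set. -/
def empty (κ : Kind) (G : Type u) [Group G] : FinGSet κ G where
  carrier := PEmpty
  mulAction :=
    { smul := fun _ => PEmpty.elim
      one_smul := fun t => t.elim
      mul_smul := fun _ _ t => t.elim }

lemma isInitialObject {E : FinGSet κ G} (h : IsEmpty E.carrier) : IsInitialObject E where
  desc _ := ⟨ofMap (fun x => (h.false x).elim) fun _ x => (h.false x).elim⟩
  ext _ _ := ⟨ofEq fun x => (h.false x).elim, trivial,
    fun _ _ => cell_ext fun x => (h.false x).elim⟩

instance : Spannable (FinGSet κ G) where
  isIso_cell a := ⟨inv a, (iso a).hom_inv_id, (iso a).inv_hom_id⟩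
  mackey u v := ⟨_, _, _, isMackey_pullback u v⟩
  coproduct X Y := by
    refine ⟨_, _, _, isCoproduct_sum X Y, fun {T} c => ⟨_, _, snd (inl X Y) c, fst (inl X Y) c,
      snd (inr X Y) c, fst (inr X Y) c, isMackey_pullback _ _, isMackey_pullback _ _,
      isCoproduct ⟨?_, ?_⟩⟩⟩
    · rintro (⟨⟨x, t⟩, h⟩ | ⟨⟨x, t⟩, h⟩) (⟨⟨x', t'⟩, h'⟩ | ⟨⟨x', t'⟩, h'⟩) e
      · obtain rfl : t = t' := e
        obtain rfl : x = x' := Sum.inl_injective (h.trans h'.symm)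
        rfl
      · obtain rfl : t = t' := e
        exact (Sum.inl_ne_inr (h.trans h'.symm)).elim
      · obtain rfl : t = t' := e
        exact (Sum.inl_ne_inr (h'.trans h.symm)).elim
      · obtain rfl : t = t' := e
        obtain rfl : x = x' := Sum.inr_injective (h.trans h'.symm)
        rfl
    · intro t
      rcases h : app c t with x | x
      · exact ⟨.inl ⟨(x, t), h.symm⟩, rfl⟩
      · exact ⟨.inr ⟨(x, t), h.symm⟩, rfl⟩
  initial := ⟨empty κ G, isInitialObject (inferInstanceAs (IsEmpty PEmpty))⟩
  strict_initial {T E} f h := by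
    obtain ⟨g⟩ := h.desc (empty κ G)
    exact isInitialObject ⟨fun x => (app g (app f x)).elim⟩

end FinGSet
end GSets

end

section

section Groupoids

/-- A groupoid with finitely many objects which is faithfully embedded in `G`, that is, equipped
with a faithful functor to the one-object groupoid `G`. If `G` is finite then so are its Hom sets.
The parameter `κ` selects the 2-cells. -/
structure FinGpd (κ : Kind) (G : Type u) [Group G] where
  /-- The set of objects. -/
  carrier : Type u
  [category : Category.{u} carrier]
  [isGroupoid : IsGroupoid carrier]
  [finite : Finite carrier]
  /-- The embedding. -/
  emb : carrier ⥤ SingleObj G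
  [faithful : emb.Faithful]

attribute [instance] FinGpd.category FinGpd.isGroupoid FinGpd.finite FinGpd.faithful

variable {κ κ' : Kind} {G : Type u} [Group G]

namespace FinGpd

/-- A functor between groupoids over `G`, with a natural isomorphism over `G`. Such a functor
is automatically faithful. -/
structure Emb (X Y : FinGpd κ G) where
  /-- The underlying functor. -/
  functor : X.carrier ⥤ Y.carrier
  /-- The compatibility with the embeddings. -/
  iso : functor ⋙ Y.emb ≅ X.emb

instance categoryStruct : CategoryStruct (FinGpd κ G) where
  Hom X Y := Emb X Y
  id _ := ⟨𝟭 _, Iso.refl _⟩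
  comp f g := ⟨f.functor ⋙ g.functor, f.functor.isoWhiskerLeft g.iso ≪≫ f.iso⟩

/-- The functor underlying a 1-cell. -/
def fn {X Y : FinGpd κ G} (f : X ⟶ Y) : X.carrier ⥤ Y.carrier := Emb.functor f

/-- The 2-cell over `G` underlying a 1-cell. -/
def ov {X Y : FinGpd κ G} (f : X ⟶ Y) : fn f ⋙ Y.emb ≅ X.emb := Emb.iso f

/-- A 1-cell from its components. -/
def mkHom {X Y : FinGpd κ G} (F : X.carrier ⥤ Y.carrier) (e : F ⋙ Y.emb ≅ X.emb) : X ⟶ Y :=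
  Emb.mk F e

lemma faithful_fn {X Y : FinGpd κ G} (f : X ⟶ Y) : (fn f).Faithful :=
  have := Functor.Faithful.of_iso (ov f).symm
  Functor.Faithful.of_comp (fn f) Y.emb

/-- A natural transformation between the functors underlying `f` and `g`. If `κ` is `plain` it is
required to be compatible with the embeddings into `G`. -/
@[ext] structure Cell {X Y : FinGpd κ G} (f g : X ⟶ Y) where
  /-- The underlying natural transformation. -/
  nat : fn f ⟶ fn g
  plain : κ = .plain → ∀ x, Y.emb.map (nat.app x) ≫ (ov g).hom.app x = (ov f).hom.app x

instance homCategory (X Y : FinGpd κ G) : Category (X ⟶ Y) where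
  Hom f g := Cell f g
  id f := ⟨𝟙 _, fun _ x => by simp⟩
  comp s t := ⟨s.nat ≫ t.nat, fun h x => by
    rw [NatTrans.comp_app, Functor.map_comp, Category.assoc, t.plain h, s.plain h]⟩
  id_comp s := Cell.ext (Category.id_comp _)
  comp_id s := Cell.ext (Category.comp_id _)
  assoc s t r := Cell.ext (Category.assoc _ _ _)

/-- The natural transformation underlying a 2-cell. -/
def nt {X Y : FinGpd κ G} {f g : X ⟶ Y} (s : f ⟶ g) : fn f ⟶ fn g := Cell.nat s

lemma nt_plain {X Y : FinGpd κ G} {f g : X ⟶ Y} (s : f ⟶ g) (h : κ = .plain) (x : X.carrier) :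
    Y.emb.map ((nt s).app x) ≫ (ov g).hom.app x = (ov f).hom.app x := Cell.plain s h x

lemma cell_ext {X Y : FinGpd κ G} {f g : X ⟶ Y} {s t : f ⟶ g}
    (h : ∀ x, (nt s).app x = (nt t).app x) : s = t :=
  Cell.ext (NatTrans.ext (funext h))

/-- A 2-cell from its components. -/
def cell {X Y : FinGpd κ G} {f g : X ⟶ Y} (n : fn f ⟶ fn g) (h : κ = .plain → ∀ x,
    Y.emb.map (n.app x) ≫ (ov g).hom.app x = (ov f).hom.app x) : f ⟶ g := Cell.mk n h

/-- An invertible 2-cell from its components. -/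
def isoCell {X Y : FinGpd κ G} {f g : X ⟶ Y} (n : fn f ≅ fn g) (h : κ = .plain → ∀ x,
    Y.emb.map (n.hom.app x) ≫ (ov g).hom.app x = (ov f).hom.app x) : f ≅ g where
  hom := cell n.hom h
  inv := cell n.inv fun hk x => by
    rw [← h hk x, ← Category.assoc, ← Functor.map_comp, n.inv_hom_id_app, CategoryTheory.Functor.map_id,
      Category.id_comp]
  hom_inv_id := Cell.ext n.hom_inv_id
  inv_hom_id := Cell.ext n.inv_hom_id

lemma isIso_cell {X Y : FinGpd κ G} {f g : X ⟶ Y} (s : f ⟶ g) : IsIso s := by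
  have : IsIso (nt s) := NatIso.isIso_of_isIso_app _
  exact (isoCell (asIso (nt s)) (nt_plain s)).isIso_hom

/-- The horizontal composite of a 1-cell and a 2-cell. -/
def preWhisker {X Y Z : FinGpd κ G} (f : X ⟶ Y) {g h : Y ⟶ Z} (s : g ⟶ h) : f ≫ g ⟶ f ≫ h :=
  cell ((fn f).whiskerLeft (nt s)) fun hk x =>
    (Category.assoc _ _ _).symm.trans
      (congrArg (fun a => a ≫ (ov f).hom.app x) (nt_plain s hk ((fn f).obj x)))

/-- The horizontal composite of a 2-cell and a 1-cell. -/
def postWhisker {X Y Z : FinGpd κ G} {f g : X ⟶ Y} (s : f ⟶ g) (h : Y ⟶ Z) : f ≫ h ⟶ g ≫ h :=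
  cell (Functor.whiskerRight (nt s) (fn h)) fun hk x => by
    change Z.emb.map ((fn h).map ((nt s).app x)) ≫ (ov h).hom.app ((fn g).obj x) ≫
      (ov g).hom.app x = (ov h).hom.app ((fn f).obj x) ≫ (ov f).hom.app x
    rw [← nt_plain s hk, ← Category.assoc, ← Category.assoc]
    exact congrArg (fun a => a ≫ (ov g).hom.app x) ((ov h).hom.naturality ((nt s).app x))

lemma emb_id_comp {Y : FinGpd κ G} {y : Y.carrier} {z : SingleObj G} (a : Y.emb.obj y ⟶ z) :
    Y.emb.map (𝟙 y) ≫ a = a := by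
  rw [CategoryTheory.Functor.map_id, Category.id_comp]

/-- For `κ = plain`, the comma 2-category of groupoids faithfully embedded in `G`: 2-cells are
natural transformations compatible with the embeddings. For `κ = fused`, 2-cells are arbitrary
natural transformations. -/
instance : Bicategory (FinGpd κ G) where
  toCategoryStruct := categoryStruct
  homCategory := homCategory
  whiskerLeft f _ _ s := preWhisker f s
  whiskerRight s h := postWhisker s h
  associator f g h := isoCell (Functor.associator (fn f) (fn g) (fn h)) fun _ x =>
    (emb_id_comp _).trans (Category.assoc _ _ _)
  leftUnitor f := isoCell (Functor.leftUnitor (fn f)) fun _ x =>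
    (emb_id_comp _).trans (Category.comp_id _).symm
  rightUnitor f := isoCell (Functor.rightUnitor (fn f)) fun _ x =>
    (emb_id_comp _).trans (Category.id_comp _).symm
  whiskerLeft_id f g := Cell.ext rfl
  whiskerLeft_comp f _ _ _ s t := Cell.ext rfl
  id_whiskerLeft s := cell_ext fun x => ((Category.id_comp _).trans (Category.comp_id _)).symm
  comp_whiskerLeft f g _ _ s :=
    cell_ext fun x => ((Category.id_comp _).trans (Category.comp_id _)).symm
  id_whiskerRight f g := cell_ext fun x => (fn g).map_id _
  comp_whiskerRight s t h := cell_ext fun x => (fn h).map_comp _ _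
  whiskerRight_id s := cell_ext fun x => ((Category.id_comp _).trans (Category.comp_id _)).symm
  whiskerRight_comp s g h :=
    cell_ext fun x => ((Category.id_comp _).trans (Category.comp_id _)).symm
  whisker_assoc f _ _ s h :=
    cell_ext fun x => ((Category.id_comp _).trans (Category.comp_id _)).symm
  whisker_exchange s t := cell_ext fun x => ((nt t).naturality _).symm
  pentagon f g h i := cell_ext fun x => by
    change (fn i).map (𝟙 _) ≫ 𝟙 _ ≫ 𝟙 _ = 𝟙 _ ≫ 𝟙 _
    simp
  triangle f g := cell_ext fun x => by
    change 𝟙 _ ≫ 𝟙 _ = (fn g).map (𝟙 _)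
    simp

end FinGpd
end Groupoids

end

section

section General

variable {B : Type u} [Bicategory.{w, v} B]

lemma IsMackey.precomp {P X Y Z P' : B} {p : P ⟶ X} {q : P ⟶ Y} {u : X ⟶ Z} {v : Y ⟶ Z}
    (h : IsMackey p q u v) {d : P' ⟶ P} (hd : IsEquivalenceCell d) {p' : P' ⟶ X} {q' : P' ⟶ Y}
    (hp : IsIsomorphic p' (d ≫ p)) (hq : IsIsomorphic q' (d ≫ q)) : IsMackey p' q' u v := by
  obtain ⟨e, rfl⟩ := hd.exists_equivalence
  have h₁ : IsMackey e.hom (e.hom ≫ q) q (𝟙 Y) :=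
    (IsMackey.id_left (e.hom ≫ q)).symm.transport e (Equivalence.id Y) ⟨(λ_ _).symm⟩
      ⟨(ρ_ _).symm⟩ ⟨Iso.refl _⟩ ⟨(λ_ _).symm⟩
  exact (h.paste h₁).congr hp hq (isIsomorphic_refl _) ⟨(λ_ _).symm⟩

lemma precomp_isEquivalence {X Y : B} (e : X ≌ Y) (T : B) : (precomp T e.hom).IsEquivalence :=
  (CategoryTheory.Equivalence.mk (precomp T e.hom) (precomp T e.inv)
    (NatIso.ofComponents (fun t => (λ_ t).symm ≪≫ whiskerRightIso e.counit.symm t ≪≫ α_ _ _ _) (by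
      intro t t' a
      change a ≫ (λ_ t').inv ≫ e.counit.inv ▷ t' ≫ (α_ e.inv e.hom t').hom =
        ((λ_ t).inv ≫ e.counit.inv ▷ t ≫ (α_ e.inv e.hom t).hom) ≫ e.inv ◁ e.hom ◁ a
      rw [leftUnitor_inv_naturality_assoc, whisker_exchange_assoc]
      simp))
    (NatIso.ofComponents (fun t => (α_ _ _ t).symm ≪≫ whiskerRightIso e.unit.symm t ≪≫ λ_ t) (by
      intro t t' a
      change e.hom ◁ e.inv ◁ a ≫ (α_ e.hom e.inv t').inv ≫ e.unit.inv ▷ t' ≫ (λ_ t').hom =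
        ((α_ e.hom e.inv t).inv ≫ e.unit.inv ▷ t ≫ (λ_ t).hom) ≫ a
      have h := whisker_exchange e.unit.inv a
      simp only [Category.assoc, ← leftUnitor_naturality]
      rw [← reassoc_of% h]
      simp))).isEquivalence_functor

/-- Coproducts are invariant under equivalence. -/
lemma IsCoproduct.of_equivalence {X Y W W' : B} {i : X ⟶ W} {j : Y ⟶ W} (h : IsCoproduct i j)
    {d : W ⟶ W'} (hd : IsEquivalenceCell d) {i' : X ⟶ W'} {j' : Y ⟶ W'}
    (hi : IsIsomorphic i' (i ≫ d)) (hj : IsIsomorphic j' (j ≫ d)) : IsCoproduct i' j' := by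
  obtain ⟨e, rfl⟩ := hd.exists_equivalence
  obtain ⟨s⟩ := hi
  obtain ⟨t⟩ := hj
  refine ⟨fun {T} f g => ?_, fun {T} r r' a b => ?_⟩
  · obtain ⟨c, ⟨h₁⟩, ⟨h₂⟩⟩ := h.desc f g
    refine ⟨e.inv ≫ c, ⟨whiskerRightIso s _ ≪≫ α_ _ _ _ ≪≫ whiskerLeftIso i ((α_ _ _ _).symm ≪≫
      whiskerRightIso e.unit.symm c ≪≫ λ_ c) ≪≫ h₁⟩, ⟨whiskerRightIso t _ ≪≫ α_ _ _ _ ≪≫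
      whiskerLeftIso j ((α_ _ _ _).symm ≪≫ whiskerRightIso e.unit.symm c ≪≫ λ_ c) ≪≫ h₂⟩⟩
  · have := precomp_isEquivalence e T
    obtain ⟨c, ⟨h₁, h₂⟩, h₃⟩ := h.ext (e.hom ≫ r) (e.hom ≫ r')
      ((α_ _ _ _).inv ≫ s.inv ▷ r ≫ a ≫ s.hom ▷ r' ≫ (α_ _ _ _).hom)
      ((α_ _ _ _).inv ≫ t.inv ▷ r ≫ b ≫ t.hom ▷ r' ≫ (α_ _ _ _).hom)
    have key : ∀ {V : B} {k : V ⟶ W} {k' : V ⟶ W'} (s : k' ≅ k ≫ e.hom) (c : r ⟶ r')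
        (a : k' ≫ r ⟶ k' ≫ r'), k' ◁ c = a ↔ k ◁ e.hom ◁ c =
          (α_ _ _ _).inv ≫ s.inv ▷ r ≫ a ≫ s.hom ▷ r' ≫ (α_ _ _ _).hom := by
      intro V k k' s c a
      have : k ◁ e.hom ◁ c =
          (α_ _ _ _).inv ≫ s.inv ▷ r ≫ k' ◁ c ≫ s.hom ▷ r' ≫ (α_ _ _ _).hom := by
        rw [whisker_exchange_assoc]; simp
      rw [this]
      refine ⟨fun h => by rw [h], fun h => ?_⟩
      simpa only [cancel_epi, cancel_mono, ← Category.assoc] using h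
    obtain ⟨c, rfl⟩ := (precomp T e.hom).map_surjective c
    refine ⟨c, ⟨(key s c a).2 h₁, (key t c b).2 h₂⟩, fun c' hc' => ?_⟩
    exact (precomp T e.hom).map_injective (h₃ _ ⟨(key s c' a).1 hc'.1, (key t c' b).1 hc'.2⟩)

end General

namespace FinGpd

variable {κ κ' : Kind} {G : Type u} [Group G]

lemma nt_comp_app {X Y : FinGpd κ G} {f g h : X ⟶ Y} (s : f ⟶ g) (t : g ⟶ h) (x : X.carrier) :
    (nt (s ≫ t)).app x = (nt s).app x ≫ (nt t).app x := rfl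

lemma over_naturality {X Y : FinGpd κ G} (f : X ⟶ Y) {x x' : X.carrier} (a : x ⟶ x') :
    Y.emb.map ((fn f).map a) ≫ (ov f).hom.app x' = (ov f).hom.app x ≫ X.emb.map a :=
  (ov f).hom.naturality a

/-- A 1-cell whose underlying functor is an equivalence of categories is an equivalence. -/
lemma isEquivalenceCell {X Y : FinGpd κ G} (f : X ⟶ Y) [(fn f).IsEquivalence] :
    IsEquivalenceCell f := by
  let e := (fn f).asEquivalence
  let g : Y ⟶ X := mkHom e.inverse ((e.inverse).isoWhiskerLeft (ov f).symm ≪≫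
    Functor.isoWhiskerRight e.counitIso Y.emb)
  refine ⟨g, ⟨(isoCell (f := 𝟙 X) (g := f ≫ g) e.unitIso fun _ x => ?_).symm⟩,
    ⟨isoCell (f := g ≫ f) (g := 𝟙 Y) e.counitIso fun _ y => ?_⟩⟩
  · change X.emb.map (e.unit.app x) ≫ ((ov f).inv.app (e.inverse.obj (e.functor.obj x)) ≫
      Y.emb.map (e.counit.app (e.functor.obj x))) ≫ (ov f).hom.app x = 𝟙 _
    have h₁ : X.emb.map (e.unit.app x) ≫ (ov f).inv.app (e.inverse.obj (e.functor.obj x)) =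
      (ov f).inv.app x ≫ Y.emb.map (e.functor.map (e.unit.app x)) :=
        (ov f).inv.naturality (e.unit.app x)
    have h₂ : Y.emb.map (e.functor.map (e.unit.app x)) ≫
        Y.emb.map (e.counit.app (e.functor.obj x)) = 𝟙 _ := by
      rw [← Functor.map_comp]
      exact (congrArg _ (e.functor_unit_comp x)).trans (CategoryTheory.Functor.map_id _ _)
    have h₃ : (ov f).inv.app x ≫ (ov f).hom.app x = 𝟙 _ := (ov f).inv_hom_id_app x
    rw [Category.assoc, reassoc_of% h₁]
    refine Eq.trans ?_ h₃
    exact congrArg ((ov f).inv.app x ≫ ·) ((Category.assoc _ _ _).symm.trans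
      ((congrArg (· ≫ (ov f).hom.app x) h₂).trans (Category.id_comp _)))
  · change Y.emb.map (e.counit.app y) ≫ 𝟙 _ =
      (ov f).hom.app (e.inverse.obj y) ≫ (ov f).inv.app (e.inverse.obj y) ≫
        Y.emb.map (e.counit.app y)
    rw [← Category.assoc, (ov f).hom_inv_id_app, Category.comp_id]
    exact (Category.id_comp _).symm

section IsoComma

variable {X Y Z : FinGpd κ G} (u : X ⟶ Z) (v : Y ⟶ Z)

instance : IsGroupoid (Comma (fn u) (fn v)) where
  all_isIso f := by
    have : f = (Comma.isoMk (asIso f.left) (asIso f.right) f.w).hom := by ext <;> rfl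
    rw [this]; infer_instance

instance : (Comma.fst (fn u) (fn v)).Faithful where
  map_injective {s t a b} h := by
    have := faithful_fn v
    refine CommaMorphism.ext h ((fn v).map_injective ?_)
    have h₁ := a.w
    have h₂ := b.w
    have h' : a.left = b.left := h
    rw [h'] at h₁
    exact (cancel_epi s.hom).1 (h₁.symm.trans h₂)

instance [Finite G] : Finite (Comma (fn u) (fn v)) := by
  have h : ∀ z z' : Z.carrier, Finite (z ⟶ z') := fun z z' =>
    have : Finite (Z.emb.obj z ⟶ Z.emb.obj z') := inferInstanceAs (Finite G)
    Finite.of_injective _ (Z.emb.map_injective (X := z) (Y := z'))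
  have (x : X.carrier) (y : Y.carrier) : Finite ((fn u).obj x ⟶ (fn v).obj y) := h _ _
  refine Finite.of_injective (β := Σ (x : X.carrier) (y : Y.carrier), (fn u).obj x ⟶ (fn v).obj y)
    (fun c => ⟨c.left, c.right, c.hom⟩) ?_
  rintro ⟨x, y, a⟩ ⟨x', y', a'⟩ h
  simp only [Sigma.mk.injEq] at h
  obtain ⟨rfl, h⟩ := h
  rw [heq_eq_eq, Sigma.mk.injEq] at h
  obtain ⟨rfl, h⟩ := h
  rw [heq_eq_eq] at h
  subst h
  rfl

/-- The iso-comma groupoid of a cospan. -/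
def isoComma [Finite G] : FinGpd κ G where
  carrier := Comma (fn u) (fn v)
  emb := Comma.fst (fn u) (fn v) ⋙ X.emb

variable [Finite G]

/-- The first projection. -/
def fst : isoComma u v ⟶ X := mkHom (Comma.fst (fn u) (fn v)) (Iso.refl _)

/-- The natural isomorphism of the iso-comma square. -/
noncomputable def commaIso : Comma.fst (fn u) (fn v) ⋙ fn u ≅ Comma.snd (fn u) (fn v) ⋙ fn v :=
  NatIso.ofComponents (fun c => asIso c.hom) fun f => f.w

/-- The second projection. -/
noncomputable def snd : isoComma u v ⟶ Y := mkHom (Comma.snd (fn u) (fn v))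
  ((Comma.snd (fn u) (fn v)).isoWhiskerLeft (ov v).symm ≪≫
    Functor.isoWhiskerRight (commaIso u v).symm Z.emb ≪≫
    (Comma.fst (fn u) (fn v)).isoWhiskerLeft (ov u))

lemma over_snd (c : Comma (fn u) (fn v)) : Z.emb.map c.hom ≫ (ov v).hom.app c.right ≫
    (ov (snd u v)).hom.app c = (ov u).hom.app c.left := by
  have h : (ov (snd u v)).hom.app c = (ov v).inv.app c.right ≫
    Z.emb.map (inv c.hom) ≫ (ov u).hom.app c.left := rfl
  have h₁ : (ov v).hom.app c.right ≫ (ov v).inv.app c.right = 𝟙 (Z.emb.obj _) :=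
    (ov v).hom_inv_id_app c.right
  have h₂ : Z.emb.map c.hom ≫ Z.emb.map (inv c.hom) = 𝟙 _ := by
    rw [← Functor.map_comp, IsIso.hom_inv_id, CategoryTheory.Functor.map_id]
  rw [h, reassoc_of% h₁, reassoc_of% h₂]

/-- The 2-cell of the iso-comma square. -/
noncomputable def isoCommaCell : fst u v ≫ u ≅ snd u v ≫ v :=
  isoCell (commaIso u v) fun _ c => (over_snd u v c).trans (Category.comp_id _).symm

variable {u v}

/-- The functor to the iso-comma groupoid given by a square. -/
def comparison {T : FinGpd κ G} {r : T ⟶ X} {s : T ⟶ Y} (σ : r ≫ u ⟶ s ≫ v) :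
    T.carrier ⥤ Comma (fn u) (fn v) where
  obj x := ⟨(fn r).obj x, (fn s).obj x, (nt σ).app x⟩
  map f := ⟨(fn r).map f, (fn s).map f, (nt σ).naturality f⟩

/-- The 1-cell to the iso-comma groupoid given by a square. -/
def lift {T : FinGpd κ G} {r : T ⟶ X} {s : T ⟶ Y} (σ : r ≫ u ⟶ s ≫ v) : T ⟶ isoComma u v :=
  mkHom (comparison σ) (ov r)

/-- The compatibility of `lift` with the first projection. -/
def liftFst {T : FinGpd κ G} {r : T ⟶ X} {s : T ⟶ Y} (σ : r ≫ u ⟶ s ≫ v) :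
    r ≅ lift σ ≫ fst u v :=
  isoCell (Iso.refl (fn r)) fun _ _ => (emb_id_comp _).trans (Category.id_comp _)

/-- The compatibility of `lift` with the second projection. -/
noncomputable def liftSnd {T : FinGpd κ G} {r : T ⟶ X} {s : T ⟶ Y} (σ : r ≫ u ⟶ s ≫ v) :
    lift σ ≫ snd u v ≅ s :=
  isoCell (Iso.refl (fn s)) fun hk x => by
    refine (emb_id_comp _).trans ?_
    have h₁ : Z.emb.map ((nt σ).app x) ≫ (ov v).hom.app ((fn s).obj x) ≫ (ov s).hom.app x =
      (ov u).hom.app ((fn r).obj x) ≫ (ov r).hom.app x := nt_plain σ hk x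
    have h₂ : Z.emb.map ((nt σ).app x) ≫ (ov v).hom.app ((fn s).obj x) ≫
      (ov (snd u v)).hom.app ((comparison σ).obj x) = (ov u).hom.app ((fn r).obj x) :=
        over_snd u v ((comparison σ).obj x)
    change (ov s).hom.app x = (ov (snd u v)).hom.app ((comparison σ).obj x) ≫ (ov r).hom.app x
    rw [← h₂, Category.assoc, Category.assoc, cancel_epi] at h₁
    exact (cancel_epi ((ov v).hom.app ((fn s).obj x))).1 h₁

lemma nt_isoCommaCell {T : FinGpd κ G} (t : T ⟶ isoComma u v) (x : T.carrier) :
    (nt ((α_ t (fst u v) u).hom ≫ t ◁ (isoCommaCell u v).hom ≫ (α_ t (snd u v) v).inv)).app x =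
      ((fn t).obj x).hom :=
  (Category.id_comp _).trans (Category.comp_id _)

variable (u v) in
/-- Iso-comma squares are Mackey squares. -/
lemma isMackey_isoComma : IsMackey (fst u v) (snd u v) u v := by
  refine ⟨isoCommaCell u v, ⟨fun {T} r s σ => ⟨lift σ.hom, liftFst σ.hom, liftSnd σ.hom,
    cell_ext fun x => ?_⟩, fun {T} t t' β β' e => ?_⟩⟩
  · rw [nt_comp_app, nt_comp_app, nt_isoCommaCell]
    change (nt σ.hom).app x = (fn u).map (𝟙 _) ≫ (nt σ.hom).app x ≫ (fn v).map (𝟙 _)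
    rw [CategoryTheory.Functor.map_id, CategoryTheory.Functor.map_id, Category.id_comp]
    exact (Category.comp_id _).symm
  · have h : ∀ x, (fn u).map ((nt β).app x) ≫ ((fn t').obj x).hom =
        ((fn t).obj x).hom ≫ (fn v).map ((nt β').app x) := fun x => by
      rw [← nt_isoCommaCell t, ← nt_isoCommaCell t']
      exact congrArg (fun s => (nt s).app x) e
    let n : fn t ⟶ fn t' :=
      { app := fun x => ⟨(nt β).app x, (nt β').app x, h x⟩
        naturality := fun x y f => CommaMorphism.ext ((nt β).naturality f) ((nt β').naturality f) }
    refine ⟨cell n fun hk x => ?_, ⟨cell_ext fun x => rfl, cell_ext fun x => rfl⟩, fun c hc =>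
      cell_ext fun x => CommaMorphism.ext ?_ ?_⟩
    · have := nt_plain β hk x
      exact ((congrArg _ (Category.id_comp _)).symm.trans this).trans (Category.id_comp _)
    · exact congrArg (fun s => (nt s).app x) hc.1
    · exact congrArg (fun s => (nt s).app x) hc.2

/-- A square whose comparison functor to the iso-comma groupoid is an equivalence is a Mackey
square. -/
lemma isMackey {P : FinGpd κ G} {p : P ⟶ X} {q : P ⟶ Y} (γ : p ≫ u ⟶ q ≫ v)
    [h : (comparison γ).IsEquivalence] : IsMackey p q u v := by
  have : (fn (lift γ)).IsEquivalence := h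
  exact (isMackey_isoComma u v).precomp (isEquivalenceCell (lift γ)) ⟨liftFst γ⟩
    ⟨(liftSnd γ).symm⟩

end IsoComma
end FinGpd

end

section

section Sums

variable {A B C : Type u} [Category.{u} A] [Category.{u} B] [Category.{u} C]

lemma isGroupoid_sum [IsGroupoid A] [IsGroupoid B] : IsGroupoid (A ⊕ B) where
  all_isIso {x y} f := by
    rcases x with x | x <;> rcases y with y | y
    · exact inferInstanceAs (IsIso ((Sum.inl_ A B).map f.down))
    · exact f.elim
    · exact f.elim
    · exact inferInstanceAs (IsIso ((Sum.inr_ A B).map f.down))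

lemma faithful_sum' {D : Type*} [Category* D] (F : A ⥤ D) (H : B ⥤ D) [F.Faithful] [H.Faithful] :
    (F.sum' H).Faithful where
  map_injective {x y} f g h := by
    rcases x with x | x <;> rcases y with y | y
    · exact congrArg ULift.up (F.map_injective h)
    · exact f.elim
    · exact f.elim
    · exact congrArg ULift.up (H.map_injective h)

/-- A natural transformation between functors out of a disjoint union. -/
def sumNatTrans {F H : A ⊕ B ⥤ C} (a : Sum.inl_ A B ⋙ F ⟶ Sum.inl_ A B ⋙ H)
    (b : Sum.inr_ A B ⋙ F ⟶ Sum.inr_ A B ⋙ H) : F ⟶ H where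
  app x := match x with
    | .inl x => a.app x
    | .inr x => b.app x
  naturality {x y} f := by
    rcases x with x | x <;> rcases y with y | y
    · exact a.naturality f.down
    · exact f.elim
    · exact f.elim
    · exact b.naturality f.down

/-- A category over a disjoint union of groupoids is the disjoint union of its two pieces. -/
lemma isEquivalence_pieces [IsGroupoid A] [IsGroupoid B] (c : C ⥤ A ⊕ B) :
    ((Comma.snd (Sum.inl_ A B) c).sum' (Comma.snd (Sum.inr_ A B) c)).IsEquivalence := by
  have : (Comma.snd (Sum.inl_ A B) c).Faithful := ⟨fun {x y} f g h => by
    have : IsIso y.hom := isGroupoid_sum.all_isIso y.hom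
    have h' : f.right = g.right := h
    have e : (Sum.inl_ A B).map f.left = (Sum.inl_ A B).map g.left := by
      rw [← cancel_mono y.hom, f.w, g.w, h']
    exact CommaMorphism.ext (congrArg ULift.down e) h'⟩
  have : (Comma.snd (Sum.inr_ A B) c).Faithful := ⟨fun {x y} f g h => by
    have : IsIso y.hom := isGroupoid_sum.all_isIso y.hom
    have h' : f.right = g.right := h
    have e : (Sum.inr_ A B).map f.left = (Sum.inr_ A B).map g.left := by
      rw [← cancel_mono y.hom, f.w, g.w, h']
    exact CommaMorphism.ext (congrArg ULift.down e) h'⟩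
  refine { faithful := faithful_sum' _ _, full := ⟨fun {x y} f => ?_⟩, essSurj := ⟨fun t => ?_⟩ }
  · rcases x with x | x <;> rcases y with y | y
    · have : IsIso y.hom := isGroupoid_sum.all_isIso y.hom
      let f' : x.right ⟶ y.right := f
      let a : (Sum.inl_ A B).obj x.left ⟶ (Sum.inl_ A B).obj y.left := x.hom ≫ c.map f' ≫ inv y.hom
      have ha : a ≫ y.hom = x.hom ≫ c.map f' := by simp [a]
      let g : x ⟶ y := ⟨a.down, f', ha⟩
      exact ⟨(Sum.inl_ _ _).map g, rfl⟩
    · have : IsIso y.hom := isGroupoid_sum.all_isIso y.hom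
      let f' : x.right ⟶ y.right := f
      let a : (Sum.inl_ A B).obj x.left ⟶ (Sum.inr_ A B).obj y.left := x.hom ≫ c.map f' ≫ inv y.hom
      exact a.elim
    · have : IsIso y.hom := isGroupoid_sum.all_isIso y.hom
      let f' : x.right ⟶ y.right := f
      let a : (Sum.inr_ A B).obj x.left ⟶ (Sum.inl_ A B).obj y.left := x.hom ≫ c.map f' ≫ inv y.hom
      exact a.elim
    · have : IsIso y.hom := isGroupoid_sum.all_isIso y.hom
      let f' : x.right ⟶ y.right := f
      let a : (Sum.inr_ A B).obj x.left ⟶ (Sum.inr_ A B).obj y.left := x.hom ≫ c.map f' ≫ inv y.hom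
      have ha : a ≫ y.hom = x.hom ≫ c.map f' := by simp [a]
      let g : x ⟶ y := ⟨a.down, f', ha⟩
      exact ⟨(Sum.inr_ _ _).map g, rfl⟩
  · rcases h : c.obj t with x | x
    · exact ⟨.inl ⟨x, t, eqToHom h.symm⟩, ⟨Iso.refl _⟩⟩
    · exact ⟨.inr ⟨x, t, eqToHom h.symm⟩, ⟨Iso.refl _⟩⟩

end Sums

namespace FinGpd

variable {κ κ' : Kind} {G : Type u} [Group G]

section Coproducts

/-- The disjoint union. -/
def sum (X Y : FinGpd κ G) : FinGpd κ G where
  carrier := X.carrier ⊕ Y.carrier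
  emb := X.emb.sum' Y.emb
  isGroupoid := isGroupoid_sum
  faithful := faithful_sum' _ _

/-- The first inclusion. -/
def inl (X Y : FinGpd κ G) : X ⟶ sum X Y :=
  mkHom (Sum.inl_ X.carrier Y.carrier) (Functor.inlCompSum' _ _)

/-- The second inclusion. -/
def inr (X Y : FinGpd κ G) : Y ⟶ sum X Y :=
  mkHom (Sum.inr_ X.carrier Y.carrier) (Functor.inrCompSum' _ _)

/-- The natural isomorphism over `G` for a functor out of a disjoint union. -/
def descOver {X Y T : FinGpd κ G} (f : X ⟶ T) (g : Y ⟶ T) :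
    (fn f).sum' (fn g) ⋙ T.emb ≅ (sum X Y).emb :=
  Functor.sumIsoExt (A := X.carrier) (B := Y.carrier)
    (NatIso.ofComponents (fun x => (ov f).app x) fun a => (ov f).hom.naturality a)
    (NatIso.ofComponents (fun x => (ov g).app x) fun a => (ov g).hom.naturality a)

/-- The 1-cell out of a disjoint union. -/
def desc {X Y T : FinGpd κ G} (f : X ⟶ T) (g : Y ⟶ T) : sum X Y ⟶ T :=
  mkHom ((fn f).sum' (fn g)) (descOver f g)

/-- The compatibility of `desc` with the first inclusion. -/
def inlDesc {X Y T : FinGpd κ G} (f : X ⟶ T) (g : Y ⟶ T) : inl X Y ≫ desc f g ≅ f :=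
  isoCell (Functor.inlCompSum' (fn f) (fn g)) fun _ _ =>
    (emb_id_comp _).trans (Category.comp_id _).symm

/-- The compatibility of `desc` with the second inclusion. -/
def inrDesc {X Y T : FinGpd κ G} (f : X ⟶ T) (g : Y ⟶ T) : inr X Y ≫ desc f g ≅ g :=
  isoCell (Functor.inrCompSum' (fn f) (fn g)) fun _ _ =>
    (emb_id_comp _).trans (Category.comp_id _).symm

lemma isCoproduct_sum (X Y : FinGpd κ G) : IsCoproduct (inl X Y) (inr X Y) where
  desc f g := ⟨desc f g, ⟨inlDesc f g⟩, ⟨inrDesc f g⟩⟩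
  ext {T} t t' a b := by
    let n : fn t ⟶ fn t' := sumNatTrans (nt a) (nt b)
    refine ⟨cell n fun hk x => ?_, ⟨cell_ext fun x => rfl, cell_ext fun x => rfl⟩, fun c hc =>
      cell_ext fun x => ?_⟩
    · rcases x with x | x
      · have h : T.emb.map ((nt a).app x) ≫ (ov t').hom.app (.inl x) ≫ 𝟙 _ =
          (ov t).hom.app (.inl x) ≫ 𝟙 _ := nt_plain a hk x
        rw [← Category.assoc] at h
        exact ((Category.comp_id _).symm.trans h).trans (Category.comp_id _)
      · have h : T.emb.map ((nt b).app x) ≫ (ov t').hom.app (.inr x) ≫ 𝟙 _ =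
          (ov t).hom.app (.inr x) ≫ 𝟙 _ := nt_plain b hk x
        rw [← Category.assoc] at h
        exact ((Category.comp_id _).symm.trans h).trans (Category.comp_id _)
    · rcases x with x | x
      · exact congrArg (fun s => (nt s).app x) hc.1
      · exact congrArg (fun s => (nt s).app x) hc.2

/-- A disjoint union decomposition, up to equivalence, is a coproduct. -/
lemma isCoproduct {X Y W : FinGpd κ G} (i : X ⟶ W) (j : Y ⟶ W)
    [h : ((fn i).sum' (fn j)).IsEquivalence] : IsCoproduct i j := by
  have : (fn (desc i j)).IsEquivalence := h
  exact (isCoproduct_sum X Y).of_equivalence (isEquivalenceCell (desc i j)) ⟨(inlDesc i j).symm⟩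
    ⟨(inrDesc i j).symm⟩

lemma isInitialObject {E : FinGpd κ G} (h : IsEmpty E.carrier) : IsInitialObject E where
  desc _ := ⟨mkHom ⟨fun x => (h.false x).elim, fun {x} _ _ => (h.false x).elim,
    fun x => (h.false x).elim, fun {x} _ _ _ _ => (h.false x).elim⟩
    (NatIso.ofComponents (fun x => (h.false x).elim) fun {x} _ _ => (h.false x).elim)⟩
  ext _ _ := ⟨cell ⟨fun x => (h.false x).elim, fun x _ _ => (h.false x).elim⟩
    fun _ x => (h.false x).elim, trivial, fun _ _ => cell_ext fun x => (h.false x).elim⟩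

variable (κ G) in
/-- The empty groupoid. -/
def empty : FinGpd κ G where
  carrier := Discrete PEmpty
  emb := Functor.empty _
  isGroupoid := ⟨fun {x} _ _ => x.as.elim⟩
  faithful := ⟨fun {x} _ _ _ _ => x.as.elim⟩

instance spannable [Finite G] : Spannable (FinGpd κ G) where
  isIso_cell := isIso_cell
  mackey u v := ⟨_, _, _, isMackey_isoComma u v⟩
  coproduct X Y := by
    refine ⟨_, _, _, isCoproduct_sum X Y, fun {T} c => ?_⟩
    have : ((fn (snd (inl X Y) c)).sum' (fn (snd (inr X Y) c))).IsEquivalence :=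
      isEquivalence_pieces (fn c)
    exact ⟨_, _, snd (inl X Y) c, fst (inl X Y) c, snd (inr X Y) c, fst (inr X Y) c,
      isMackey_isoComma _ _, isMackey_isoComma _ _, isCoproduct _ _⟩
  initial := ⟨empty κ G, isInitialObject ⟨fun x => x.as.elim⟩⟩
  strict_initial {T E} f h := by
    obtain ⟨g⟩ := h.desc (empty κ G)
    exact isInitialObject ⟨fun x => ((fn g).obj ((fn f).obj x)).as.elim⟩

end Coproducts
end FinGpd

end

section

variable {κ κ' : Kind} {G : Type u} [Group G]

namespace FinGSet

/-- A finite `G`-set, with another choice of 2-cells. -/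
def inclObj (κ' : Kind) (X : FinGSet κ G) : FinGSet κ' G := ⟨X.carrier⟩

/-- A `G`-map, with another choice of 2-cells. -/
def inclMap (κ' : Kind) {X Y : FinGSet κ G} (f : X ⟶ Y) : inclObj κ' X ⟶ inclObj κ' Y :=
  ofMap (X := inclObj κ' X) (Y := inclObj κ' Y) (app f) (app_smul f)

/-- The effect of the inclusion on twisting maps. -/
def inclCell (h : κ' = .plain → κ = .plain) {X Y : FinGSet κ G} {f g : X ⟶ Y} (s : f ⟶ g) :
    inclMap κ' f ⟶ inclMap κ' g :=
  cell (f := inclMap κ' f) (g := inclMap κ' g) (tw (X := X) (Y := Y) (f := f) (g := g) s)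
    (tw_smul (X := X) (Y := Y) (f := f) (g := g) s) (tw_app (X := X) (Y := Y) (f := f) (g := g) s)
    fun hk => tw_plain (X := X) (Y := Y) (f := f) (g := g) s (h hk)

/-- The inclusion of the discrete 2-category of `G`-sets into the 2-category of fused `G`-sets
(for `κ = plain` and `κ' = fused`), the identity on objects and 1-cells. -/
def incl (h : κ' = .plain → κ = .plain) : FinGSet κ G ⥤ᵖ FinGSet κ' G where
  obj X := inclObj κ' X
  map f := inclMap κ' f
  map₂ s := inclCell h s
  mapId X := iso (ofEq fun _ => rfl)
  mapComp f g := iso (ofEq fun _ => rfl)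
  map₂_id f := cell_ext fun x => rfl
  map₂_comp s t := cell_ext fun x => rfl
  map₂_whisker_left f _ _ s := cell_ext fun x => by
    change tw s (app f x) = (1 : G)⁻¹ * tw s (app f x) * 1
    simp
  map₂_whisker_right s f := cell_ext fun x => by
    change tw s x = (1 : G)⁻¹ * tw s x * 1
    simp
  map₂_associator f g h := cell_ext fun x => by
    change (1 : G) = (((1 : G)⁻¹ * (1 : G)⁻¹) * 1 * 1) * 1
    simp
  map₂_left_unitor f := cell_ext fun x => by
    change (1 : G) = 1 * 1 * 1
    simp
  map₂_right_unitor f := cell_ext fun x => by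
    change (1 : G) = 1 * 1 * 1
    simp

instance (h : κ' = .plain → κ = .plain) : PreservesSpans (incl (G := G) h) where
  mackey u v := ⟨_, _, _, isMackey_pullback u v, isMackey_pullback (inclMap κ' u) (inclMap κ' v)⟩
  coproduct X Y := ⟨_, _, _, isCoproduct_sum X Y, isCoproduct_sum (inclObj κ' X) (inclObj κ' Y)⟩
  initial := ⟨empty κ G, isInitialObject ⟨fun x => x.elim⟩, isInitialObject (E := empty κ' G)
    ⟨fun x => x.elim⟩⟩

end FinGSet

namespace FinGpd

/-- A groupoid embedded in `G`, with another choice of 2-cells. -/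
def inclObj (κ' : Kind) (X : FinGpd κ G) : FinGpd κ' G := ⟨X.carrier, X.emb⟩

/-- A 1-cell, with another choice of 2-cells. -/
def inclMap (κ' : Kind) {X Y : FinGpd κ G} (f : X ⟶ Y) : inclObj κ' X ⟶ inclObj κ' Y :=
  mkHom (X := inclObj κ' X) (Y := inclObj κ' Y) (fn (X := X) (Y := Y) f) (ov (X := X) (Y := Y) f)

/-- The effect of the inclusion on natural transformations. -/
def inclCell (h : κ' = .plain → κ = .plain) {X Y : FinGpd κ G} {f g : X ⟶ Y} (s : f ⟶ g) :
    inclMap κ' f ⟶ inclMap κ' g :=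
  cell (f := inclMap κ' f) (g := inclMap κ' g) (nt (X := X) (Y := Y) s)
    fun hk => nt_plain (X := X) (Y := Y) s (h hk)

/-- The inclusion of the comma 2-category of groupoids embedded into `G` into its fused variant
(for `κ = plain` and `κ' = fused`), the identity on objects and 1-cells. -/
def incl (h : κ' = .plain → κ = .plain) : FinGpd κ G ⥤ᵖ FinGpd κ' G where
  obj X := inclObj κ' X
  map f := inclMap κ' f
  map₂ s := inclCell h s
  mapId X := isoCell (Iso.refl _) fun _ _ => emb_id_comp _
  mapComp f g := isoCell (Iso.refl _) fun _ _ => emb_id_comp _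
  map₂_id f := cell_ext fun x => rfl
  map₂_comp s t := cell_ext fun x => rfl
  map₂_whisker_left f _ _ s :=
    cell_ext fun x => ((Category.id_comp _).trans (Category.comp_id _)).symm
  map₂_whisker_right s f :=
    cell_ext fun x => ((Category.id_comp _).trans (Category.comp_id _)).symm
  map₂_associator f g h := cell_ext fun x => by
    change 𝟙 _ = 𝟙 _ ≫ (fn h).map (𝟙 _) ≫ 𝟙 _ ≫ 𝟙 _ ≫ 𝟙 _
    simp
  map₂_left_unitor f := cell_ext fun x => by
    change 𝟙 _ = 𝟙 _ ≫ (fn f).map (𝟙 _) ≫ 𝟙 _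
    rw [Category.id_comp, Category.comp_id]
    exact ((fn f).map_id _).symm
  map₂_right_unitor f := cell_ext fun x => by
    change 𝟙 _ = 𝟙 _ ≫ 𝟙 _ ≫ 𝟙 _
    simp

instance [Finite G] (h : κ' = .plain → κ = .plain) :
    PreservesSpans (incl (G := G) h) where
  mackey u v := ⟨_, _, _, isMackey_isoComma u v, isMackey_isoComma (inclMap κ' u) (inclMap κ' v)⟩
  coproduct X Y := ⟨_, _, _, isCoproduct_sum X Y, isCoproduct_sum (inclObj κ' X) (inclObj κ' Y)⟩
  initial := ⟨empty κ G, isInitialObject ⟨fun x => x.as.elim⟩, isInitialObject (E := empty κ' G)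
    ⟨fun x => x.as.elim⟩⟩

end FinGpd

/-- The objects of the transport groupoid of a `G`-set: the points. -/
structure Transport (G : Type u) [Group G] (X : Type u) [MulAction G X] where
  /-- The underlying point. -/
  pt : X

namespace Transport

section
variable {X : Type u} [MulAction G X]

/-- A morphism `x ⟶ y` of the transport groupoid is an element `g` with `g • x = y`. -/
instance : Category (Transport G X) where
  Hom x y := {g : G // g • x.pt = y.pt}
  id x := ⟨1, one_smul G x.pt⟩
  comp f g := ⟨g.1 * f.1, by rw [mul_smul, f.2, g.2]⟩
  id_comp f := Subtype.ext (mul_one f.1)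
  comp_id f := Subtype.ext (one_mul f.1)
  assoc f g h := Subtype.ext (mul_assoc h.1 g.1 f.1).symm

instance : IsGroupoid (Transport G X) where
  all_isIso f := ⟨⟨f.1⁻¹, by rw [inv_smul_eq_iff, f.2]⟩, Subtype.ext (inv_mul_cancel f.1),
    Subtype.ext (mul_inv_cancel f.1)⟩

instance [Finite X] : Finite (Transport G X) :=
  Finite.of_injective pt fun ⟨_⟩ ⟨_⟩ h => congrArg mk h

variable (G X) in
/-- The faithful functor from the transport groupoid to `G`. -/
def proj : Transport G X ⥤ SingleObj G where
  obj _ := SingleObj.star G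
  map f := f.1

instance : (proj G X).Faithful := ⟨fun h => Subtype.ext h⟩

lemma hom_ext {x y : Transport G X} {f g : x ⟶ y} (h : f.1 = g.1) : f = g := Subtype.ext h

end

/-- The transport groupoid, embedded in `G`. -/
def of (κ' : Kind) (X : FinGSet κ G) : FinGpd κ' G where
  carrier := Transport G X.carrier
  emb := proj G X.carrier

/-- The functor between transport groupoids induced by a `G`-map. -/
def functor {X Y : FinGSet κ G} (f : X ⟶ Y) : Transport G X.carrier ⥤ Transport G Y.carrier where
  obj x := ⟨FinGSet.app f x.pt⟩
  map {x y} a := ⟨a.1, (FinGSet.app_smul f a.1 x.pt).symm.trans (congrArg (FinGSet.app f) a.2)⟩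

/-- The natural transformation induced by a twisting map. -/
def natTrans {X Y : FinGSet κ G} {f g : X ⟶ Y} (s : f ⟶ g) : functor f ⟶ functor g where
  app x := ⟨FinGSet.tw s x.pt, FinGSet.tw_app s x.pt⟩
  naturality {x y} a := hom_ext (by
    change FinGSet.tw s y.pt * a.1 = a.1 * FinGSet.tw s x.pt
    have h : FinGSet.tw s y.pt = a.1 * FinGSet.tw s x.pt * a.1⁻¹ :=
      (congrArg (FinGSet.tw s) a.2.symm).trans (FinGSet.tw_smul s a.1 x.pt)
    rw [h, inv_mul_cancel_right])

/-- The 1-cell between transport groupoids induced by a `G`-map. -/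
def map (κ' : Kind) {X Y : FinGSet κ G} (f : X ⟶ Y) : of κ' X ⟶ of κ' Y :=
  FinGpd.mkHom (functor f) (Iso.refl _)

end Transport

/-- The transport groupoid construction. For `κ = κ'` it is the 2-functor from (fused) `G`-sets
to (fused) groupoids embedded in `G`. -/
def transport (h : κ' = .plain → κ = .plain) : FinGSet κ G ⥤ᵖ FinGpd κ' G where
  obj X := Transport.of κ' X
  map f := Transport.map κ' f
  map₂ s := FinGpd.cell (Transport.natTrans s) fun hk x => (Category.comp_id _).trans
    (FinGSet.tw_plain s (h hk) x.pt)
  mapId X := FinGpd.isoCell (Iso.refl _) fun _ _ => FinGpd.emb_id_comp _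
  mapComp f g := FinGpd.isoCell (Iso.refl _) fun _ _ => (FinGpd.emb_id_comp _).trans
    (Category.comp_id _)
  map₂_id f := FinGpd.cell_ext fun x => rfl
  map₂_comp s t := FinGpd.cell_ext fun x => rfl
  map₂_whisker_left f _ _ s :=
    FinGpd.cell_ext fun x => ((Category.id_comp _).trans (Category.comp_id _)).symm
  map₂_whisker_right s f :=
    FinGpd.cell_ext fun x => ((Category.id_comp _).trans (Category.comp_id _)).symm
  map₂_associator f g h := FinGpd.cell_ext fun x => Transport.hom_ext (by
    change 1 = (((1 * 1) * 1) * 1) * 1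
    simp)
  map₂_left_unitor f := FinGpd.cell_ext fun x => Transport.hom_ext (by
    change 1 = (1 * 1) * 1
    simp)
  map₂_right_unitor f := FinGpd.cell_ext fun x => Transport.hom_ext (by
    change 1 = (1 * 1) * 1
    simp)

instance [Finite G] (h : κ' = .plain → κ = .plain) :
    PreservesSpans (transport (G := G) h) where
  mackey {X Y Z} u v := by
    refine ⟨_, _, _, FinGSet.isMackey_pullback u v, ?_⟩
    let γ : (transport h).map (FinGSet.fst u v) ≫ (transport h).map u ⟶
        (transport h).map (FinGSet.snd u v) ≫ (transport h).map v :=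
      ((transport h).mapComp _ _).inv ≫ (transport h).map₂
        (FinGSet.ofEq (f := FinGSet.fst u v ≫ u) (g := FinGSet.snd u v ≫ v) fun t => t.2) ≫
        ((transport h).mapComp _ _).hom
    have hγ : ∀ t, (((FinGpd.nt γ).app t).1 : G) = 1 := fun t => by
      change (1 * 1 * 1 : G) = 1
      simp
    have : (FinGpd.comparison γ).IsEquivalence := by
      refine { faithful := ⟨fun {t t'} a b e => ?_⟩, full := ⟨fun {t t'} e => ?_⟩,
               essSurj := ⟨fun c => ?_⟩ }
      · exact Transport.hom_ext (congrArg (fun e => e.left.1) e)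
      · have w := congrArg Subtype.val e.w
        change ((FinGpd.nt γ).app t').1 * e.left.1 = e.right.1 * ((FinGpd.nt γ).app t).1 at w
        rw [hγ, hγ, one_mul, mul_one] at w
        refine ⟨⟨e.left.1, Subtype.ext (Prod.ext e.left.2 ?_)⟩, CommaMorphism.ext ?_ ?_⟩
        · exact (congrArg (fun g => g • t.pt.1.2) w).trans e.right.2
        · exact Transport.hom_ext rfl
        · exact Transport.hom_ext w
      · have hc : FinGSet.app u (c.hom.1 • c.left.pt) = FinGSet.app v c.right.pt := by
          rw [FinGSet.app_smul]; exact c.hom.2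
        let t : Transport G (FinGSet.pullback u v).carrier :=
          ⟨⟨(c.hom.1 • c.left.pt, c.right.pt), hc⟩⟩
        let a : c.left ⟶ ((FinGpd.comparison γ).obj t).left := ⟨c.hom.1, rfl⟩
        refine ⟨t, ⟨(Comma.isoMk (X := c) (Y := (FinGpd.comparison γ).obj t) (asIso a)
          (Iso.refl c.right) (Transport.hom_ext ?_)).symm⟩⟩
        exact congrArg (· * c.hom.1) (hγ t)
    exact FinGpd.isMackey γ
  coproduct X Y := by
    refine ⟨_, _, _, FinGSet.isCoproduct_sum X Y, ?_⟩
    have : ((FinGpd.fn ((transport h).map (FinGSet.inl X Y))).sum'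
        (FinGpd.fn ((transport h).map (FinGSet.inr X Y)))).IsEquivalence := by
      have := FinGpd.faithful_fn ((transport h).map (FinGSet.inl X Y))
      have := FinGpd.faithful_fn ((transport h).map (FinGSet.inr X Y))
      refine { faithful := faithful_sum' _ _, full := ⟨fun {t t'} e => ?_⟩,
               essSurj := ⟨fun t => ?_⟩ }
      · rcases t with t | t <;> rcases t' with t' | t'
        · exact ⟨(Sum.inl_ _ _).map ⟨e.1, Sum.inl_injective e.2⟩, rfl⟩
        · exact (Sum.inl_ne_inr e.2).elim
        · exact (Sum.inr_ne_inl e.2).elim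
        · exact ⟨(Sum.inr_ _ _).map ⟨e.1, Sum.inr_injective e.2⟩, rfl⟩
      · rcases t with ⟨t | t⟩
        · exact ⟨.inl ⟨t⟩, ⟨Iso.refl _⟩⟩
        · exact ⟨.inr ⟨t⟩, ⟨Iso.refl _⟩⟩
    exact FinGpd.isCoproduct _ _
  initial := ⟨FinGSet.empty κ G, FinGSet.isInitialObject (inferInstanceAs (IsEmpty PEmpty)),
    FinGpd.isInitialObject ⟨fun x => x.pt.elim⟩⟩

end

section

section Bouc

variable {G : Type u} [Group G]

/-- Two parallel `G`-maps are identified in the category of fused `G`-sets if they differ by a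
twisting map `τ`. -/
def IsTwist {κ : Kind} {X Y : FinGSet κ G} (f g : X ⟶ Y) : Prop :=
  ∃ τ : X.carrier → G, (∀ (a : G) x, τ (a • x) = a * τ x * a⁻¹) ∧
    ∀ x, τ x • FinGSet.app f x = FinGSet.app g x

lemma isTwist_iff {X Y : FinGSet .fused G} {f g : X ⟶ Y} : IsTwist f g ↔ IsIsomorphic f g :=
  ⟨fun ⟨τ, h₁, h₂⟩ => FinGSet.isIsomorphic (FinGSet.cell τ h₁ h₂ nofun),
    fun ⟨s⟩ => ⟨_, FinGSet.tw_smul s.hom, FinGSet.tw_app s.hom⟩⟩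

/-- The relation `IsTwist` is an equivalence relation. -/
instance twistSetoid (X Y : FinGSet .fused G) : Setoid (X ⟶ Y) where
  r := IsTwist
  iseqv := ⟨fun _ => isTwist_iff.2 (isIsomorphic_refl _),
    fun h => isTwist_iff.2 (isIsomorphic_symm (isTwist_iff.1 h)),
    fun h h' => isTwist_iff.2 (isIsomorphic_trans (isTwist_iff.1 h) (isTwist_iff.1 h'))⟩

lemma isTwist_comp {X Y Z : FinGSet .fused G} {f f' : X ⟶ Y} {g g' : Y ⟶ Z} (h : IsTwist f f')
    (h' : IsTwist g g') : IsTwist (f ≫ g) (f' ≫ g') :=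
  isTwist_iff.2 (isIsomorphic_comp (isTwist_iff.1 h) (isTwist_iff.1 h'))

/-- The objects of Bouc's category of fused `G`-sets: the finite `G`-sets. -/
structure FusedGSet (G : Type u) [Group G] where
  /-- The underlying finite `G`-set. -/
  as : FinGSet .fused G

/-- Bouc's category of fused `G`-sets: the quotient of the category of finite `G`-sets in which
two parallel maps are identified if they differ by a twisting map. -/
instance : Category (FusedGSet G) where
  Hom X Y := Quotient (twistSetoid X.as Y.as)
  id X := Quotient.mk _ (𝟙 X.as)
  comp f g := Quotient.map₂ (fun f g => f ≫ g) (fun _ _ hf _ _ hg => isTwist_comp hf hg) f g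
  id_comp f := by
    induction f using Quotient.inductionOn
    rfl
  comp_id f := by
    induction f using Quotient.inductionOn
    rfl
  assoc f g h := by
    induction f using Quotient.inductionOn
    induction g using Quotient.inductionOn
    induction h using Quotient.inductionOn
    rfl

namespace FusedGSet

/-- The class of a `G`-map. -/
def mkHom {X Y : FinGSet .fused G} (f : X ⟶ Y) : FusedGSet.mk X ⟶ FusedGSet.mk Y :=
  Quotient.mk _ f

lemma mkHom_eq_iff {X Y : FinGSet .fused G} {f g : X ⟶ Y} : mkHom f = mkHom g ↔ IsTwist f g :=
  ⟨fun h => Quotient.exact h, fun h => Quotient.sound h⟩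

lemma mkHom_comp {X Y Z : FinGSet .fused G} (f : X ⟶ Y) (g : Y ⟶ Z) :
    mkHom (f ≫ g) = mkHom f ≫ mkHom g := rfl

/-- A `G`-map representing a morphism of fused `G`-sets. -/
noncomputable def rep {X Y : FusedGSet G} (f : X ⟶ Y) : X.as ⟶ Y.as := Quotient.out f

@[simp] lemma mkHom_rep {X Y : FusedGSet G} (f : X ⟶ Y) : mkHom (rep f) = f := Quotient.out_eq f

end FusedGSet

open FusedGSet

/-- A span in the category of fused `G`-sets. -/
structure FusedSpan (X Y : FusedGSet G) where
  /-- The object in the middle. -/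
  apex : FusedGSet G
  /-- The left leg. -/
  left : apex ⟶ X
  /-- The right leg. -/
  right : apex ⟶ Y

namespace FusedSpan

variable {X Y Z : FusedGSet G}

/-- Isomorphism of spans. -/
def IsIsom (S S' : FusedSpan X Y) : Prop :=
  ∃ e : S.apex ≅ S'.apex, S.left = e.hom ≫ S'.left ∧ S.right = e.hom ≫ S'.right

/-- Isomorphism of spans is an equivalence relation. -/
instance setoid (X Y : FusedGSet G) : Setoid (FusedSpan X Y) where
  r := IsIsom
  iseqv := ⟨fun _ => ⟨Iso.refl _, by simp, by simp⟩,
    fun ⟨e, h₁, h₂⟩ => ⟨e.symm, by simp [h₁], by simp [h₂]⟩,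
    fun ⟨e, h₁, h₂⟩ ⟨e', h₁', h₂'⟩ => ⟨e ≪≫ e', by simp [h₁, h₁'], by simp [h₂, h₂']⟩⟩

/-- The composite of two spans, formed by a pullback of `G`-sets. The choice of the `G`-maps
representing the inner legs is immaterial, see `FusedSpan.comp_mk`. -/
noncomputable def comp (S : FusedSpan X Y) (T : FusedSpan Y Z) : FusedSpan X Z where
  apex := ⟨FinGSet.pullback (rep S.right) (rep T.left)⟩
  left := mkHom (FinGSet.fst _ _) ≫ S.left
  right := mkHom (FinGSet.snd _ _) ≫ T.right

/-- The sum of two spans, given by the disjoint union of the middle objects. -/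
noncomputable def add (S T : FusedSpan X Y) : FusedSpan X Y where
  apex := ⟨FinGSet.sum S.apex.as T.apex.as⟩
  left := mkHom (FinGSet.desc (rep S.left) (rep T.left))
  right := mkHom (FinGSet.desc (rep S.right) (rep T.right))

/-- The span with empty middle object. -/
def zero (X Y : FusedGSet G) : FusedSpan X Y where
  apex := ⟨FinGSet.empty .fused G⟩
  left := mkHom (FinGSet.ofMap (X := FinGSet.empty .fused G) PEmpty.elim fun _ x => x.elim)
  right := mkHom (FinGSet.ofMap (X := FinGSet.empty .fused G) PEmpty.elim fun _ x => x.elim)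

/-- The span of fused `G`-sets represented by a span of `G`-sets. -/
def ofSpan {X Y : FinGSet .fused G} (S : Span X Y) : FusedSpan ⟨X⟩ ⟨Y⟩ :=
  ⟨⟨S.apex⟩, mkHom S.left, mkHom S.right⟩

/-- A span of `G`-sets representing a span of fused `G`-sets. -/
noncomputable def toSpan (S : FusedSpan X Y) : Span X.as Y.as :=
  ⟨S.apex.as, rep S.left, rep S.right⟩

lemma ofSpan_toSpan (S : FusedSpan X Y) : ofSpan S.toSpan = S := by
  rcases S with ⟨a, l, r⟩
  exact congrArg₂ (FusedSpan.mk a) (mkHom_rep l) (mkHom_rep r)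

lemma isIsom_ofSpan {X Y : FinGSet .fused G} {S S' : Span X Y} :
    IsIsom (ofSpan S) (ofSpan S') ↔ S.Equiv S' := by
  constructor
  · rintro ⟨e, h₁, h₂⟩
    rw [← mkHom_rep e.hom] at h₁ h₂
    have h₃ : mkHom (rep e.hom) ≫ mkHom (rep e.inv) = 𝟙 _ := by
      rw [mkHom_rep, mkHom_rep]
      exact e.hom_inv_id
    have h₄ : mkHom (rep e.inv) ≫ mkHom (rep e.hom) = 𝟙 _ := by
      rw [mkHom_rep, mkHom_rep]
      exact e.inv_hom_id
    exact ⟨rep e.hom, ⟨rep e.inv, isTwist_iff.1 (mkHom_eq_iff.1 h₃),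
      isTwist_iff.1 (mkHom_eq_iff.1 h₄)⟩, isTwist_iff.1 (mkHom_eq_iff.1 h₁),
      isTwist_iff.1 (mkHom_eq_iff.1 h₂)⟩
  · rintro ⟨s, ⟨r, h₁, h₂⟩, h₃, h₄⟩
    exact ⟨⟨mkHom s, mkHom r, mkHom_eq_iff.2 (isTwist_iff.2 h₁), mkHom_eq_iff.2 (isTwist_iff.2 h₂)⟩,
      mkHom_eq_iff.2 (isTwist_iff.2 h₃), mkHom_eq_iff.2 (isTwist_iff.2 h₄)⟩

lemma isIsom_iff {S S' : FusedSpan X Y} : S.IsIsom S' ↔ S.toSpan.Equiv S'.toSpan := by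
  rw [← isIsom_ofSpan, ofSpan_toSpan, ofSpan_toSpan]

lemma toSpan_ofSpan {X Y : FinGSet .fused G} (S : Span X Y) : (ofSpan S).toSpan.Equiv S := by
  rw [← isIsom_ofSpan, ofSpan_toSpan]
  exact (setoid _ _).refl _

lemma isComp (S : FusedSpan X Y) (T : FusedSpan Y Z) :
    ∃ R, Span.IsComp S.toSpan T.toSpan R ∧ ofSpan R = S.comp T := by
  refine ⟨⟨FinGSet.pullback (rep S.right) (rep T.left), FinGSet.fst _ _ ≫ rep S.left,
    FinGSet.snd _ _ ≫ rep T.right⟩, ⟨FinGSet.fst _ _, FinGSet.snd _ _,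
    FinGSet.isMackey_pullback _ _, isIsomorphic_refl _, isIsomorphic_refl _⟩, ?_⟩
  rw [ofSpan, mkHom_comp, mkHom_comp, mkHom_rep, mkHom_rep]
  rfl

lemma isSum (S T : FusedSpan X Y) :
    ∃ R, Span.IsSum S.toSpan T.toSpan R ∧ ofSpan R = S.add T :=
  ⟨⟨FinGSet.sum S.apex.as T.apex.as, FinGSet.desc (rep S.left) (rep T.left),
    FinGSet.desc (rep S.right) (rep T.right)⟩, ⟨FinGSet.inl _ _, FinGSet.inr _ _,
    FinGSet.isCoproduct_sum _ _, isIsomorphic_refl _, isIsomorphic_refl _, isIsomorphic_refl _,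
    isIsomorphic_refl _⟩, rfl⟩

lemma comp_ofSpan {X Y Z : FinGSet .fused G} {S : Span X Y} {T : Span Y Z} {R : Span X Z}
    (h : Span.IsComp S T R) : ((ofSpan S).comp (ofSpan T)).IsIsom (ofSpan R) := by
  obtain ⟨R', h', e⟩ := isComp (ofSpan S) (ofSpan T)
  rw [← e, isIsom_ofSpan]
  exact h'.equiv h (toSpan_ofSpan S) (toSpan_ofSpan T)

lemma add_ofSpan {X Y : FinGSet .fused G} {S T R : Span X Y}
    (h : Span.IsSum S T R) : ((ofSpan S).add (ofSpan T)).IsIsom (ofSpan R) := by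
  obtain ⟨R', h', e⟩ := isSum (ofSpan S) (ofSpan T)
  rw [← e, isIsom_ofSpan]
  exact h'.equiv h (toSpan_ofSpan S) (toSpan_ofSpan T)

/-- Spans of fused `G`-sets are composed by pullback of arbitrary representatives. -/
lemma comp_mk {A B X Y Z : FinGSet .fused G} (l : A ⟶ X) (u : A ⟶ Y) (v : B ⟶ Y) (r : B ⟶ Z) :
    ((FusedSpan.mk ⟨A⟩ (mkHom l) (mkHom u)).comp (FusedSpan.mk ⟨B⟩ (mkHom v) (mkHom r))).IsIsom
      ⟨⟨FinGSet.pullback u v⟩, mkHom (FinGSet.fst u v ≫ l), mkHom (FinGSet.snd u v ≫ r)⟩ :=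
  comp_ofSpan (S := ⟨A, l, u⟩) (T := ⟨B, v, r⟩)
    (R := ⟨FinGSet.pullback u v, FinGSet.fst u v ≫ l, FinGSet.snd u v ≫ r⟩)
    ⟨FinGSet.fst u v, FinGSet.snd u v,
      FinGSet.isMackey_pullback u v, isIsomorphic_refl _, isIsomorphic_refl _⟩

lemma comp_congr {S S' : FusedSpan X Y} {T T' : FusedSpan Y Z} (hS : S.IsIsom S')
    (hT : T.IsIsom T') : (S.comp T).IsIsom (S'.comp T') := by
  obtain ⟨R, h, e⟩ := isComp S T
  obtain ⟨R', h', e'⟩ := isComp S' T'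
  rw [← e, ← e', isIsom_ofSpan]
  exact h.equiv h' (isIsom_iff.1 hS) (isIsom_iff.1 hT)

lemma add_congr {S S' T T' : FusedSpan X Y} (hS : S.IsIsom S')
    (hT : T.IsIsom T') : (S.add T).IsIsom (S'.add T') := by
  obtain ⟨R, h, e⟩ := isSum S T
  obtain ⟨R', h', e'⟩ := isSum S' T'
  rw [← e, ← e', isIsom_ofSpan]
  exact h.equiv h' (isIsom_iff.1 hS) (isIsom_iff.1 hT)

end FusedSpan

/-- The objects of the category of spans of fused `G`-sets. -/
structure FusedSpanCat (G : Type u) [Group G] where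
  /-- The underlying object. -/
  as : FusedGSet G

namespace FusedSpanCat

/-- Isomorphism classes of spans of fused `G`-sets. -/
abbrev SpanClass (X Y : FusedGSet G) := Quotient (FusedSpan.setoid X Y)

/-- The class represented by a span of `G`-sets. -/
def ofHom {X Y : FinGSet .fused G} (f : SpanCat.mk X ⟶ SpanCat.mk Y) : SpanClass ⟨X⟩ ⟨Y⟩ :=
  Quotient.map FusedSpan.ofSpan (fun _ _ h => FusedSpan.isIsom_ofSpan.2 h) f

lemma ofHom_surjective {X Y : FusedGSet G} (f : SpanClass X Y) :
    ∃ g : SpanCat.mk X.as ⟶ SpanCat.mk Y.as, ofHom g = f := by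
  induction f using Quotient.inductionOn with
  | h S => exact ⟨S.toSpan.toHom, congrArg (Quotient.mk _) S.ofSpan_toSpan⟩

/-- Composition of classes of spans. -/
noncomputable def comp {X Y Z : FusedGSet G} (f : SpanClass X Y) (g : SpanClass Y Z) :
    SpanClass X Z :=
  Quotient.map₂ FusedSpan.comp (fun _ _ h _ _ h' => FusedSpan.comp_congr h h') f g

/-- Addition of classes of spans. -/
noncomputable def add {X Y : FusedGSet G} (f g : SpanClass X Y) : SpanClass X Y :=
  Quotient.map₂ FusedSpan.add (fun _ _ h _ _ h' => FusedSpan.add_congr h h') f g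

lemma ofHom_comp {X Y Z : FinGSet .fused G} (f : SpanCat.mk X ⟶ SpanCat.mk Y)
    (g : SpanCat.mk Y ⟶ SpanCat.mk Z) : ofHom (f ≫ g) = comp (ofHom f) (ofHom g) := by
  induction f using Quotient.inductionOn
  induction g using Quotient.inductionOn
  exact (Quotient.sound (FusedSpan.comp_ofSpan (Span.isComp _ _))).symm

lemma ofHom_add {X Y : FinGSet .fused G} (f g : SpanCat.mk X ⟶ SpanCat.mk Y) :
    ofHom (f + g) = add (ofHom f) (ofHom g) := by
  induction f using Quotient.inductionOn
  induction g using Quotient.inductionOn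
  exact (Quotient.sound (FusedSpan.add_ofSpan (Span.isSum _ _))).symm

lemma ofHom_zero (X Y : FinGSet .fused G) :
    ofHom (0 : SpanCat.mk X ⟶ SpanCat.mk Y) = Quotient.mk _ (FusedSpan.zero ⟨X⟩ ⟨Y⟩) :=
  Quotient.sound ((FusedSpan.isIsom_ofSpan (S' := ⟨FinGSet.empty .fused G,
    FinGSet.ofMap (X := FinGSet.empty .fused G) PEmpty.elim fun _ x => x.elim,
    FinGSet.ofMap (X := FinGSet.empty .fused G) PEmpty.elim fun _ x => x.elim⟩)).2
      (Span.equiv_of_initial (Span.isInitial_zero _ _)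
        (FinGSet.isInitialObject ⟨fun x => x.elim⟩)))

/-- The category of spans of fused `G`-sets: morphisms are isomorphism classes of spans in the
category of fused `G`-sets, and composition is induced by pullback of `G`-sets. -/
noncomputable instance : Category (FusedSpanCat G) where
  Hom X Y := SpanClass X.as Y.as
  id X := Quotient.mk _ ⟨X.as, 𝟙 X.as, 𝟙 X.as⟩
  comp f g := comp f g
  id_comp f := by
    obtain ⟨f, rfl⟩ := ofHom_surjective f
    exact (ofHom_comp (𝟙 _) f).symm.trans (congrArg ofHom (Category.id_comp f))
  comp_id f := by
    obtain ⟨f, rfl⟩ := ofHom_surjective f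
    exact (ofHom_comp f (𝟙 _)).symm.trans (congrArg ofHom (Category.comp_id f))
  assoc f g h := by
    obtain ⟨f, rfl⟩ := ofHom_surjective f
    obtain ⟨g, rfl⟩ := ofHom_surjective g
    obtain ⟨h, rfl⟩ := ofHom_surjective h
    rw [← ofHom_comp, ← ofHom_comp, ← ofHom_comp, ← ofHom_comp, Category.assoc]

noncomputable instance (X Y : FusedSpanCat G) : Zero (X ⟶ Y) :=
  ⟨Quotient.mk _ (FusedSpan.zero X.as Y.as)⟩

noncomputable instance (X Y : FusedSpanCat G) : Add (X ⟶ Y) := ⟨fun f g => add f g⟩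

/-- The sum of spans is given by disjoint unions. -/
noncomputable instance : MonoidEnriched (FusedSpanCat G) where
  addCommMonoid X Y :=
    { nsmul := nsmulRec
      add_assoc := fun f g h => by
        obtain ⟨f, rfl⟩ := ofHom_surjective f
        obtain ⟨g, rfl⟩ := ofHom_surjective g
        obtain ⟨h, rfl⟩ := ofHom_surjective h
        change add (add _ _) _ = add _ (add _ _)
        rw [← ofHom_add, ← ofHom_add, ← ofHom_add, ← ofHom_add, add_assoc]
      add_comm := fun f g => by
        obtain ⟨f, rfl⟩ := ofHom_surjective f
        obtain ⟨g, rfl⟩ := ofHom_surjective g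
        change add _ _ = add _ _
        rw [← ofHom_add, ← ofHom_add, add_comm]
      zero_add := fun f => by
        obtain ⟨f, rfl⟩ := ofHom_surjective f
        change add (Quotient.mk _ (FusedSpan.zero X.as Y.as)) _ = _
        rw [← ofHom_zero, ← ofHom_add, zero_add]
      add_zero := fun f => by
        obtain ⟨f, rfl⟩ := ofHom_surjective f
        change add _ (Quotient.mk _ (FusedSpan.zero X.as Y.as)) = _
        rw [← ofHom_zero, ← ofHom_add, add_zero] }
  add_comp f g h := by
    obtain ⟨f, rfl⟩ := ofHom_surjective f
    obtain ⟨g, rfl⟩ := ofHom_surjective g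
    obtain ⟨h, rfl⟩ := ofHom_surjective h
    change comp (add _ _) _ = add (comp _ _) (comp _ _)
    rw [← ofHom_add, ← ofHom_comp, ← ofHom_comp, ← ofHom_comp, ← ofHom_add,
      MonoidEnriched.add_comp]
  comp_add f g h := by
    obtain ⟨f, rfl⟩ := ofHom_surjective f
    obtain ⟨g, rfl⟩ := ofHom_surjective g
    obtain ⟨h, rfl⟩ := ofHom_surjective h
    change comp _ (add _ _) = add (comp _ _) (comp _ _)
    rw [← ofHom_add, ← ofHom_comp, ← ofHom_comp, ← ofHom_comp, ← ofHom_add,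
      MonoidEnriched.comp_add]
  zero_comp {X Y Z} h := by
    obtain ⟨h, rfl⟩ := ofHom_surjective h
    change comp (Quotient.mk _ (FusedSpan.zero X.as Y.as)) _ =
      Quotient.mk _ (FusedSpan.zero X.as Z.as)
    rw [← ofHom_zero, ← ofHom_comp, MonoidEnriched.zero_comp, ofHom_zero]
  comp_zero {X Y Z} f := by
    obtain ⟨f, rfl⟩ := ofHom_surjective f
    change comp _ (Quotient.mk _ (FusedSpan.zero Y.as Z.as)) =
      Quotient.mk _ (FusedSpan.zero X.as Z.as)
    rw [← ofHom_zero, ← ofHom_comp, MonoidEnriched.comp_zero, ofHom_zero]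

/-- The quotient functor from spans of `G`-sets to spans of fused `G`-sets. -/
noncomputable def quotientFunctor (G : Type u) [Group G] : SpanCat (FinGSet .plain G) ⥤ FusedSpanCat G where
  obj X := ⟨⟨FinGSet.inclObj .fused X.as⟩⟩
  map {X Y} f := ofHom (X := FinGSet.inclObj .fused X.as) (Y := FinGSet.inclObj .fused Y.as)
    ((SpanCat.map (FinGSet.incl (κ := .plain) (κ' := .fused) fun _ => rfl)).map f)
  map_id X := by rw [CategoryTheory.Functor.map_id]; rfl
  map_comp f g := by rw [CategoryTheory.Functor.map_comp]; exact ofHom_comp _ _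

instance : MonoidEnriched.IsAdditive (quotientFunctor G) where
  map_add f g := (congrArg ofHom (MonoidEnriched.IsAdditive.map_add
    (F := SpanCat.map (FinGSet.incl (κ := .plain) (κ' := .fused) (G := G) fun _ => rfl))
    f g)).trans (ofHom_add _ _)
  map_zero X Y := (congrArg ofHom (MonoidEnriched.IsAdditive.map_zero
    (F := SpanCat.map (FinGSet.incl (κ := .plain) (κ' := .fused) (G := G) fun _ => rfl))
    X Y)).trans (ofHom_zero _ _)

end FusedSpanCat
end Bouc

section MackeyForG

variable (k : Type w') [CommRing k] (G : Type u) [Group G]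

/-- The Mackey functors for `G`: the `k`-linear functors on spans of finite `G`-sets. -/
abbrev MackeyGrp := Mackey.{u, u, u+1, w', m} k (FinGSet .plain G)

/-- Fused Mackey functors in the sense of Bouc: the Mackey functors for `G` which come, up to
isomorphism, from a `k`-linear functor on the linearized category of spans of fused `G`-sets. -/
def isBoucFused : ObjectProperty (MackeyGrp.{m} k G) := fun M =>
  ∃ N : Linearization k (FusedSpanCat G) ⥤ ModuleCat.{m} k, N.Additive ∧ N.Linear k ∧
    Nonempty (M.obj ≅ Linearization.map k (FusedSpanCat.quotientFunctor G) ⋙ N)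

variable {G} [Finite G]

/-- The `G`-set `G/H`. -/
def cosets (H : Subgroup G) : FinGSet .plain G where
  carrier := G ⧸ H

/-- For `a` in the centralizer of `H`, the `G`-map `G/H ⟶ G/H` sending `gH` to `gaH`. -/
def conj (H : Subgroup G) (a : Subgroup.centralizer (H : Set G)) : cosets H ⟶ cosets H :=
  FinGSet.ofMap (X := cosets H) (Y := cosets H)
    (fun x : G ⧸ H => Quotient.map' (fun g : G => g * a) (fun g g' h => by
      rw [QuotientGroup.leftRel_apply] at h ⊢
      have h' := Subgroup.mem_centralizer_iff.1 a.2 _ h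
      have : (g * a)⁻¹ * (g' * a) = g⁻¹ * g' := by
        rw [mul_inv_rev, mul_assoc, ← mul_assoc g⁻¹, h', inv_mul_cancel_left]
      rwa [this]) x) (fun b x => by
      induction x using Quotient.inductionOn'
      exact congrArg (Quotient.mk'' (s₁ := QuotientGroup.leftRel H)) (mul_assoc _ _ _))

/-- The endomorphism of `G/H` in the linearized category of spans given by conjugation with `a`. -/
noncomputable def conjSpan (H : Subgroup G) (a : Subgroup.centralizer (H : Set G)) :
    (⟨⟨cosets H⟩⟩ : SpanLin k (FinGSet .plain G)) ⟶ ⟨⟨cosets H⟩⟩ :=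
  linOf k (Span.toHom ⟨cosets H, 𝟙 _, conj H a⟩)

variable (G) in
/-- Conjugation invariant Mackey functors: for every subgroup `H`, the centralizer of `H` acts
trivially on the value at `G/H`. -/
def isConjugationInvariant : ObjectProperty (MackeyGrp.{m} k G) := fun M =>
  ∀ (H : Subgroup G) (a : Subgroup.centralizer (H : Set G)), M.obj.map (conjSpan k H a) = 𝟙 _

/-- The functor from Mackey functors for groupoids over `G` with arbitrary 2-cells to Mackey
functors for `G` given by restriction along the transport groupoid construction. -/
noncomputable def toMackeyGrp (k : Type w') [CommRing k] (G : Type u) [Group G] [Finite G] :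
    Mackey.{u, u, u+1, w', m} k (FinGpd .fused G) ⥤ MackeyGrp.{m} k G :=
  Mackey.restrict k (transport (κ := .plain) (κ' := .fused) fun _ => rfl)

end MackeyForG

end

end FusedMackey

open FusedMackey

/-! All four categories consist of linear functors on linearized span categories, so the statements
come down to properties of the functors between span categories.

Horizontal functors. A class of spans sees 1-cells only up to invertible 2-cells. A span-preserving
pseudofunctor therefore induces an equivalence of span categories as soon as it reaches every object
up to equivalence, lifts 1-cells up to isomorphism and reflects isomorphism of 1-cells
(`Span.map_isEquivalence`). The transport groupoid has these properties for both kinds of 2-cells: a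
groupoid over `G` is equivalent to the transport groupoid of the `G`-set of classes `[x, a]`, and
natural transformations between transport functors are twisting maps. Precomposition with the linear
extension is then an equivalence (`restrict_isEquivalence`).

Image of `Φ`. Passing from `G`-sets to fused `G`-sets changes neither objects nor 1-cells, so on
spans it is full and essentially surjective. Restriction along it is fully faithful, and a Mackey
functor `M` lies in the essential image exactly when it agrees on spans that become equal
(`Linearization.exists_factorization`). Two spans become equal exactly when some `G`-bijection of
their middle objects matches the legs up to twisting maps. A twist of the right leg is treated orbit
by orbit: on the orbit of `x` it is conjugation by `τ(x)`, which centralizes the stabilizer of `x`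
(`map_eq_of_isTwist_right`). A twist of the left leg is moved to the right leg by the automorphism
`x ↦ τ(x) • x` (`map_eq_of_isTwist_left`). So conjugation invariance suffices. It is also necessary,
because conjugation by an element of the centralizer is a twist of the identity. Bouc's quotient
functor identifies the same spans, so a single criterion, `isConjugationInvariant_iff`, describes
both his subcategory and the image.

Abelian structure. Additivity, linearity and conjugation invariance are equations between natural
transformations of exact evaluation functors. Such conditions pass to finite limits and colimits, so
they cut out abelian subcategories with exact inclusion. -/

namespace FusedMackey

/-! ### Full subcategories cut out by equations between natural transformations -/

section EquationalProperties

open Limits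

variable {C D J : Type*} [Category* C] [Category* D] [Category* J]

/-- A map into `E'` of a limit is determined by its composites with the projections, and naturality
turns these into components at the vertices of the diagram. Only the target functor has to preserve
the limit. -/
lemma isClosedUnderLimitsOfShape_of_app_eq {E E' : C ⥤ D} (φ ψ : E ⟶ E')
    [PreservesLimitsOfShape J E'] :
    ObjectProperty.IsClosedUnderLimitsOfShape (fun X : C => φ.app X = ψ.app X) J where
  limitsOfShape_le := by
    rintro X ⟨h⟩
    refine (isLimitOfPreserves E' h.isLimit).hom_ext fun j => ?_
    have h₁ := φ.naturality (h.π.app j)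
    have h₂ := ψ.naturality (h.π.app j)
    rw [h.prop_diag_obj j] at h₁
    exact h₁.symm.trans h₂

/-- Dually, the components are compared after the coprojections, so it is the source functor that
has to preserve the colimit. -/
lemma isClosedUnderColimitsOfShape_of_app_eq {E E' : C ⥤ D} (φ ψ : E ⟶ E')
    [PreservesColimitsOfShape J E] :
    ObjectProperty.IsClosedUnderColimitsOfShape (fun X : C => φ.app X = ψ.app X) J where
  colimitsOfShape_le := by
    rintro X ⟨h⟩
    refine (isColimitOfPreserves E h.isColimit).hom_ext fun j => ?_
    have h₁ := φ.naturality (h.ι.app j)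
    have h₂ := ψ.naturality (h.ι.app j)
    rw [h.prop_diag_obj j] at h₁
    exact h₁.trans h₂.symm

lemma isClosedUnderLimitsOfShape_forall {ι : Sort*} (P : ι → ObjectProperty C)
    [∀ i, (P i).IsClosedUnderLimitsOfShape J] :
    ObjectProperty.IsClosedUnderLimitsOfShape (fun X : C => ∀ i, P i X) J where
  limitsOfShape_le := by
    rintro X ⟨h⟩ i
    exact (P i).prop_of_isLimit h.isLimit fun j => h.prop_diag_obj j i

lemma isClosedUnderColimitsOfShape_forall {ι : Sort*} (P : ι → ObjectProperty C)
    [∀ i, (P i).IsClosedUnderColimitsOfShape J] :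
    ObjectProperty.IsClosedUnderColimitsOfShape (fun X : C => ∀ i, P i X) J where
  colimitsOfShape_le := by
    rintro X ⟨h⟩ i
    exact (P i).prop_of_isColimit h.isColimit fun j => h.prop_diag_obj j i

/-- The property `P` is closed under finite limits and finite colimits. -/
structure IsClosedUnderFinite (P : ObjectProperty C) : Prop where
  limits : ∀ (J : Type) [SmallCategory J] [FinCategory J], P.IsClosedUnderLimitsOfShape J
  colimits : ∀ (J : Type) [SmallCategory J] [FinCategory J], P.IsClosedUnderColimitsOfShape J

namespace IsClosedUnderFinite

variable {P : ObjectProperty C}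

lemma of_app_eq {E E' : C ⥤ D} (φ ψ : E ⟶ E') [PreservesFiniteLimits E']
    [PreservesFiniteColimits E] : IsClosedUnderFinite (fun X : C => φ.app X = ψ.app X) :=
  ⟨fun _ => isClosedUnderLimitsOfShape_of_app_eq φ ψ,
    fun _ => isClosedUnderColimitsOfShape_of_app_eq φ ψ⟩

lemma all {ι : Sort*} {P : ι → ObjectProperty C} (h : ∀ i, IsClosedUnderFinite (P i)) :
    IsClosedUnderFinite (fun X : C => ∀ i, P i X) :=
  ⟨fun J => have := fun i => (h i).limits J; isClosedUnderLimitsOfShape_forall P,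
    fun J => have := fun i => (h i).colimits J; isClosedUnderColimitsOfShape_forall P⟩

lemma inf {P Q : ObjectProperty C} (h : IsClosedUnderFinite P) (h' : IsClosedUnderFinite Q) :
    IsClosedUnderFinite (fun X => P X ∧ Q X) := by
  -- A conjunction is an intersection indexed by `Bool`; the `false` case comes first, hence the
  -- later swap by `and_comm`.
  have := all (P := fun b : Bool => cond b P Q) (Bool.rec h' h)
  simp only [Bool.forall_bool, cond_true, cond_false] at this
  simpa only [and_comm] using this

lemma preservesFiniteLimits [HasFiniteLimits C] (h : IsClosedUnderFinite P) :
    PreservesFiniteLimits P.ι :=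
  ⟨fun J => have := h.limits J; inferInstance⟩

lemma preservesFiniteColimits [HasFiniteColimits C] (h : IsClosedUnderFinite P) :
    PreservesFiniteColimits P.ι :=
  ⟨fun J => have := h.colimits J; inferInstance⟩

/-- A full subcategory of an abelian category which is closed under finite limits and finite
colimits is abelian. -/
@[reducible] noncomputable def abelian [Abelian C] (h : IsClosedUnderFinite P) :
    Abelian P.FullSubcategory :=
  have : P.IsClosedUnderKernels := ⟨by
    rintro _ ⟨f, k, hk, hf⟩
    -- A kernel of `f` is a limit of the parallel pair `f, 0`, whose vertices are the source and the
    -- target of `f`.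
    have := h.limits WalkingParallelPair
    refine P.prop_of_isLimit hk ?_
    rintro (_ | _)
    · exact hf.1
    · exact hf.2⟩
  have : P.IsClosedUnderCokernels := ⟨by
    rintro _ ⟨f, k, hk, hf⟩
    have := h.colimits WalkingParallelPair
    refine P.prop_of_isColimit hk ?_
    rintro (_ | _)
    · exact hf.1
    · exact hf.2⟩
  have : P.IsClosedUnderFiniteProducts := ⟨fun J _ => by
    -- Closure is available for shapes in `Type` only, so the finite index type is replaced by a
    -- copy of `Fin n`.
    have := h.limits (Discrete (ULift (Fin (Nat.card J))))
    exact ObjectProperty.IsClosedUnderLimitsOfShape.of_equivalence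
      (Discrete.equivalence (Equiv.ulift.trans (Finite.equivFin J).symm))⟩
  -- The zero object is terminal, that is, a limit of the empty diagram.
  have : P.ContainsZero := ⟨_, isZero_zero C,
    have := h.limits (Discrete PEmpty)
    P.prop_of_isTerminal _ (isZero_zero C).isTerminal⟩
  inferInstance

end IsClosedUnderFinite

end EquationalProperties

/-! ### Precomposition with a full and essentially surjective functor -/

section Whiskering

variable {C D E : Type*} [Category* C] [Category* D] [Category* E] (L : C ⥤ D)

/-- By naturality, a transformation is determined by its components on one object of each
isomorphism class, and every class meets the image of `L`. -/
lemma faithful_whiskeringLeft [L.EssSurj] : ((Functor.whiskeringLeft C D E).obj L).Faithful where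
  map_injective {F H} σ τ h := by
    ext Y
    rw [← cancel_epi (F.map (L.objObjPreimageIso Y).hom), σ.naturality, τ.naturality]
    exact congrArg (· ≫ _) (NatTrans.congr_app h (L.objPreimage Y))

/-- A transformation given on the image of `L` is extended by conjugating with the chosen
isomorphisms `L X ≅ Y`. Fullness of `L` is what makes the extension natural for every morphism of
`D`. -/
lemma full_whiskeringLeft [L.EssSurj] [L.Full] :
    ((Functor.whiskeringLeft C D E).obj L).Full where
  map_surjective {F H} σ := by
    -- `s` is `σ` with its components typed without the composite functors, which keeps the later
    -- rewriting syntactic.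
    obtain ⟨s, hs⟩ : ∃ s : ∀ X, F.obj (L.obj X) ⟶ H.obj (L.obj X), ∀ X, s X = σ.app X :=
      ⟨_, fun _ => rfl⟩
    have key : ∀ {X X' : C} (f : L.obj X ⟶ L.obj X'), F.map f ≫ s X' = s X ≫ H.map f := fun f => by
      obtain ⟨f, rfl⟩ := L.map_surjective f
      rw [hs, hs]
      exact σ.naturality f
    refine ⟨{ app Y := F.map (L.objObjPreimageIso Y).inv ≫ s (L.objPreimage Y) ≫
                H.map (L.objObjPreimageIso Y).hom
              naturality Y Y' f := ?_ }, ?_⟩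
    · rw [← cancel_epi (F.map (L.objObjPreimageIso Y).hom),
        ← cancel_mono (H.map (L.objObjPreimageIso Y').inv)]
      -- Conjugating `f` by the chosen isomorphisms gives a morphism between objects in the image of
      -- `L`, where `key` applies.
      have := key ((L.objObjPreimageIso Y).hom ≫ f ≫ (L.objObjPreimageIso Y').inv)
      simpa only [Functor.map_comp, Category.assoc, Iso.map_hom_inv_id, Iso.map_hom_inv_id_assoc,
        Category.comp_id] using this
    · ext X
      rw [← hs]
      change F.map _ ≫ s _ ≫ H.map _ = s X
      rw [← key, ← Functor.map_comp_assoc, Iso.inv_hom_id, CategoryTheory.Functor.map_id,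
        Category.id_comp]

end Whiskering

/-! ### Mackey functors form an abelian category -/

section Abelian

open Limits

variable (k : Type w') [CommRing k]

section

variable (C : Type*) [Category* C] [Preadditive C] [Linear k C]

/-- A morphism `f` is a natural transformation between evaluation functors, and these are exact
since limits and colimits of functors are pointwise. Each instance of additivity or of linearity is
an equation between two such transformations. -/
lemma isClosedUnderFinite_additive_linear :
    IsClosedUnderFinite (fun M : C ⥤ ModuleCat.{m} k => M.Additive ∧ M.Linear k) := by
  have h₁ : ∀ (X Y : C) (f g : X ⟶ Y), IsClosedUnderFinite
      (fun M : C ⥤ ModuleCat.{m} k => M.map (f + g) = M.map f + M.map g) := fun X Y f g =>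
    .of_app_eq ((evaluation C (ModuleCat.{m} k)).map (f + g))
      ((evaluation C (ModuleCat.{m} k)).map f + (evaluation C (ModuleCat.{m} k)).map g)
  have h₂ : ∀ (X Y : C) (f : X ⟶ Y) (r : k), IsClosedUnderFinite
      (fun M : C ⥤ ModuleCat.{m} k => M.map (r • f) = r • M.map f) := fun X Y f r =>
    .of_app_eq ((evaluation C (ModuleCat.{m} k)).map (r • f))
      (r • (evaluation C (ModuleCat.{m} k)).map f)
  convert (IsClosedUnderFinite.all fun X => .all fun Y => .all fun f => .all fun g =>
    h₁ X Y f g).inf (IsClosedUnderFinite.all fun X => .all fun Y => .all fun f =>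
      .all fun r => h₂ X Y f r) using 3 with M
  · exact ⟨fun h _ _ _ _ => h.map_add, fun h => ⟨fun {X Y f g} => h X Y f g⟩⟩
  · exact ⟨fun h _ _ _ _ => h.map_smul _ _, fun h => ⟨fun {X Y} f r => h X Y f r⟩⟩

end

variable (B : Type u) [Bicategory.{w, v} B] [Spannable B]

lemma isClosedUnderFinite_isMackeyFunctor : IsClosedUnderFinite (isMackeyFunctor.{m} k B) :=
  isClosedUnderFinite_additive_linear k (SpanLin k B)

noncomputable instance : Abelian (Mackey.{w, v, u, w', m} k B) :=
  (isClosedUnderFinite_isMackeyFunctor k B).abelian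

end Abelian

/-! ### Functoriality and universal property of the linearization -/

section Linearization

open scoped TensorProduct
open Algebra

variable {k : Type*} [CommRing k] {C D E : Type*} [Category* C] [MonoidEnriched C]
  [Category* D] [MonoidEnriched D] [Category* E] [MonoidEnriched E]

/-- The projection to the quotient by this span kills every generator, hence vanishes by `lin_ext`.
No separate treatment of differences is needed, as the scalar `-1` produces them. -/
lemma span_linOf (X Y : C) : Submodule.span k (Set.range fun f : X ⟶ Y => linOf k f) = ⊤ := by
  have : (Submodule.span k (Set.range fun f : X ⟶ Y => linOf k f)).mkQ = 0 :=
    lin_ext fun f => (Submodule.Quotient.mk_eq_zero _).2 (Submodule.subset_span ⟨f, rfl⟩)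
  rw [← Submodule.ker_mkQ (Submodule.span _ _), this, LinearMap.ker_zero]

/-- A linear map out of a Hom module of the linearization, given by an additive map. -/
noncomputable def linLift {X Y : C} {N : Type*} [AddCommGroup N] [Module k N]
    (φ : (X ⟶ Y) →+ N) : k ⊗[ℤ] GrothendieckAddGroup (X ⟶ Y) →ₗ[k] N :=
  LinearMap.liftBaseChange k (GrothendieckAddGroup.lift φ).toIntLinearMap

lemma linLift_of {X Y : C} {N : Type*} [AddCommGroup N] [Module k N] (φ : (X ⟶ Y) →+ N)
    (f : X ⟶ Y) : linLift φ (linOf k f) = φ f := by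
  rw [linLift, linOf, LinearMap.liftBaseChange_tmul, one_smul, AddMonoidHom.coe_toIntLinearMap,
    lift_of]

lemma linOf_add {X Y : C} (f g : X ⟶ Y) : linOf k (f + g) = linOf k f + linOf k g := by
  rw [linOf, map_add, TensorProduct.tmul_add]; rfl

lemma linOf_zero (X Y : C) : linOf k (0 : X ⟶ Y) = 0 := by
  rw [linOf, map_zero, TensorProduct.tmul_zero]

variable (k) in
/-- The class of a morphism, as a morphism of the linearization. -/
noncomputable def linHom {X Y : C} (f : X ⟶ Y) :
    (⟨X⟩ : Linearization k C) ⟶ ⟨Y⟩ := linOf k f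

lemma linHom_comp {X Y Z : C} (f : X ⟶ Y) (g : Y ⟶ Z) :
    linHom k (f ≫ g) = linHom k f ≫ linHom k g := (linComp_of f g).symm

lemma linHom_id (X : C) : linHom k (𝟙 X) = 𝟙 _ := rfl

lemma linHom_add {X Y : C} (f g : X ⟶ Y) : linHom k (f + g) = linHom k f + linHom k g :=
  linOf_add f g

lemma linHom_zero (X Y : C) : linHom k (0 : X ⟶ Y) = 0 := linOf_zero X Y

lemma map_linHom (F : C ⥤ D) [MonoidEnriched.IsAdditive F] {X Y : C} (f : X ⟶ Y) :
    (Linearization.map k F).map (linHom k f) = linHom k (F.map f) := linMap_of F f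

/-- Induction on the morphisms of a linearization, as linear combinations of morphisms of `C`. -/
lemma linearization_induction {X Y : Linearization k C} {p : (X ⟶ Y) → Prop}
    (of : ∀ f : X.as ⟶ Y.as, p (linHom k f)) (zero : p 0) (add : ∀ f g, p f → p g → p (f + g))
    (smul : ∀ (r : k) f, p f → p (r • f)) (f : X ⟶ Y) : p f := by
  -- Viewing `f` as an element of its Hom module turns the claim into induction on membership in a
  -- span.
  have h : (f : k ⊗[ℤ] GrothendieckAddGroup (X.as ⟶ Y.as)) ∈
      Submodule.span k (Set.range fun f : X.as ⟶ Y.as => linOf k f) := by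
    rw [span_linOf]; trivial
  induction h using Submodule.span_induction with
  | mem x h => obtain ⟨f, rfl⟩ := h; exact of f
  | zero => exact zero
  | add x y _ _ hx hy => exact add x y hx hy
  | smul r x _ hx => exact smul r x hx

namespace Linearization

variable (F : C ⥤ D) [MonoidEnriched.IsAdditive F]

lemma map_full [F.Full] : (map k F).Full where
  map_surjective {X Y} f := by
    induction f using linearization_induction with
    | of f =>
      obtain ⟨g, rfl⟩ := F.map_surjective f
      exact ⟨linHom k g, map_linHom F g⟩
    | zero => exact ⟨0, (map k F).map_zero _ _⟩
    | add f g hf hg =>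
      obtain ⟨f, rfl⟩ := hf
      obtain ⟨g, rfl⟩ := hg
      exact ⟨f + g, (map k F).map_add⟩
    | smul r f hf =>
      obtain ⟨f, rfl⟩ := hf
      exact ⟨r • f, (map k F).map_smul _ _⟩

/-- Tensoring and group completion need not preserve injectivity of maps of monoids, so fullness is
used as well: `F` is then an additive bijection on Hom monoids, and the linear extension of its
inverse is a left inverse. -/
lemma map_faithful [F.Full] [F.Faithful] : (map k F).Faithful where
  map_injective {X Y} := by
    let e : (X.as ⟶ Y.as) ≃+ (F.obj X.as ⟶ F.obj Y.as) :=
      { (Functor.FullyFaithful.ofFullyFaithful F).homEquiv with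
        map_add' := MonoidEnriched.IsAdditive.map_add }
    refine Function.LeftInverse.injective
      (g := linLift (N := k ⊗[ℤ] GrothendieckAddGroup (X.as ⟶ Y.as))
        { toFun := fun f => linOf k (e.symm f)
          map_zero' := by rw [map_zero, linOf_zero]
          map_add' := fun f g => by rw [map_add, linOf_add] }) fun f => ?_
    refine LinearMap.congr_fun (f := (linLift _).comp (linMap k F X.as Y.as))
      (g := LinearMap.id) (lin_ext fun f => ?_) f
    rw [LinearMap.comp_apply, linMap_of, linLift_of]
    exact congrArg (linOf k) (e.symm_apply_apply f)

/-- An isomorphism, as an isomorphism of the linearization. -/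
noncomputable def isoOf {X Y : C} (e : X ≅ Y) : (⟨X⟩ : Linearization k C) ≅ ⟨Y⟩ where
  hom := linHom k e.hom
  inv := linHom k e.inv
  hom_inv_id := by rw [← linHom_comp, Iso.hom_inv_id, linHom_id]
  inv_hom_id := by rw [← linHom_comp, Iso.inv_hom_id, linHom_id]

lemma map_essSurj [F.EssSurj] : (map k F).EssSurj where
  mem_essImage Y := ⟨⟨F.objPreimage Y.as⟩, ⟨isoOf (F.objObjPreimageIso Y.as)⟩⟩

lemma map_isEquivalence [F.IsEquivalence] : (map k F).IsEquivalence where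
  full := map_full F
  faithful := map_faithful F
  essSurj := map_essSurj F

section

variable {A : Type*} [Category* A] [Preadditive A] [Linear k A] (H : C ⥤ A)
    (zero : ∀ X Y : C, H.map (0 : X ⟶ Y) = 0)
    (add : ∀ {X Y : C} (f g : X ⟶ Y), H.map (f + g) = H.map f + H.map g)

/-- The linear extension of the effect of a functor on morphisms. -/
noncomputable def liftHom (X Y : Linearization k C) : (X ⟶ Y) →ₗ[k] (H.obj X.as ⟶ H.obj Y.as) :=
  linLift (k := k) (X := X.as) (Y := Y.as)
    { toFun := H.map
      map_zero' := zero _ _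
      map_add' := add }

lemma liftHom_linHom {X Y : C} (f : X ⟶ Y) :
    liftHom H zero add ⟨X⟩ ⟨Y⟩ (linHom k f) = H.map f := linLift_of _ f

/-- The linear extension of a functor to a linear category. -/
noncomputable def lift : Linearization k C ⥤ A where
  obj X := H.obj X.as
  map {X Y} f := liftHom H zero add X Y f
  map_id X := (liftHom_linHom H zero add _).trans (H.map_id _)
  map_comp {X Y Z} f g := by
    -- Both sides are bilinear in `f` and `g`, so only composites of morphisms of `C` need to be
    -- compared.
    induction f using linearization_induction with
    | of f =>
      induction g using linearization_induction with
      | of g =>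
        rw [← linHom_comp, liftHom_linHom, liftHom_linHom, liftHom_linHom, H.map_comp]
      | zero => simp
      | add g g' hg hg' =>
        rw [Preadditive.comp_add, map_add, map_add, hg, hg', Preadditive.comp_add]
      | smul r g hg => rw [Linear.comp_smul, map_smul, map_smul, hg, Linear.comp_smul]
    | zero => simp
    | add f f' hf hf' => rw [Preadditive.add_comp, map_add, map_add, hf, hf', Preadditive.add_comp]
    | smul r f hf => rw [Linear.smul_comp, map_smul, map_smul, hf, Linear.smul_comp]

lemma lift_map_linHom {X Y : C} (f : X ⟶ Y) :
    (lift (k := k) H zero add).map (linHom k f) = H.map f := liftHom_linHom H zero add f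

instance : (lift (k := k) H zero add).Additive where
  map_add {X Y _ _} := map_add (liftHom H zero add X Y) _ _

instance : (lift (k := k) H zero add).Linear k where
  map_smul {X Y} _ _ := map_smul (liftHom H zero add X Y) _ _

end

/-- Linear functors on a linearization agree on all morphisms if they do so on those of `C`. -/
lemma map_ext {A : Type*} [Category* A] [Preadditive A] [Linear k A]
    {M N : Linearization k C ⥤ A} [M.Additive] [M.Linear k] [N.Additive] [N.Linear k]
    (φ : ∀ X : C, M.obj ⟨X⟩ ⟶ N.obj ⟨X⟩)
    (h : ∀ {X Y : C} (f : X ⟶ Y), M.map (linHom k f) ≫ φ Y = φ X ≫ N.map (linHom k f))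
    {X Y : Linearization k C} (f : X ⟶ Y) : M.map f ≫ φ Y.as = φ X.as ≫ N.map f := by
  induction f using linearization_induction with
  | of f => exact h f
  | zero => simp
  | add f g hf hg => rw [M.map_add, N.map_add, Preadditive.add_comp, Preadditive.comp_add, hf, hg]
  | smul r f hf => rw [M.map_smul, N.map_smul, Linear.smul_comp, Linear.comp_smul, hf]

/-- This is an equality of functors, not just an isomorphism, because the square of restriction
functors is shown to commute strictly. -/
lemma map_comp_map_eq {F : C ⥤ D} {H : D ⥤ E} {K : C ⥤ E} [MonoidEnriched.IsAdditive F]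
    [MonoidEnriched.IsAdditive H] [MonoidEnriched.IsAdditive K] (h : F ⋙ H = K) :
    map k F ⋙ map k H = map k K := by
  subst h
  have key : ∀ {X Y : Linearization k C} (f : X ⟶ Y),
      (map k H).map ((map k F).map f) = (map k (F ⋙ H)).map f := fun {X Y} f => by
    induction f using linearization_induction with
    | of f =>
      exact (congrArg (map k H).map (map_linHom F f)).trans
        ((map_linHom H (F.map f)).trans (map_linHom (F ⋙ H) f).symm)
    | zero => rw [Functor.map_zero, Functor.map_zero, Functor.map_zero]; rfl
    | add f g hf hg => rw [Functor.map_add, Functor.map_add, Functor.map_add, hf, hg]; rfl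
    | smul r f hf => rw [Functor.map_smul, Functor.map_smul, Functor.map_smul, hf]; rfl
  -- The objects agree definitionally, so the transports in `Functor.ext` are identities.
  exact CategoryTheory.Functor.ext (fun X => rfl) fun X Y f => (key f).trans
    ((Category.id_comp _).trans (Category.comp_id _)).symm

end Linearization

end Linearization

/-! ### Restriction of Mackey functors along a pseudofunctor -/

section Restrict

variable (k : Type w') [CommRing k] {B : Type*} [Bicategory B] [Spannable B] {C : Type*}
  [Bicategory C] [Spannable C] (F : B ⥤ᵖ C) [PreservesSpans F]

instance : (Mackey.restrict.{m} k F).Additive where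
  map_add := rfl

instance : (Mackey.restrict.{m} k F).Linear k where
  map_smul _ _ := rfl

lemma restrict_faithful [(SpanCat.map F).EssSurj] : (Mackey.restrict.{m} k F).Faithful where
  map_injective h := by
    have := Linearization.map_essSurj (k := k) (SpanCat.map F)
    have := faithful_whiskeringLeft (E := ModuleCat.{m} k) (Linearization.map k (SpanCat.map F))
    exact ObjectProperty.hom_ext _ (((Functor.whiskeringLeft _ _ (ModuleCat.{m} k)).obj
      (Linearization.map k (SpanCat.map F))).map_injective (congrArg (·.hom) h))

lemma restrict_full [(SpanCat.map F).EssSurj] [(SpanCat.map F).Full] :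
    (Mackey.restrict.{m} k F).Full where
  map_surjective f := by
    have := Linearization.map_essSurj (k := k) (SpanCat.map F)
    have := Linearization.map_full (k := k) (SpanCat.map F)
    have := full_whiskeringLeft (E := ModuleCat.{m} k) (Linearization.map k (SpanCat.map F))
    obtain ⟨g, hg⟩ := ((Functor.whiskeringLeft _ _ (ModuleCat.{m} k)).obj
      (Linearization.map k (SpanCat.map F))).map_surjective f.hom
    exact ⟨ObjectProperty.homMk g, ObjectProperty.hom_ext _ hg⟩

/-- A Mackey functor on the source is extended to the target by precomposition with a quasi-inverse
of the linearized span functor. The extension is again a Mackey functor because the inverse of a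
linear equivalence is linear. -/
lemma restrict_isEquivalence [(SpanCat.map F).IsEquivalence] :
    (Mackey.restrict.{m} k F).IsEquivalence where
  full := restrict_full k F
  faithful := restrict_faithful k F
  essSurj := ⟨fun M => by
    have := Linearization.map_isEquivalence (k := k) (SpanCat.map F)
    have := M.property.1
    have := M.property.2
    let e := (Linearization.map k (SpanCat.map F)).asEquivalence
    -- Additivity and linearity are recorded for `e.functor` itself, so that instance search can
    -- pass them on to `e.inverse`.
    have : e.functor.Additive := inferInstanceAs (Linearization.map k (SpanCat.map F)).Additive
    have : e.functor.Linear k := inferInstanceAs ((Linearization.map k (SpanCat.map F)).Linear k)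
    exact ⟨⟨e.inverse ⋙ M.obj, inferInstanceAs (e.inverse ⋙ M.obj).Additive,
      inferInstanceAs ((e.inverse ⋙ M.obj).Linear k)⟩,
      ⟨ObjectProperty.isoMk _ (e.funInvIdAssoc M.obj)⟩⟩⟩

end Restrict


/-! ### When a pseudofunctor induces an equivalence of span categories -/

section SpanEquivalence

namespace Span

section

variable {B : Type u} [Bicategory.{w, v} B]

/-- A pullback along an identity is trivial, so composing with the forward span of a 1-cell affects
the right leg only. -/
lemma isComp_right {X Y Z : B} (S : Span X Y) (f : Y ⟶ Z) :
    IsComp S ⟨Y, 𝟙 Y, f⟩ ⟨S.apex, S.left, S.right ≫ f⟩ :=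
  ⟨𝟙 _, S.right, (IsMackey.id_left S.right).symm, ⟨(λ_ _).symm⟩, ⟨Iso.refl _⟩⟩

variable [Spannable B]

lemma toHom_eq_iff {X Y : B} {S T : Span X Y} : S.toHom = T.toHom ↔ S.Equiv T :=
  ⟨fun h => Quotient.exact h, fun h => Quotient.sound h⟩

lemma exists_toHom {X Y : SpanCat B} (f : X ⟶ Y) : ∃ S : Span X.as Y.as, S.toHom = f :=
  Quotient.exists_rep f

lemma toHom_congr {X Y A : B} {l l' : A ⟶ X} {r r' : A ⟶ Y} (h : IsIsomorphic l l')
    (h' : IsIsomorphic r r') : (Span.mk A l r).toHom = (Span.mk A l' r').toHom :=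
  toHom_eq_iff.2 (equiv_iff.2 ⟨Iso.refl _, by simpa using cl_eq_iff.2 h,
    by simpa using cl_eq_iff.2 h'⟩)

lemma toHom_of_equivalence {X Y A A' : B} {s : A ⟶ A'} (hs : IsEquivalenceCell s) (l : A' ⟶ X)
    (r : A' ⟶ Y) : (Span.mk A (s ≫ l) (s ≫ r)).toHom = (Span.mk A' l r).toHom :=
  toHom_eq_iff.2 ⟨s, hs, isIsomorphic_refl _, isIsomorphic_refl _⟩

lemma toHom_comp_right {X Y Z : B} (S : Span X Y) (f : Y ⟶ Z) :
    S.toHom ≫ (Span.mk Y (𝟙 Y) f).toHom = (Span.mk S.apex S.left (S.right ≫ f)).toHom :=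
  (isComp_right S f).toHom

/-- The isomorphism of the category of spans given by an equivalence. -/
noncomputable def isoOfEquivalence {X Y : B} (e : X ≌ Y) : SpanCat.mk X ≅ SpanCat.mk Y where
  hom := (Span.mk X (𝟙 X) e.hom).toHom
  inv := (Span.mk Y (𝟙 Y) e.inv).toHom
  hom_inv_id := (toHom_comp_right _ _).trans (toHom_congr ⟨Iso.refl _⟩ ⟨e.unit.symm⟩)
  inv_hom_id := (toHom_comp_right _ _).trans (toHom_congr ⟨Iso.refl _⟩ ⟨e.counit⟩)

end

section

variable {B : Type*} [Bicategory B] [Spannable B] {C : Type*} [Bicategory C] [Spannable C]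

/-- Nothing about individual 2-cells is required beyond existence: equivalence of spans asks for a
1-cell with a pseudo-inverse and for isomorphisms between composites of 1-cells. The last two
hypotheses lift the former and reflect the latter. -/
lemma map_isEquivalence (F : B ⥤ᵖ C) [PreservesSpans F]
    (hobj : ∀ Y : C, ∃ (X : B) (e : F.obj X ⟶ Y), IsEquivalenceCell e)
    (hmap : ∀ {X Y : B} (f : F.obj X ⟶ F.obj Y), ∃ g : X ⟶ Y, IsIsomorphic (F.map g) f)
    (hcell : ∀ {X Y : B} {f g : X ⟶ Y}, IsIsomorphic (F.map f) (F.map g) → IsIsomorphic f g) :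
    (SpanCat.map F).IsEquivalence where
  full := ⟨fun {X Y} f => by
    obtain ⟨T, rfl⟩ := exists_toHom f
    -- The middle object is replaced by an equivalent one in the image of `F`; both legs then lift.
    obtain ⟨A, e, he⟩ := hobj T.apex
    obtain ⟨l, hl⟩ := hmap (e ≫ T.left)
    obtain ⟨r, hr⟩ := hmap (e ≫ T.right)
    exact ⟨(Span.mk A l r).toHom, Quotient.sound ⟨e, he, hl, hr⟩⟩⟩
  faithful := ⟨fun {X Y} f g h => by
    obtain ⟨S, rfl⟩ := exists_toHom f
    obtain ⟨S', rfl⟩ := exists_toHom g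
    obtain ⟨s, ⟨t, h₁, h₂⟩, hl, hr⟩ : ∃ s : F.obj S.apex ⟶ F.obj S'.apex, IsEquivalenceCell s ∧
      IsIsomorphic (F.map S.left) (s ≫ F.map S'.left) ∧
      IsIsomorphic (F.map S.right) (s ≫ F.map S'.right) := Quotient.exact h
    -- The equivalence of middle objects and its pseudo-inverse are lifted separately; `hcell`
    -- returns the relations between them to `B`.
    obtain ⟨s, hs⟩ := hmap s
    obtain ⟨t, ht⟩ := hmap t
    have comp : ∀ {X Y Z : B} (f : X ⟶ Y) (g : Y ⟶ Z),
      cl (F.map (f ≫ g)) = cl (F.map f) ≫ cl (F.map g) := fun f g => cl_eq_iff.2 ⟨F.mapComp f g⟩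
    have id : ∀ X : B, cl (F.map (𝟙 X)) = 𝟙 _ := fun X => cl_eq_iff.2 ⟨F.mapId X⟩
    rw [← cl_eq_iff] at hs ht h₁ h₂ hl hr
    rw [cl_comp, ← hs] at hl hr h₁ h₂
    rw [← ht] at h₁ h₂
    exact toHom_eq_iff.2 ⟨s, ⟨t, hcell (cl_eq_iff.1 ((comp _ _).trans (h₁.trans (id _).symm))),
      hcell (cl_eq_iff.1 ((comp _ _).trans (h₂.trans (id _).symm)))⟩,
      hcell (cl_eq_iff.1 (hl.trans (comp _ _).symm)),
      hcell (cl_eq_iff.1 (hr.trans (comp _ _).symm))⟩⟩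
  essSurj := ⟨fun Y => by
    obtain ⟨X, e, he⟩ := hobj Y.as
    obtain ⟨e, -⟩ := he.exists_equivalence
    exact ⟨⟨X⟩, ⟨isoOfEquivalence e⟩⟩⟩

end

end Span

end SpanEquivalence

/-! ### Groupoids over `G` and transport groupoids -/

section TransportEquivalence

variable {κ : Kind} {G : Type u} [Group G]

namespace FinGpd

/-- A 1-cell over `G` carries an element `θ(x)` at each point `x`. Moving the image of `x` by `θ(x)`
makes the assignment equivariant, and `θ` itself is the required isomorphism. It is compatible with
the embeddings, so it is allowed for both kinds of 2-cells. -/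
lemma exists_transport_map {X Y : FinGSet κ G} (F : (transport id).obj X ⟶ (transport id).obj Y) :
    ∃ f : X ⟶ Y, IsIsomorphic ((transport id).map f) F := by
  let θ (x : X.carrier) : G := (ov F).hom.app ⟨x⟩
  let pt (x : X.carrier) : Y.carrier := ((fn F).obj ⟨x⟩).pt
  -- Naturality of the isomorphism over `G`, written as an identity in `G`; composition in
  -- `SingleObj G` is multiplication in the opposite order.
  have hθ : ∀ (a : G) (x y : X.carrier) (h : a • x = y),
      θ y * (((fn F).map (⟨a, h⟩ : Transport.mk x ⟶ Transport.mk y)).1 : G) = a * θ x :=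
    fun a x y h => over_naturality F (⟨a, h⟩ : Transport.mk x ⟶ Transport.mk y)
  let f : X ⟶ Y := FinGSet.ofMap (fun x => θ x • pt x) fun a x => by
    have h₁ : (((fn F).map (⟨a, rfl⟩ : Transport.mk x ⟶ Transport.mk (a • x))).1 : G) • pt x =
      pt (a • x) := ((fn F).map (⟨a, rfl⟩ : Transport.mk x ⟶ Transport.mk (a • x))).2
    rw [← h₁, smul_smul, smul_smul, hθ]
  -- The component at `x` is `θ(x)`, which carries the image of `x` to `f(x)` by the construction of
  -- `f`; its naturality is again `hθ`.
  let n : fn F ⟶ fn ((transport id).map f) :=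
    { app := fun x => ⟨θ x.pt, rfl⟩
      naturality := fun x y a => Transport.hom_ext (hθ a.1 x.pt y.pt a.2) }
  have : IsIso n := NatIso.isIso_of_isIso_app n
  exact ⟨f, ⟨(isoCell (f := F) (g := (transport id).map f) (asIso n)
    fun _ x => Category.comp_id _).symm⟩⟩

/-- The components of a natural transformation are elements of `G`, and naturality along `a : x ⟶ a
• x` is the equivariance of a twisting map. -/
lemma isIsomorphic_of_transport {X Y : FinGSet κ G} {f g : X ⟶ Y}
    (h : IsIsomorphic ((transport (κ' := κ) id).map f) ((transport id).map g)) :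
    IsIsomorphic f g := by
  obtain ⟨s⟩ := h
  refine FinGSet.isIsomorphic (FinGSet.cell (fun x => ((nt s.hom).app ⟨x⟩).1)
    (fun a x => ?_) (fun x => ((nt s.hom).app ⟨x⟩).2) fun hk x => ?_)
  · have h : ((nt s.hom).app ⟨a • x⟩).1 * a = a * ((nt s.hom).app ⟨x⟩).1 :=
      congrArg Subtype.val ((nt s.hom).naturality (⟨a, rfl⟩ : Transport.mk x ⟶ ⟨a • x⟩))
    rw [← h, mul_inv_cancel_right]
  -- For plain 2-cells, compatibility with the identity isomorphisms over `G` forces each component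
  -- to be `1`.
  · exact (Category.comp_id (X := SingleObj.star G) _).symm.trans (nt_plain s.hom hk ⟨x⟩)

/-- The element of `G` underlying a morphism. -/
def val {K : FinGpd κ G} {x y : K.carrier} (f : x ⟶ y) : G := K.emb.map f

lemma val_id {K : FinGpd κ G} (x : K.carrier) : val (𝟙 x) = 1 := K.emb.map_id x

lemma val_comp {K : FinGpd κ G} {x y z : K.carrier} (f : x ⟶ y) (g : y ⟶ z) :
    val (f ≫ g) = val g * val f := K.emb.map_comp f g

/-- The relation defining the `G`-set of a groupoid over `G`. -/
def pointSetoid (K : FinGpd κ G) : Setoid (K.carrier × G) where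
  r a b := ∃ f : a.1 ⟶ b.1, a.2 = b.2 * val f
  iseqv :=
    { refl := fun a => ⟨𝟙 _, by rw [val_id, mul_one]⟩
      symm := by
        rintro a b ⟨f, h⟩
        have := IsGroupoid.all_isIso f
        exact ⟨inv f, by rw [h, mul_assoc, ← val_comp, IsIso.inv_hom_id, val_id, mul_one]⟩
      trans := by
        rintro a b c ⟨f, h⟩ ⟨g, h'⟩
        exact ⟨f ≫ g, by rw [h, h', val_comp, mul_assoc]⟩ }

variable [Finite G]

/-- The `G`-set of a groupoid over `G`: the set of components of the comma category of the
embedding under the object of `G`, with `G` acting by postcomposition. -/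
def toGSet (K : FinGpd κ G) : FinGSet κ G where
  carrier := Quotient (pointSetoid K)
  mulAction :=
    { smul := fun a => Quotient.map (fun p => (p.1, a * p.2)) (by
        rintro p q ⟨f, h⟩
        exact ⟨f, by rw [h, mul_assoc]⟩)
      one_smul := fun p => by
        induction p using Quotient.inductionOn with
        | h p => exact congrArg (Quotient.mk _) (Prod.ext rfl (one_mul p.2))
      mul_smul := fun a b p => by
        induction p using Quotient.inductionOn with
        | h p => exact congrArg (Quotient.mk _) (Prod.ext rfl (mul_assoc a b p.2)) }

/-- The point of the associated `G`-set given by an object. -/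
def point (K : FinGpd κ G) (x : K.carrier) (a : G) : (toGSet K).carrier := Quotient.mk _ (x, a)

lemma point_eq_iff {K : FinGpd κ G} {x y : K.carrier} {a b : G} :
    point K x a = point K y b ↔ ∃ f : x ⟶ y, a = b * val f :=
  ⟨fun h => Quotient.exact h, fun h => Quotient.sound h⟩

lemma smul_point {K : FinGpd κ G} (a : G) (x : K.carrier) (b : G) :
    a • point K x b = point K x (a * b) := rfl

/-- The comparison of a groupoid over `G` with the transport groupoid of its `G`-set. -/
def toTransport (K : FinGpd κ G) : K ⟶ Transport.of κ (toGSet K) :=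
  mkHom (X := K) (Y := Transport.of κ (toGSet K))
    { obj := fun x => ⟨point K x 1⟩
      map := fun f => ⟨val f, by
        rw [smul_point, mul_one, point_eq_iff]; exact ⟨f, (one_mul _).symm⟩⟩
      map_id := fun x => Transport.hom_ext (val_id x)
      map_comp := fun f g => Transport.hom_ext (val_comp f g) }
    (NatIso.ofComponents (fun x => Iso.refl (SingleObj.star G)) fun f =>
      (Category.comp_id _).trans (Category.id_comp _).symm)

instance (K : FinGpd κ G) : (fn (toTransport K)).IsEquivalence where
  faithful := faithful_fn _
  -- A morphism `[x, 1] ⟶ [y, 1]` is an `a` with `[x, a] = [y, 1]`; by the defining relation `a` is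
  -- the value of a morphism `x ⟶ y`.
  full := ⟨fun {x y} a => by
    have h : point K x a.1 = point K y 1 := by
      rw [← mul_one a.1, ← smul_point]; exact a.2
    obtain ⟨f, hf⟩ := point_eq_iff.1 h
    exact ⟨f, Transport.hom_ext (hf.trans (one_mul _)).symm⟩⟩
  essSurj := ⟨fun ⟨y⟩ => by
    induction y using Quotient.inductionOn with
    | h p =>
      -- Since `[x, a] = a • [x, 1]`, every point is isomorphic to one in the image.
      let a : (fn (toTransport K)).obj p.1 ⟶ ⟨Quotient.mk _ p⟩ :=
        ⟨p.2, (smul_point p.2 p.1 1).trans (by rw [mul_one]; rfl)⟩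
      have := IsGroupoid.all_isIso a
      exact ⟨p.1, ⟨asIso a⟩⟩⟩

/-- The comparison map runs from the groupoid to the transport groupoid, so its pseudo-inverse is
the 1-cell wanted here. -/
lemma exists_transport_equivalence (K : FinGpd κ G) :
    ∃ (X : FinGSet κ G) (e : (transport id).obj X ⟶ K), IsEquivalenceCell e := by
  obtain ⟨e, -⟩ := (isEquivalenceCell (toTransport K)).exists_equivalence
  exact ⟨toGSet K, e.inv, ⟨e.hom, ⟨e.counit⟩, ⟨e.unit.symm⟩⟩⟩

end FinGpd

/-- Spans of fused `G`-sets are built from ordinary `G`-maps, so each has a lift; only the relation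
between spans becomes coarser. -/
lemma exists_incl_map_eq {X Y : SpanCat (FinGSet .plain G)}
    (f : (SpanCat.map (FinGSet.incl (κ := .plain) (κ' := .fused) (G := G) fun _ => rfl)).obj X ⟶
      (SpanCat.map (FinGSet.incl (κ := .plain) (κ' := .fused) (G := G) fun _ => rfl)).obj Y) :
    ∃ g : X ⟶ Y,
      (SpanCat.map (FinGSet.incl (κ := .plain) (κ' := .fused) fun _ => rfl)).map g = f := by
  obtain ⟨S, rfl⟩ := Span.exists_toHom f
  exact ⟨(Span.mk (FinGSet.inclObj .plain S.apex)
    (FinGSet.inclMap .plain S.left) (FinGSet.inclMap .plain S.right)).toHom, rfl⟩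

variable [Finite G]

instance : (SpanCat.map (transport (κ := κ) (κ' := κ) (G := G) id)).IsEquivalence :=
  Span.map_isEquivalence _ FinGpd.exists_transport_equivalence FinGpd.exists_transport_map
    FinGpd.isIsomorphic_of_transport

instance : (SpanCat.map (FinGSet.incl (κ := .plain) (κ' := .fused) (G := G) fun _ => rfl)).Full :=
  ⟨exists_incl_map_eq⟩

instance : (SpanCat.map
    (FinGSet.incl (κ := .plain) (κ' := .fused) (G := G) fun _ => rfl)).EssSurj :=
  ⟨fun X => ⟨⟨FinGSet.inclObj .plain X.as⟩, ⟨Iso.refl _⟩⟩⟩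

end TransportEquivalence


/-! ### Linear functors that factor through a quotient of the span category -/

section Factorization

variable {k : Type*} [CommRing k] {C D : Type*} [Category* C] [MonoidEnriched C]
  [Category* D] [MonoidEnriched D] {A : Type*} [Category* A] [Preadditive A] [Linear k A]

/-- A linear functor on a linearization which identifies all morphisms identified by a full and
essentially surjective functor factors through its linear extension. -/
lemma Linearization.exists_factorization (F : C ⥤ D) [MonoidEnriched.IsAdditive F] [F.Full]
    [F.EssSurj] (M : Linearization k C ⥤ A) [M.Additive] [M.Linear k]
    (hM : ∀ {X Y : C} (f g : X ⟶ Y), F.map f = F.map g →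
      M.map (linHom k f) = M.map (linHom k g)) :
    ∃ N : Linearization k D ⥤ A, N.Additive ∧ N.Linear k ∧
      Nonempty (M ≅ Linearization.map k F ⋙ N) := by
  -- Choose a preimage of every object and, by fullness, of every morphism conjugated into the
  -- image. The hypothesis on `M` makes the choices harmless.
  let e (Y : D) := F.objObjPreimageIso Y
  let p {Y Z : D} (f : Y ⟶ Z) : F.objPreimage Y ⟶ F.objPreimage Z :=
    F.preimage ((e Y).hom ≫ f ≫ (e Z).inv)
  have hp {Y Z : D} (f : Y ⟶ Z) : F.map (p f) = (e Y).hom ≫ f ≫ (e Z).inv := F.map_preimage _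
  -- The factorization is built on `D` first and extended linearly afterwards. This avoids
  -- determining which linear combinations the linearization of `F` kills.
  let N₀ : D ⥤ A :=
    { obj := fun Y => M.obj ⟨F.objPreimage Y⟩
      map := fun f => M.map (linHom k (p f))
      map_id := fun Y => by
        rw [hM (p (𝟙 Y)) (𝟙 _) (by simp [hp]), linHom_id, CategoryTheory.Functor.map_id]
      map_comp := fun f g => by
        rw [hM (p (f ≫ g)) (p f ≫ p g) (by simp [hp]), linHom_comp, Functor.map_comp] }
  have zero : ∀ X Y : D, N₀.map (0 : X ⟶ Y) = 0 := fun X Y => by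
    refine (hM (p 0) 0 ?_).trans ?_
    · rw [hp, MonoidEnriched.zero_comp, MonoidEnriched.comp_zero,
        MonoidEnriched.IsAdditive.map_zero]
    · rw [linHom_zero, Functor.map_zero]
  have add : ∀ {X Y : D} (f g : X ⟶ Y), N₀.map (f + g) = N₀.map f + N₀.map g := fun f g => by
    refine (hM (p (f + g)) (p f + p g) ?_).trans ?_
    · rw [hp, MonoidEnriched.add_comp, MonoidEnriched.comp_add,
        MonoidEnriched.IsAdditive.map_add, hp, hp]
    · rw [linHom_add, Functor.map_add]
  -- A lift of the chosen isomorphism between `F X` and the image of its preimage. The lifts need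
  -- not be inverse in `C`, but their composites have identities as images under `F`, which is
  -- enough after applying `M`.
  let φ (X : C) : M.obj ⟨X⟩ ≅ M.obj ⟨F.objPreimage (F.obj X)⟩ :=
    { hom := M.map (linHom k (F.preimage (e (F.obj X)).inv))
      inv := M.map (linHom k (F.preimage (e (F.obj X)).hom))
      hom_inv_id := by
        rw [← Functor.map_comp, ← linHom_comp, hM _ (𝟙 _) (by simp), linHom_id,
          CategoryTheory.Functor.map_id]
      inv_hom_id := by
        rw [← Functor.map_comp, ← linHom_comp, hM _ (𝟙 _) (by simp), linHom_id,
          CategoryTheory.Functor.map_id] }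
  refine ⟨Linearization.lift N₀ zero add, inferInstance, inferInstance,
    ⟨NatIso.ofComponents (fun X => φ X.as) fun {X Y} f => ?_⟩⟩
  -- Both functors are linear, so naturality has to be checked on morphisms of `C` only.
  refine Linearization.map_ext (M := M)
    (N := Linearization.map k F ⋙ Linearization.lift N₀ zero add) (fun X => (φ X).hom)
    (fun {X Y} f => ?_) f
  have h : (Linearization.map k F ⋙ Linearization.lift N₀ zero add).map (linHom k f) =
      M.map (linHom k (p (F.map f))) :=
    (congrArg (Linearization.lift N₀ zero add).map (map_linHom F f)).trans
      (Linearization.lift_map_linHom N₀ zero add (F.map f))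
  rw [h]
  change M.map _ ≫ M.map _ = M.map _ ≫ M.map _
  rw [← Functor.map_comp, ← Functor.map_comp, ← linHom_comp, ← linHom_comp]
  exact hM _ _ (by simp [hp])

end Factorization

/-! ### Twisted spans of `G`-sets and orbit decomposition -/

section FusedSpans

variable {G : Type u} [Group G]

namespace FinGSet

variable {κ : Kind}

lemma isEquivalenceCell_of_bijective {X Y : FinGSet κ G} {f : X ⟶ Y}
    (hf : Function.Bijective (app f)) : IsEquivalenceCell f := by
  let e := Equiv.ofBijective _ hf
  refine ⟨ofMap e.symm fun a y => ?_, isIsomorphic (ofEq fun x => e.symm_apply_apply x),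
    isIsomorphic (ofEq fun y => e.apply_symm_apply y)⟩
  rw [e.symm_apply_eq]
  exact ((app_smul f a _).trans (congrArg (a • ·) (e.apply_symm_apply y))).symm

/-- An equivalence of fused `G`-sets is an honest bijection. Injectivity holds because `x` is
recovered from `f x` as `τ(x) • g(f x)`, where `τ(x)` also depends on `f x` alone. Surjectivity
holds because the twist of `g ≫ f` can be moved inside `f` by equivariance. -/
lemma bijective_of_isTwist {X Y : FinGSet κ G} {f : X ⟶ Y} {g : Y ⟶ X}
    (h : IsTwist (f ≫ g) (𝟙 X)) (h' : IsTwist (g ≫ f) (𝟙 Y)) : Function.Bijective (app f) := by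
  obtain ⟨τ, hτ, h⟩ := h
  obtain ⟨σ, -, h'⟩ := h'
  refine ⟨fun x y e => ?_, fun y => ⟨σ y • app g y, (app_smul f _ _).trans (h' y)⟩⟩
  -- Applying the twisting rule to `x = τ(x) • g(f x)` conjugates the value at `g(f x)` by `τ(x)`;
  -- cancelling gives the equality.
  have key : ∀ x, τ x = τ (app g (app f x)) := fun x => by
    have := hτ (τ x) (app g (app f x))
    rw [show τ x • app g (app f x) = x from h x] at this
    exact mul_left_cancel ((mul_inv_eq_iff_eq_mul.1 this.symm).symm)
  have hx : τ x • app g (app f x) = x := h x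
  have hy : τ y • app g (app f y) = y := h y
  rw [key, e, ← key, hy] at hx
  exact hx.symm

/-- The part of a `G`-set away from the orbit of a point. -/
def orbitCompl (X : FinGSet κ G) (x : X.carrier) : FinGSet κ G where
  carrier := {y : X.carrier // y ∉ MulAction.orbit G x}
  mulAction :=
    { smul := fun a y => ⟨a • y.1, fun h => y.2 (by
        obtain ⟨b, hb⟩ := h
        exact ⟨a⁻¹ * b, (mul_smul _ _ _).trans (inv_smul_eq_iff.2 hb)⟩)⟩
      one_smul := fun y => Subtype.ext (one_smul G y.1)
      mul_smul := fun a b y => Subtype.ext (mul_smul a b y.1) }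

/-- The inclusion of the complement of an orbit. -/
def orbitComplIncl (X : FinGSet κ G) (x : X.carrier) : orbitCompl X x ⟶ X :=
  ofMap (fun y => y.1) fun _ _ => rfl

/-- The induction measure for splitting off one orbit at a time. -/
lemma card_orbitCompl (X : FinGSet κ G) (x : X.carrier) :
    Nat.card (orbitCompl X x).carrier < Nat.card X.carrier :=
  Finite.card_subtype_lt (x := x) (not_not.2 (MulAction.mem_orbit_self x))

end FinGSet

open FinGSet

/-- The inclusion of an orbit. -/
def orbitIncl [Finite G] (X : FinGSet .plain G) (x : X.carrier) :
    cosets (MulAction.stabilizer G x) ⟶ X :=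
  ofMap (X := cosets (MulAction.stabilizer G x)) (MulAction.ofQuotientStabilizer G x)
    (MulAction.ofQuotientStabilizer_smul G x)

/-- The orbit of `x` is `G` modulo its stabilizer, and what remains is again a `G`-set. Coproducts
of middle objects are sums of spans, so a Mackey functor can be examined one orbit at a time. -/
lemma isCoproduct_orbit [Finite G] (X : FinGSet .plain G) (x : X.carrier) :
    IsCoproduct (orbitIncl X x) (orbitComplIncl X x) := by
  refine isCoproduct ⟨(MulAction.injective_ofQuotientStabilizer G x).sumElim
    Subtype.val_injective fun y z h => z.2 ?_, fun y => ?_⟩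
  · exact Set.mem_of_eq_of_mem h.symm (MulAction.ofQuotientStabilizer_mem_orbit G x y)
  · by_cases hy : y ∈ MulAction.orbit G x
    · obtain ⟨a, rfl⟩ := hy
      exact ⟨.inl (QuotientGroup.mk a), rfl⟩
    · exact ⟨.inr ⟨y, hy⟩, rfl⟩

/-- The twisting map given by conjugation with elements of a centralizer. -/
lemma isTwist_conj [Finite G] (H : Subgroup G) (a : Subgroup.centralizer (H : Set G)) :
    IsTwist (𝟙 (cosets H)) (conj H a) := by
  -- The twist at the coset of `g` is `g * a * g⁻¹`, independent of the representative because `a`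
  -- commutes with `H`; it takes `gH` to `gaH`.
  refine ⟨fun x : G ⧸ H => Quotient.liftOn' x (fun g => g * a * g⁻¹) fun g g' h => ?_,
    fun b x => ?_, fun x => ?_⟩
  · rw [QuotientGroup.leftRel_apply] at h
    have h' := Subgroup.mem_centralizer_iff.1 a.2 _ h
    calc g * a * g⁻¹ = g * (a * (g⁻¹ * g')) * g'⁻¹ := by group
      _ = g * (g⁻¹ * g' * a) * g'⁻¹ := by rw [h']
      _ = g' * a * g'⁻¹ := by group
  · induction x using Quotient.inductionOn' with
    | h g =>
      change (b * g) * a * (b * g)⁻¹ = b * (g * a * g⁻¹) * b⁻¹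
      group
  · induction x using Quotient.inductionOn' with
    | h g =>
      change (QuotientGroup.mk (g * a * g⁻¹ * g) : G ⧸ H) = QuotientGroup.mk (g * a)
      rw [inv_mul_cancel_right]

lemma Span.IsSum.toHom {B : Type u} [Bicategory.{w, v} B] [Spannable B] {X Y : B}
    {S T R : Span X Y} (h : IsSum S T R) : S.toHom + T.toHom = R.toHom :=
  Quotient.sound ((isSum S T).equiv h (.refl _) (.refl _))

/-- Spans of `G`-sets which become equivalent as spans of fused `G`-sets. -/
def Span.FusedEquiv {X Y : FinGSet .plain G} (S S' : Span X Y) : Prop :=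
  (S.map (incl (κ' := .fused) fun _ => rfl)).Equiv (S'.map (incl (κ' := .fused) fun _ => rfl))

lemma Span.fusedEquiv_of_isTwist {X Y A : FinGSet .plain G} {l l' : A ⟶ X} {r r' : A ⟶ Y}
    (h : IsTwist l l') (h' : IsTwist r r') : FusedEquiv (mk A l r) (mk A l' r') :=
  ⟨𝟙 _, ⟨𝟙 _, isIsomorphic_refl _, isIsomorphic_refl _⟩, isTwist_iff.1 h, isTwist_iff.1 h'⟩

/-- An equivalence of middle objects in the fused 2-category is an ordinary isomorphism of `G`-sets.
All fusion is thereby confined to the legs, which can be treated separately. -/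
lemma Span.FusedEquiv.exists_bijective {X Y : FinGSet .plain G} {S S' : Span X Y}
    (h : S.FusedEquiv S') : ∃ s : S.apex ⟶ S'.apex, Function.Bijective (app s) ∧
      IsTwist S.left (s ≫ S'.left) ∧ IsTwist S.right (s ≫ S'.right) := by
  obtain ⟨s, ⟨t, h₁, h₂⟩, h₃, h₄⟩ := h
  exact ⟨inclMap .plain s, bijective_of_isTwist (isTwist_iff.2 h₁) (isTwist_iff.2 h₂),
    isTwist_iff.2 h₃, isTwist_iff.2 h₄⟩

/-! ### Conjugation-invariant Mackey functors do not see twists -/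

section Invariance

variable [Finite G] {k : Type w'} [CommRing k] {M : MackeyGrp.{m} k G}

/-- On the orbit of `x`, a twist of a `G`-map by `τ` amounts to precomposition with conjugation by
`τ(x)`. The corresponding span factors through the conjugation span of the orbit, which acts as the
identity by hypothesis. -/
lemma map_eq_of_isTwist_right (hM : isConjugationInvariant k G M) {X Y A : FinGSet .plain G}
    (l : A ⟶ X) {r r' : A ⟶ Y} (h : IsTwist r r') :
    M.obj.map (linHom k (Span.mk A l r).toHom) = M.obj.map (linHom k (Span.mk A l r').toHom) := by
  have := M.property.1
  -- The orbit of a point is split off; its complement has fewer elements and inherits the twist by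
  -- restriction.
  induction hn : Nat.card A.carrier using Nat.strong_induction_on generalizing A with
  | h n ih =>
    obtain ⟨τ, h₁, h₂⟩ := h
    rcases isEmpty_or_nonempty A.carrier with hA | ⟨⟨x⟩⟩
    · rw [FinGSet.hom_ext (f := r) (g := r') fun x => (hA.false x).elim]
    · have sum : ∀ r : A ⟶ Y, (Span.mk (cosets _) (orbitIncl A x ≫ l) (orbitIncl A x ≫ r)).toHom +
          (Span.mk (orbitCompl A x) (orbitComplIncl A x ≫ l) (orbitComplIncl A x ≫ r)).toHom =
          (Span.mk A l r).toHom := fun r =>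
        Span.IsSum.toHom ⟨orbitIncl A x, orbitComplIncl A x, isCoproduct_orbit A x,
          isIsomorphic_refl _, isIsomorphic_refl _, isIsomorphic_refl _, isIsomorphic_refl _⟩
      rw [← sum, ← sum, linHom_add, linHom_add, Functor.map_add, Functor.map_add,
        ih _ (hn ▸ card_orbitCompl A x) (orbitComplIncl A x ≫ l) (r := orbitComplIncl A x ≫ r)
          (r' := orbitComplIncl A x ≫ r') ⟨fun y => τ y.1, fun a y => h₁ a y.1,
            fun y => h₂ y.1⟩ rfl]
      congr 1
      -- For `g` fixing `x`, the rule `τ(g • x) = g * τ(x) * g⁻¹` says that `τ(x)` commutes with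
      -- `g`.
      let a : Subgroup.centralizer (MulAction.stabilizer G x : Set G) :=
        ⟨τ x, Subgroup.mem_centralizer_iff.2 fun g hg => by
          have := h₁ g x
          rw [show g • x = x from hg] at this
          rw [eq_mul_inv_iff_mul_eq] at this
          exact this.symm⟩
      -- At `g • x` both sides equal `g • τ(x) • r(x)`, the right side because `r` is equivariant.
      have hr : orbitIncl A x ≫ r' = (𝟙 _ ≫ conj _ a) ≫ orbitIncl A x ≫ r :=
        FinGSet.hom_ext fun y => by
          induction y using Quotient.inductionOn' with
          | h g =>
            change app r' (g • x) = app r ((g * τ x) • x)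
            rw [app_smul, app_smul, mul_smul, h₂]
      rw [hr]
      -- The span on the orbit with leg `r'` is the composite of three: the left leg backwards,
      -- conjugation by `a`, and the right leg `r` forwards. After removal of the middle one, `e₃`
      -- recomposes the rest into the span with leg `r`.
      have e₁ := Span.toHom_comp_right
        (Span.mk (cosets (MulAction.stabilizer G x)) (orbitIncl A x ≫ l) (𝟙 _)) (conj _ a)
      have e₂ := Span.toHom_comp_right (Span.mk (cosets (MulAction.stabilizer G x))
        (orbitIncl A x ≫ l) (𝟙 _ ≫ conj _ a)) (orbitIncl A x ≫ r)
      have e₃ := Span.toHom_comp_right (Span.mk (cosets (MulAction.stabilizer G x))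
        (orbitIncl A x ≫ l) (𝟙 _)) (orbitIncl A x ≫ r)
      have e : M.obj.map (linHom k (Span.mk (cosets (MulAction.stabilizer G x)) (𝟙 _)
        (conj _ a)).toHom) = 𝟙 _ := hM _ a
      rw [← e₂, ← e₁, linHom_comp, linHom_comp, Functor.map_comp, Functor.map_comp, e,
        Category.comp_id, ← Functor.map_comp, ← linHom_comp, e₃]
      rfl

/-- By equivariance a twist `l'` of `l` is `l` precomposed with the automorphism `c : x ↦ τ(x) • x`
of the middle object. Transporting the span along `c` restores the left leg and twists the right leg
by `τ⁻¹`, which is the case already treated. -/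
lemma map_eq_of_isTwist_left (hM : isConjugationInvariant k G M) {X Y A : FinGSet .plain G}
    {l l' : A ⟶ X} (r : A ⟶ Y) (h : IsTwist l l') :
    M.obj.map (linHom k (Span.mk A l r).toHom) = M.obj.map (linHom k (Span.mk A l' r).toHom) := by
  obtain ⟨τ, h₁, h₂⟩ := h
  -- `τ(x)` commutes with itself, so `τ` does not change along `x ↦ τ(x) • x`; hence `c` and `d`
  -- below are mutually inverse.
  have hτ : ∀ x, τ (τ x • x) = τ x := fun x => by rw [h₁, mul_inv_cancel_right]
  have hτ' : ∀ x, τ ((τ x)⁻¹ • x) = τ x := fun x => by rw [h₁]; group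
  let c : A ⟶ A := ofMap (fun x => τ x • x) fun a x => by
    rw [h₁, smul_smul, smul_smul, inv_mul_cancel_right]
  let d : A ⟶ A := ofMap (fun x => (τ x)⁻¹ • x) fun a x => by
    rw [h₁, smul_smul, smul_smul]; group
  have hcd : c ≫ d = 𝟙 A := FinGSet.hom_ext fun x => by
    change (τ (τ x • x))⁻¹ • τ x • x = x
    rw [hτ, inv_smul_smul]
  have hdc : d ≫ c = 𝟙 A := FinGSet.hom_ext fun x => by
    change τ ((τ x)⁻¹ • x) • (τ x)⁻¹ • x = x
    rw [hτ', smul_inv_smul]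
  have hc : IsEquivalenceCell c := ⟨d, ⟨eqToIso hcd⟩, ⟨eqToIso hdc⟩⟩
  have hl : l' = c ≫ l := FinGSet.hom_ext fun x => (h₂ x).symm.trans (app_smul l _ _).symm
  have hr : r = c ≫ d ≫ r := FinGSet.hom_ext fun x =>
    congrArg (app r) (congrArg (fun f : A ⟶ A => app f x) hcd).symm
  have ht : IsTwist r (d ≫ r) := ⟨fun x => (τ x)⁻¹, fun a x => by
    change (τ (a • x))⁻¹ = a * (τ x)⁻¹ * a⁻¹
    rw [h₁]; group, fun x => (app_smul r _ _).symm⟩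
  -- The span with legs `l'` and `r` is the pullback along `c` of the one with legs `l` and `d ≫ r`.
  have e := Span.toHom_of_equivalence hc l (d ≫ r)
  rw [← hl, ← hr] at e
  rw [e]
  exact map_eq_of_isTwist_right hM l ht

/-- The two legs are untwisted one after the other; what remains is an ordinary isomorphism of spans
given by the bijection `s`. -/
lemma map_eq_of_fusedEquiv (hM : isConjugationInvariant k G M) {X Y : FinGSet .plain G}
    {S S' : Span X Y} (h : S.FusedEquiv S') :
    M.obj.map (linHom k S.toHom) = M.obj.map (linHom k S'.toHom) := by
  obtain ⟨s, hs, hl, hr⟩ := h.exists_bijective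
  exact (map_eq_of_isTwist_left hM S.right hl).trans ((map_eq_of_isTwist_right hM _ hr).trans
    (congrArg (fun f => M.obj.map (linHom k f))
      (Span.toHom_of_equivalence (isEquivalenceCell_of_bijective hs) S'.left S'.right)))

/-- The target is left abstract so that the criterion covers both spans in the fused 2-category and
spans in Bouc's quotient category. All that matters is which spans of `G`-sets get identified. -/
lemma isConjugationInvariant_iff {E : Type*} [Category* E] [MonoidEnriched E]
    (F : SpanCat (FinGSet .plain G) ⥤ E) [MonoidEnriched.IsAdditive F] [F.Full] [F.EssSurj]
    (hF : ∀ {X Y : FinGSet .plain G} (S S' : Span X Y),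
      F.map S.toHom = F.map S'.toHom ↔ S.FusedEquiv S') :
    isConjugationInvariant k G M ↔ ∃ N : Linearization k E ⥤ ModuleCat.{m} k,
      N.Additive ∧ N.Linear k ∧ Nonempty (M.obj ≅ Linearization.map k F ⋙ N) := by
  constructor
  · intro hM
    have := M.property.1
    have := M.property.2
    refine Linearization.exists_factorization F M.obj fun f g h => ?_
    obtain ⟨S, rfl⟩ := Span.exists_toHom f
    obtain ⟨S', rfl⟩ := Span.exists_toHom g
    exact map_eq_of_fusedEquiv hM ((hF S S').1 h)
  · rintro ⟨N, -, -, ⟨e⟩⟩ H a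
    -- The conjugation span differs from the identity span by a twist of its right leg, so `F` sends
    -- both to the identity.
    have h : F.map (Span.mk (cosets H) (𝟙 _) (conj H a)).toHom = 𝟙 _ :=
      ((hF _ (Span.mk (cosets H) (𝟙 _) (𝟙 _))).2 (Span.Equiv.symm (Span.fusedEquiv_of_isTwist
        ⟨fun _ => 1, by simp, by simp⟩ (isTwist_conj H a)))).trans (F.map_id _)
    have h' : (Linearization.map k F).map (conjSpan k H a) = 𝟙 _ :=
      (map_linHom F (Span.mk (cosets H) (𝟙 _) (conj H a)).toHom).trans
        ((congrArg (linHom k) h).trans (linHom_id _))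
    -- Naturality of the isomorphism `e` carries the identity back from the factorization to `M`.
    rw [← cancel_mono (e.hom.app _), e.hom.naturality, Functor.comp_map, h',
      CategoryTheory.Functor.map_id, Category.id_comp]
    exact Category.comp_id _

end Invariance

lemma incl_map_eq_iff {X Y : FinGSet .plain G} (S S' : Span X Y) :
    (SpanCat.map (incl (κ' := .fused) fun _ => rfl)).map S.toHom =
      (SpanCat.map (incl (κ' := .fused) fun _ => rfl)).map S'.toHom ↔ S.FusedEquiv S' :=
  ⟨fun h => Quotient.exact h, fun h => Quotient.sound h⟩

/-- Isomorphism of spans in the quotient category is the same relation as equivalence of spans in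
the fused 2-category, since a twisting map is precisely an invertible 2-cell there. -/
lemma quotientFunctor_map_eq_iff {X Y : FinGSet .plain G} (S S' : Span X Y) :
    (FusedSpanCat.quotientFunctor G).map S.toHom =
      (FusedSpanCat.quotientFunctor G).map S'.toHom ↔ S.FusedEquiv S' :=
  ⟨fun h => FusedSpan.isIsom_ofSpan.1 (Quotient.exact h),
    fun h => Quotient.sound (FusedSpan.isIsom_ofSpan.2 h)⟩

instance : (FusedSpanCat.quotientFunctor G).Full where
  map_surjective {X Y} f := by
    obtain ⟨g, rfl⟩ := FusedSpanCat.ofHom_surjective f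
    obtain ⟨h, rfl⟩ := exists_incl_map_eq (X := X) (Y := Y) g
    exact ⟨h, rfl⟩

instance : (FusedSpanCat.quotientFunctor G).EssSurj :=
  ⟨fun X => ⟨⟨inclObj .plain X.as.as⟩, ⟨Iso.refl _⟩⟩⟩

variable [Finite G] (k : Type w') [CommRing k]

variable (G) in
lemma isBoucFused_eq : isBoucFused.{m} k G = isConjugationInvariant.{m} k G := by
  ext M
  exact (isConjugationInvariant_iff _ quotientFunctor_map_eq_iff).symm

variable (G) in
-- For the inclusion, a linear factorization of `M` is nothing but a Mackey functor on fused
-- `G`-sets restricting to `M`, so the general criterion reads off the essential image.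
lemma essImage_restrict_incl :
    (Mackey.restrict.{m} k (incl (κ := .plain) (κ' := .fused) (G := G) fun _ => rfl)).essImage =
      isConjugationInvariant.{m} k G := by
  ext M
  refine Iff.trans ?_ (isConjugationInvariant_iff _ incl_map_eq_iff).symm
  constructor
  · rintro ⟨N, ⟨e⟩⟩
    exact ⟨N.obj, N.property.1, N.property.2, ⟨(ObjectProperty.ι _).mapIso e.symm⟩⟩
  · rintro ⟨N, h, h', ⟨e⟩⟩
    exact ⟨⟨N, h, h'⟩, ⟨ObjectProperty.isoMk _ e.symm⟩⟩

open Limits in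
variable (G) in
-- For fixed `H` and `a`, invariance equates an endomorphism of evaluation at `G/H` with the
-- identity. Evaluation is exact on Mackey functors, as these are closed under finite limits and
-- colimits among all functors.
lemma isClosedUnderFinite_isConjugationInvariant :
    IsClosedUnderFinite (isConjugationInvariant.{m} k G) := by
  have := (isClosedUnderFinite_isMackeyFunctor.{m} k (FinGSet .plain G)).preservesFiniteLimits
  have := (isClosedUnderFinite_isMackeyFunctor.{m} k (FinGSet .plain G)).preservesFiniteColimits
  refine .all fun H => .all fun a => ?_
  let E : MackeyGrp.{m} k G ⥤ ModuleCat.{m} k :=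
    (isMackeyFunctor k _).ι ⋙ (evaluation _ _).obj ⟨⟨cosets H⟩⟩
  have : PreservesFiniteLimits E := comp_preservesFiniteLimits _ _
  have : PreservesFiniteColimits E := comp_preservesFiniteColimits _ _
  exact .of_app_eq (E := E) (E' := E)
    (Functor.whiskerLeft _ ((evaluation _ _).map (conjSpan k H a))) (𝟙 E)

end FusedSpans

/-! ### Composition of restriction functors and the theorem -/

section Restrictions

/-- Comparing the induced functors on spans is enough. This avoids asking for an equality of
pseudofunctors, whose coherence cells would also have to match. -/
lemma restrict_comp_restrict (k : Type w') [CommRing k] {A : Type*} [Bicategory A] [Spannable A]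
    {B : Type*} [Bicategory B] [Spannable B] {C : Type*} [Bicategory C] [Spannable C]
    {F : A ⥤ᵖ B} {H : B ⥤ᵖ C} {K : A ⥤ᵖ C} [PreservesSpans F] [PreservesSpans H]
    [PreservesSpans K] (h : SpanCat.map F ⋙ SpanCat.map H = SpanCat.map K) :
    Mackey.restrict.{m} k H ⋙ Mackey.restrict.{m} k F = Mackey.restrict.{m} k K := by
  have e := Linearization.map_comp_map_eq (k := k) h
  unfold Mackey.restrict
  simp only [← e]
  rfl

end Restrictions

end FusedMackey

open FusedMackey
theorem mainTheorem6 (k : Type w') [CommRing k] (G : Type u) [Group G] [Finite G] :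
    let setPlainOfFused : Mackey.{u, u, u+1, w', m} k (FinGSet .fused G) ⥤ MackeyGrp.{m} k G :=
      Mackey.restrict k (FinGSet.incl fun _ => rfl)
    let gpdPlainOfFused : Mackey.{u, u, u+1, w', m} k (FinGpd .fused G) ⥤
        Mackey.{u, u, u+1, w', m} k (FinGpd .plain G) :=
      Mackey.restrict k (FinGpd.incl fun _ => rfl)
    let plainSetOfGpd : Mackey.{u, u, u+1, w', m} k (FinGpd .plain G) ⥤ MackeyGrp.{m} k G :=
      Mackey.restrict k (transport id)
    let fusedSetOfGpd : Mackey.{u, u, u+1, w', m} k (FinGpd .fused G) ⥤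
        Mackey.{u, u, u+1, w', m} k (FinGSet .fused G) :=
      Mackey.restrict k (transport id)
    let Φ : Mackey.{u, u, u+1, w', m} k (FinGpd .fused G) ⥤ MackeyGrp.{m} k G := toMackeyGrp k G
    -- all the functors are `k`-linear
    (setPlainOfFused.Additive ∧ setPlainOfFused.Linear k) ∧
    (gpdPlainOfFused.Additive ∧ gpdPlainOfFused.Linear k) ∧
    (plainSetOfGpd.Additive ∧ plainSetOfGpd.Linear k) ∧
    (fusedSetOfGpd.Additive ∧ fusedSetOfGpd.Linear k) ∧
    (Φ.Additive ∧ Φ.Linear k) ∧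
    -- the square commutes, with diagonal `Φ`
    gpdPlainOfFused ⋙ plainSetOfGpd = Φ ∧
    fusedSetOfGpd ⋙ setPlainOfFused = Φ ∧
    -- the horizontal functors are equivalences
    plainSetOfGpd.IsEquivalence ∧
    fusedSetOfGpd.IsEquivalence ∧
    -- the full image of `Φ`
    Φ.Full ∧ Φ.Faithful ∧
    Φ.essImage = isBoucFused.{m} k G ∧
    isBoucFused.{m} k G = isConjugationInvariant.{m} k G ∧
    -- it is an abelian subcategory
    Nonempty (Abelian (MackeyGrp.{m} k G)) ∧
    Nonempty (Abelian (isBoucFused.{m} k G).FullSubcategory) ∧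
    Limits.PreservesFiniteLimits (isBoucFused.{m} k G).ι ∧
    Limits.PreservesFiniteColimits (isBoucFused.{m} k G).ι := by
  intro setPlainOfFused gpdPlainOfFused plainSetOfGpd fusedSetOfGpd Φ
  -- On objects and on representing spans both composites give the same transport groupoids and
  -- functors by definition.
  have h₁ : gpdPlainOfFused ⋙ plainSetOfGpd = Φ := restrict_comp_restrict k
    (CategoryTheory.Functor.ext (fun _ => rfl) fun X Y f => by
      obtain ⟨S, rfl⟩ := Span.exists_toHom f
      exact ((Category.id_comp _).trans (Category.comp_id _)).symm)
  have h₂ : fusedSetOfGpd ⋙ setPlainOfFused = Φ := restrict_comp_restrict k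
    (CategoryTheory.Functor.ext (fun _ => rfl) fun X Y f => by
      obtain ⟨S, rfl⟩ := Span.exists_toHom f
      exact ((Category.id_comp _).trans (Category.comp_id _)).symm)
  have e₁ : plainSetOfGpd.IsEquivalence := restrict_isEquivalence k _
  have e₂ : fusedSetOfGpd.IsEquivalence := restrict_isEquivalence k _
  have full : setPlainOfFused.Full := restrict_full k _
  have faithful : setPlainOfFused.Faithful := restrict_faithful k _
  -- `Φ` is an equivalence followed by restriction along the inclusion into fused `G`-sets, and
  -- essential surjectivity of the equivalence leaves the essential image unchanged.
  have image : Φ.essImage = isConjugationInvariant.{m} k G := by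
    rw [← essImage_restrict_incl.{m} G k, ← h₂]
    ext M
    constructor
    · rintro ⟨N, ⟨e⟩⟩
      exact ⟨_, ⟨e⟩⟩
    · rintro ⟨N, ⟨e⟩⟩
      exact ⟨fusedSetOfGpd.objPreimage N,
        ⟨setPlainOfFused.mapIso (fusedSetOfGpd.objObjPreimageIso N) ≪≫ e⟩⟩
  have closed := isClosedUnderFinite_isConjugationInvariant.{m} G k
  -- Closure is clear for conjugation invariance, which is equational, and is carried over to Bouc's
  -- definition by the equality of the two properties.
  rw [← isBoucFused_eq.{m} G k] at closed
  exact ⟨⟨inferInstance, inferInstance⟩, ⟨inferInstance, inferInstance⟩,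
    ⟨inferInstance, inferInstance⟩, ⟨inferInstance, inferInstance⟩,
    ⟨inferInstanceAs (Mackey.restrict.{m} k _).Additive,
      inferInstanceAs ((Mackey.restrict.{m} k _).Linear k)⟩, h₁, h₂, e₁, e₂,
    h₂ ▸ inferInstanceAs (fusedSetOfGpd ⋙ setPlainOfFused).Full,
    h₂ ▸ inferInstanceAs (fusedSetOfGpd ⋙ setPlainOfFused).Faithful,
    image.trans (isBoucFused_eq.{m} G k).symm, isBoucFused_eq.{m} G k, ⟨inferInstance⟩,
    ⟨closed.abelian⟩, closed.preservesFiniteLimits, closed.preservesFiniteColimits⟩
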